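/- Conventions. Manifolds are smooth Hausdorff manifolds modelled on Hausdorff locally convex topological vector spaces, and all maps, forms, actions and bundles are smooth. $\mathbb{T}$ is the unit circle; $A^q$ denotes real differential $q$-forms; for a Lie group $G$ with Lie algebra $\mathfrak{g}$ put $\mathfrak{g}^\dagger=\mathrm{Hom}(\mathfrak{g},\sqrt{-1}\,\mathbb{R})$, with pairing $\langle X|\xi\rangle$; a map $\lambda:Y\to\mathfrak g^\dagger$ is smooth if $(y,X)\mapsto\langle X|\lambda(y)\rangle$ is. $X^*$ denotes the tangent vector generated by the infinitesimal action of $X\in\mathfrak g$, and $\langle X|\mathrm{Ad}_g\xi\rangle=\langle \mathrm{Ad}_{g^{-1}}X|\xi\rangle$. For a surjective submersion $\pi:Y\to M$ (locally, up to diffeomorphism, a projection $M\times F\to M$), $Y^{[p]}$ is the $p$-fold fibre product, $\pi_i:Y^{[p]}\to Y^{[p-1]}$ omits the $i$-th factor, $\delta=\sum_i(-1)^{i-1}\pi_i^*$ on forms and functions, and $\delta P=\pi_1^*P\otimes\pi_2^*P^{\otimes -1}\otimes\cdots$ for a principal $\mathbb T$-bundle $P$; similarly for sections and connections. A bundle gerbe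 $\mathcal G=(Y,P,s)$ over $M$ is a surjective submersion $\pi:Y\to M$, a principal $\mathbb T$-bundle $P\to Y^{[2]}$ and a section $s:Y^{[3]}\to\delta P$ with $\delta s=1$. A connection on $\mathcal G$ is a connection $\nabla\in\sqrt{-1}A^1(P)$ on $P$ with $s^*(\delta\nabla)=0$; a curving for $\nabla$ is $f\in\sqrt{-1}A^2(Y)$ with $\delta f=F(\nabla)$. A pseudo $\mathbb T$-bundle for $\mathcal G$ is a pair $(R,v)$ of a principal $\mathbb T$-bundle $R\to Y$ and a section $v:Y^{[2]}\to\delta R^{\otimes -1}\otimes P$ with $\delta v=s$; a connection on $(R,v)$, for $(\mathcal G,\nabla,f)$, is a connection $\eta\in\sqrt{-1}A^1(R)$ on $R$ with $v^*(\delta\eta^{\otimes -1}\otimes\nabla)=0$. If a Lie group $G$ acts on $M$, then $\mathcal G$ is strongly $G$-equivariant if $G$ acts compatibly on $Y$ and, by bundle isomorphisms, on $P$, and $s$ is $G$-invariant; a pseudo $\mathbb T$-bundle $(R,v)$ for it is $G$-equivariant if $G$ acts on $R$ by bundle isomorphisms covering the action on $Y$ and $v$ is $G$-invariant. Setting. Let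 $G$ be a Lie group acting on $M$ and let $\mathcal G=(Y,P,s)$ be a strongly $G$-equivariant bundle gerbe over $M$ with $G$-invariant connection $\nabla$ and $G$-invariant curving $f$. Assume that the actions of $G$ on $M$ and on $Y$ are free and locally trivial and that $M/G$ and $\bar Y=Y/G$ are manifolds with smooth projections $q:M\to M/G$ and $Y\to\bar Y$. Let $\Xi\in A^1(M,\mathfrak g)$ be a connection on the principal $G$-bundle $q$. Let $\lambda:Y\to\mathfrak g^\dagger$ be a map such that $\delta\lambda=\tilde\lambda$, where $\tilde\lambda:Y^{[2]}\to\mathfrak g^\dagger$ is the moment of $(P,\nabla)$, $\langle X|\tilde\lambda(y_1,y_2)\rangle=\nabla(p;X^*)$ for $p\in P$ over $(y_1,y_2)$, and such that $\langle X|d\lambda\rangle+\iota_{X^*}f=0$ and $g^*\lambda=\mathrm{Ad}_g\lambda$ for all $X\in\mathfrak g$, $g\in G$. Put $\kappa=\langle\pi^*\Xi|\lambda\rangle\in\sqrt{-1}A^1(Y)$. Let $(\bar{\mathcal G},\bar\nabla,\bar f)$ be the reduction of $(\mathcal G,\nabla,f)$ with respect to $\lambda$ and $\Xi$: the bundle gerbe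 $\bar{\mathcal G}=(\bar Y,\bar P,\bar s)$ over $M/G$ with $\bar P=P/G$ and $\bar s$ induced by $s$, with the connection $\bar\nabla$ and the curving $\bar f$ whose pull-backs to $P$ and $Y$ are $\nabla-\delta\kappa$ and $f-d\kappa$. Proposition. Let $((R,v),\eta)$ be a $G$-equivariant pseudo $\mathbb T$-bundle with $G$-invariant connection for $(\mathcal G,\nabla,f)$, let $\rho:Y\to\mathfrak g^\dagger$ be its moment, $\langle X|\rho(y)\rangle=\eta(r;X^*)$ for $r\in R$ over $y$, and define $\mu:M\to\mathfrak g^\dagger$ by $\pi^*\mu=\rho-\lambda$. If $\mu=0$, then there is a pseudo $\mathbb T$-bundle with connection $((\bar R,\bar v),\bar\eta)$ for $(\bar{\mathcal G},\bar\nabla,\bar f)$ that is the quotient of $((R,v),\eta-\kappa)$ by $G$: $\bar R=R/G$ as a principal $\mathbb T$-bundle over $\bar Y$, the section $\bar v$ is induced by $v$, and the pull-back of $\bar\eta$ to $R$ is $\eta-\kappa$. -/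

import Mathlib

open Set Filter Topology

universe u v w

noncomputable section

/-! ### Smooth maps between locally convex spaces -/

section Calculus

variable {F : Type v} [AddCommGroup F] [Module ℝ F] [TopologicalSpace F]

/-- `d` is the directional derivative of `f` at `x` in the direction `h`. -/
def HasDirDeriv {E : Type u} [AddCommGroup E] [Module ℝ E]
    (f : E → F) (x h : E) (d : F) : Prop :=
  Tendsto (fun t : ℝ => t⁻¹ • (f (x + t • h) - f x)) (𝓝[≠] 0) (𝓝 d)

/-- The directional derivative as a function (only used where it exists). -/
def dirDeriv {E : Type u} [AddCommGroup E] [Module ℝ E]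
    (f : E → F) (x h : E) : F :=
  limUnder (𝓝[≠] (0 : ℝ)) (fun t : ℝ => t⁻¹ • (f (x + t • h) - f x))

/-- `f` is of class `C^k` on the open set `U`, in the sense of Bastiani, Michal and Hamilton: `f` is
continuous on `U`, all its directional derivatives exist on `U`, and `df` is of class `C^(k-1)` as a
function of the point and the direction jointly. -/
def IsCk : ℕ → ∀ {E : Type u} [AddCommGroup E] [Module ℝ E] [TopologicalSpace E],
    (E → F) → Set E → Prop
  | 0, _, _, _, _, f, U => ContinuousOn f U
  | k + 1, E, _, _, _, f, U => ContinuousOn f U ∧ ∃ df : E × E → F,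
      (∀ x ∈ U, ∀ h, HasDirDeriv f x h (df (x, h))) ∧ IsCk k df (U ×ˢ (univ : Set E))

/-- `f` is smooth (`C^∞`) on the open set `U`. -/
def IsCInf {E : Type u} [AddCommGroup E] [Module ℝ E] [TopologicalSpace E]
    (f : E → F) (U : Set E) : Prop :=
  ∀ k : ℕ, IsCk k f U

theorem IsCk.comp_linear (k : ℕ) {E : Type u} [AddCommGroup E] [Module ℝ E] [TopologicalSpace E]
    {E' : Type w} [AddCommGroup E'] [Module ℝ E'] [TopologicalSpace E']
    {f : E → F} {U : Set E} (L : E' →L[ℝ] E) (hf : IsCk k f U) :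
    IsCk k (fun x => f (L x)) (L ⁻¹' U) := by
  induction k generalizing E E' with
  | zero =>
    exact ContinuousOn.comp (t := U) hf L.continuous.continuousOn (fun x hx => hx)
  | succ k ih =>
    obtain ⟨hc, df, hd, hk⟩ := hf
    refine ⟨hc.comp L.continuous.continuousOn (fun x hx => hx),
      fun p => df (L p.1, L p.2), ?_, ?_⟩
    · intro x hx h
      have := hd (L x) hx (L h)
      simpa [HasDirDeriv] using this
    · have := ih (L.prodMap L) hk
      have hs : (L ⁻¹' U) ×ˢ (univ : Set E') = (L.prodMap L) ⁻¹' (U ×ˢ (univ : Set E)) := by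
        ext p
        simp
      rw [hs]
      exact this

theorem IsCk.mono (k : ℕ) {E : Type u} [AddCommGroup E] [Module ℝ E] [TopologicalSpace E]
    {f : E → F} {U V : Set E} (hf : IsCk k f U) (h : V ⊆ U) : IsCk k f V := by
  induction k generalizing E with
  | zero => exact ContinuousOn.mono hf h
  | succ k ih =>
    obtain ⟨hc, df, hd, hk⟩ := hf
    exact ⟨hc.mono h, df, fun x hx => hd x (h hx), ih hk (prod_mono h subset_rfl)⟩

theorem IsCk.prodMk (k : ℕ) {E : Type u} [AddCommGroup E] [Module ℝ E] [TopologicalSpace E]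
    {F' : Type w} [AddCommGroup F'] [Module ℝ F'] [TopologicalSpace F']
    {f : E → F} {g : E → F'} {U : Set E} (hf : IsCk k f U) (hg : IsCk k g U) :
    IsCk k (fun x => (f x, g x)) U := by
  induction k generalizing E with
  | zero => exact ContinuousOn.prodMk hf hg
  | succ k ih =>
    obtain ⟨hc, df, hd, hk⟩ := hf
    obtain ⟨hc', df', hd', hk'⟩ := hg
    exact ⟨hc.prodMk hc', fun p => (df p, df' p),
      fun x hx h => (hd x hx h).prodMk_nhds (hd' x hx h), ih hk hk'⟩

theorem isCk_linear (k : ℕ) {E : Type u} [AddCommGroup E] [Module ℝ E] [TopologicalSpace E]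
    (L : E →L[ℝ] F) (U : Set E) : IsCk k L U := by
  induction k generalizing E with
  | zero => exact L.continuous.continuousOn
  | succ k ih =>
    refine ⟨L.continuous.continuousOn, fun p => L p.2, ?_, ?_⟩
    · intro x _ h
      refine (tendsto_const_nhds (x := L h)).congr' ?_
      filter_upwards [self_mem_nhdsWithin] with t ht
      have ht' : t ≠ 0 := ht
      simp [smul_smul, ht']
    · exact ih (L.comp (ContinuousLinearMap.snd ℝ E E)) _

end Calculus

/-! ### Manifolds -/

/-- A smooth Hausdorff manifold modelled on a Hausdorff locally convex topological vector space. -/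
structure LCManifold : Type (u + 1) where
  carrier : Type u
  model : Type u
  [top : TopologicalSpace carrier]
  [t2 : T2Space carrier]
  [modelAdd : AddCommGroup model]
  [modelModule : Module ℝ model]
  [modelTop : TopologicalSpace model]
  [modelTopAdd : IsTopologicalAddGroup model]
  [modelSMul : ContinuousSMul ℝ model]
  [modelLC : LocallyConvexSpace ℝ model]
  [modelT2 : T2Space model]
  [charted : ChartedSpace model carrier]
  compatible : ∀ e ∈ atlas model carrier, ∀ e' ∈ atlas model carrier,
    IsCInf (fun x => e' (e.symm x)) (e.target ∩ e.symm ⁻¹' e'.source)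

namespace LCManifold

attribute [instance] top t2 modelAdd modelModule modelTop modelTopAdd modelSMul modelLC modelT2
  charted

instance : CoeSort LCManifold.{u} (Type u) := ⟨carrier⟩

/-- A Hausdorff locally convex space as a manifold. -/
abbrev ofSpace (E : Type u) [AddCommGroup E] [Module ℝ E] [TopologicalSpace E]
    [IsTopologicalAddGroup E] [ContinuousSMul ℝ E] [LocallyConvexSpace ℝ E] [T2Space E] :
    LCManifold.{u} where
  carrier := E
  model := E
  charted := chartedSpaceSelf E
  compatible := by
    intro e he e' he' k
    rw [chartedSpaceSelf_atlas] at he he'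
    subst he he'
    exact isCk_linear k (ContinuousLinearMap.id ℝ E) _

/-- The product manifold, with the products of charts as charts. -/
abbrev prod (M : LCManifold.{u}) (N : LCManifold.{v}) : LCManifold.{max u v} where
  carrier := M.carrier × N.carrier
  model := M.model × N.model
  charted :=
    { atlas := image2 OpenPartialHomeomorph.prod (atlas M.model M.carrier) (atlas N.model N.carrier)
      chartAt := fun x => (chartAt M.model x.1).prod (chartAt N.model x.2)
      mem_chart_source := fun x => ⟨mem_chart_source M.model x.1, mem_chart_source N.model x.2⟩
      chart_mem_atlas := fun x =>
        mem_image2_of_mem (chart_mem_atlas M.model x.1) (chart_mem_atlas N.model x.2) }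
  compatible := by
    rintro _ ⟨e₁, h₁, e₂, h₂, rfl⟩ _ ⟨e₁', h₁', e₂', h₂', rfl⟩ k
    have h := (((M.compatible e₁ h₁ e₁' h₁' k).comp_linear k
        (ContinuousLinearMap.fst ℝ M.model N.model)).mono k inter_subset_left).prodMk k
      (((N.compatible e₂ h₂ e₂' h₂' k).comp_linear k
        (ContinuousLinearMap.snd ℝ M.model N.model)).mono k inter_subset_right)
    refine h.mono k ?_
    rintro ⟨x, y⟩ ⟨hx, hy⟩
    exact ⟨⟨hx.1, hy.1⟩, ⟨hx.2, hy.2⟩⟩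

/-- The preferred chart at `x`; through it the tangent space at `x` is identified with the model
space, so that tangent vectors at `x` are elements of `M.model`. -/
abbrev chart (M : LCManifold.{u}) (x : M) : OpenPartialHomeomorph M.carrier M.model :=
  chartAt M.model x

/-- The tangent vector at `e.symm x` (in the preferred chart there) whose components in the chart
`e` are `h`. -/
def ofChart (M : LCManifold.{u}) (e : OpenPartialHomeomorph M.carrier M.model) (x h : M.model) :
    M.model :=
  dirDeriv (fun x' => M.chart (e.symm x) (e.symm x')) x h

end LCManifold

open LCManifold

/-- `f` is smooth on the open subset `W` of the manifold `M`. -/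
def SmoothOn {M : LCManifold.{u}} {N : LCManifold.{v}} (f : M → N) (W : Set M) : Prop :=
  ContinuousOn f W ∧ ∀ e ∈ atlas M.model M.carrier, ∀ e' ∈ atlas N.model N.carrier,
    IsCInf (fun x => e' (f (e.symm x))) (e.target ∩ e.symm ⁻¹' (W ∩ f ⁻¹' e'.source))

/-- `f` is smooth. -/
def Smooth {M : LCManifold.{u}} {N : LCManifold.{v}} (f : M → N) : Prop :=
  SmoothOn f univ

/-- The tangent map of `f` at `x`. -/
def tmap {M : LCManifold.{u}} {N : LCManifold.{v}} (f : M → N) (x : M) (h : M.model) : N.model :=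
  dirDeriv (fun x' => N.chart (f x) (f ((M.chart x).symm x'))) (M.chart x x) h

/-- The velocity of a curve. -/
def velocity {M : LCManifold.{u}} (c : ℝ → M) (t : ℝ) : M.model :=
  tmap (M := ofSpace ℝ) c t 1

/-- `c` is a smooth curve on the open set `I`. -/
def SmoothCurveOn {M : LCManifold.{u}} (c : ℝ → M) (I : Set ℝ) : Prop :=
  SmoothOn (M := ofSpace ℝ) c I

/-- `π` is a surjective submersion: it is onto, and around each point of `Y` it is, up to a
diffeomorphism, the projection of a product onto its first factor. In particular it has smooth
local sections, and its fibre products are submanifolds. -/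
structure IsSurjectiveSubmersion {Y M : LCManifold.{u}} (π : Y → M) : Prop where
  surjective : Function.Surjective π
  local_product : ∀ y : Y, ∃ (F : LCManifold.{u})
    (e : OpenPartialHomeomorph Y.carrier (M.prod F).carrier), y ∈ e.source ∧
      SmoothOn (N := M.prod F) e e.source ∧ SmoothOn (M := M.prod F) e.symm e.target ∧
      ∀ z ∈ e.source, (e z).1 = π z

/-! ### Differential forms -/

/-- `α` is a smooth 1-form on `M` with values in the locally convex space `F`. -/
structure IsOneForm (M : LCManifold.{u}) {F : Type v} [AddCommGroup F] [Module ℝ F]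
    [TopologicalSpace F] (α : M → M.model → F) : Prop where
  linear : ∀ x, IsLinearMap ℝ (α x)
  smooth : ∀ e ∈ atlas M.model M.carrier,
    IsCInf (fun p : M.model × M.model => α (e.symm p.1) (M.ofChart e p.1 p.2))
      (e.target ×ˢ (univ : Set M.model))

/-- `ω` is a smooth real-valued 2-form on `M`. -/
structure IsTwoForm (M : LCManifold.{u}) (ω : M → M.model → M.model → ℝ) : Prop where
  linear : ∀ x h, IsLinearMap ℝ (ω x h)
  alternating : ∀ x h k, ω x h k = - ω x k h
  smooth : ∀ e ∈ atlas M.model M.carrier,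
    IsCInf (fun p : M.model × (M.model × M.model) =>
        ω (e.symm p.1) (M.ofChart e p.1 p.2.1) (M.ofChart e p.1 p.2.2))
      (e.target ×ˢ (univ : Set (M.model × M.model)))

/-- The exterior derivative of a real-valued 1-form, computed at `x` in the preferred chart at `x`:
`dα(h, k) = D_h (α(k)) - D_k (α(h))` for constant vector fields `h`, `k`. -/
def extD (M : LCManifold.{u}) (α : M → M.model → ℝ) (x : M) (h k : M.model) : ℝ :=
  dirDeriv (fun u => α ((M.chart x).symm u) (M.ofChart (M.chart x) u k)) (M.chart x x) h -
    dirDeriv (fun u => α ((M.chart x).symm u) (M.ofChart (M.chart x) u h)) (M.chart x x) k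

/-! ### Lie groups and actions -/

/-- The group structure of `G` makes the manifold `G` a Lie group. Its Lie algebra, the tangent
space at `1`, is then `G.model`. -/
structure IsLieGroup (G : LCManifold.{u}) [Group G] : Prop where
  smooth_mul : Smooth (M := G.prod G) (N := G) (fun p => p.1 * p.2)
  smooth_inv : Smooth (M := G) (N := G) (fun g => g⁻¹)

/-- The adjoint action of `G` on its Lie algebra. -/
def Ad {G : LCManifold.{u}} [Group G] (g : G) (X : G.model) : G.model :=
  tmap (M := G) (N := G) (fun h => g * h * g⁻¹) 1 X

/-- The (left) action of `G` on `M` is smooth. -/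
def IsSmoothAction (G M : LCManifold.{u}) [Group G] [MulAction G M] : Prop :=
  Smooth (M := G.prod M) (N := M) (fun p => p.1 • p.2)

/-- The tangent vector `X^*` at `x` generated by the infinitesimal action of `X`. -/
def infAct {G M : LCManifold.{u}} [Group G] [MulAction G M] (X : G.model) (x : M) : M.model :=
  tmap (M := G) (N := M) (fun g => g • x) 1 X

/-- `q : M → B` is the smooth projection onto the manifold of orbits `B = M/G` of a free, locally
trivial action: over a neighbourhood `W` of each point of `B` there are a smooth section `σ` and a
smooth `c : q⁻¹(W) → G` with `m = c(m) σ(q(m))`, i.e. a `G`-equivariant diffeomorphism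
`G × W ≅ q⁻¹(W)` over `W`. -/
structure IsPrincipalQuotient (G M B : LCManifold.{u}) [Group G] [MulAction G M] (q : M → B) :
    Prop where
  smooth : Smooth q
  surjective : Function.Surjective q
  orbits : ∀ m m' : M, q m = q m' ↔ ∃ g : G, g • m = m'
  free : ∀ (g : G) (m : M), g • m = m → g = 1
  locally_trivial : ∀ b : B, ∃ W : Set B, IsOpen W ∧ b ∈ W ∧ ∃ (σ : B → M) (c : M → G),
    SmoothOn σ W ∧ SmoothOn c (q ⁻¹' W) ∧ (∀ b' ∈ W, q (σ b') = b') ∧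
      ∀ m ∈ q ⁻¹' W, m = c m • σ (q m)

/-- `Ξ` is a connection on the principal `G`-bundle `M → M/G` (`G` acting on the left). -/
structure IsPrincipalConnection (G M : LCManifold.{u}) [Group G] [MulAction G M]
    (Ξ : M → M.model → G.model) : Prop where
  form : IsOneForm M Ξ
  vertical : ∀ (m : M) (X : G.model), Ξ m (infAct X m) = X
  equivariant : ∀ (g : G) (m : M) (h : M.model),
    Ξ (g • m) (tmap (M := M) (N := M) (fun m' => g • m') m h) = Ad g (Ξ m h)

/-- `lam` is a smooth map from `Y` to the dual of the Lie algebra of `G`; here `lam` is smooth when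
the induced function on `Y × 𝔤` is. -/
structure IsDualMap (G Y : LCManifold.{u}) (lam : Y → G.model → ℝ) : Prop where
  linear : ∀ y, IsLinearMap ℝ (lam y)
  smooth : Smooth (M := Y.prod (ofSpace G.model)) (N := ofSpace ℝ) (fun p => lam p.1 p.2)

/-- The 1-form `α` is invariant under `G`. -/
def InvariantOneForm (G M : LCManifold.{u}) [Group G] [MulAction G M] (α : M → M.model → ℝ) : Prop :=
  ∀ (g : G) (x : M) (h : M.model),
    α (g • x) (tmap (M := M) (N := M) (fun x' => g • x') x h) = α x h

/-- The 2-form `ω` is invariant under `G`. -/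
def InvariantTwoForm (G M : LCManifold.{u}) [Group G] [MulAction G M]
    (ω : M → M.model → M.model → ℝ) : Prop :=
  ∀ (g : G) (x : M) (h k : M.model),
    ω (g • x) (tmap (M := M) (N := M) (fun x' => g • x') x h)
      (tmap (M := M) (N := M) (fun x' => g • x') x k) = ω x h k

/-! ### Principal circle bundles -/

/-- A principal `𝕋`-bundle `P` over the subset `S` of the manifold `X` (in the applications `S` is
`X` itself or a fibre product, which is a submanifold of `X`). Smoothness of a map on `S` means that
it extends locally to a smooth map on an open subset of `X`; the smoothness of a `𝕋`-valued function
is that of the induced `ℂ`-valued one, and the smoothness of the action of `𝕋` is expressed through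
the covering `ℝ → 𝕋`. Around each point of `S` there are a smooth section `σ` and a smooth
`τ` with `p = τ(p) σ(proj p)`, i.e. a `𝕋`-equivariant diffeomorphism of `(W ∩ S) × 𝕋` onto
`P|_W`. -/
structure TBundle (X : LCManifold.{u}) (S : Set X) : Type (u + 1) where
  total : LCManifold.{u}
  [act : MulAction Circle total]
  proj : total → X
  smooth_act : Smooth (M := (ofSpace ℝ).prod total) (N := total)
    (fun p => Circle.exp p.1 • p.2)
  smooth_proj : Smooth proj
  proj_mem : ∀ p, proj p ∈ S
  proj_smul : ∀ (z : Circle) (p : total), proj (z • p) = proj p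
  free : ∀ (z : Circle) (p : total), z • p = p → z = 1
  locally_trivial : ∀ x ∈ S, ∃ W : Set X, IsOpen W ∧ x ∈ W ∧
    ∃ (σ : X → total) (τ : total → Circle), SmoothOn σ W ∧
      SmoothOn (N := ofSpace ℂ) (fun p => (τ p : ℂ)) (proj ⁻¹' W) ∧
      (∀ x' ∈ W ∩ S, proj (σ x') = x') ∧ ∀ p ∈ proj ⁻¹' W, p = τ p • σ (proj p)

attribute [instance] TBundle.act

/-- `√-1 A` is a connection on the principal `𝕋`-bundle `P`. Imaginary-valued forms are written
throughout as `√-1` times a real-valued form. -/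
structure IsTConnection {X : LCManifold.{u}} {S : Set X} (P : TBundle X S)
    (A : P.total → P.total.model → ℝ) : Prop where
  form : IsOneForm P.total A
  vertical : ∀ p : P.total, A p (velocity (fun θ : ℝ => Circle.exp θ • p) 0) = 1
  invariant : ∀ (z : Circle) (p : P.total) (h : P.total.model),
    A (z • p) (tmap (M := P.total) (N := P.total) (fun p' => z • p') p h) = A p h

/-- The smooth action of `G` on `P` makes `P` a `G`-equivariant `𝕋`-bundle, where `act` is the
action of `G` on the base: `G` acts by bundle isomorphisms covering `act`. -/
structure IsEquivariantTBundle (G : LCManifold.{u}) [Group G] {X : LCManifold.{u}} {S : Set X}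
    (P : TBundle X S) [MulAction G P.total] (act : G → X → X) : Prop where
  smooth : IsSmoothAction G P.total
  proj_smul : ∀ (g : G) (p : P.total), P.proj (g • p) = act g (P.proj p)
  comm : ∀ (g : G) (z : Circle) (p : P.total), g • (z • p) = z • (g • p)

/-- `Pbar` is the quotient `P/G` of the `G`-equivariant `𝕋`-bundle `P`, where `qP : P → Pbar` is the
projection, covering the projection `qX` of the bases. -/
structure IsTBundleQuotient (G : LCManifold.{u}) [Group G] {X Xbar : LCManifold.{u}} {S : Set X}
    {Sbar : Set Xbar} (P : TBundle X S) [MulAction G P.total] (Pbar : TBundle Xbar Sbar)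
    (qX : X → Xbar) (qP : P.total → Pbar.total) : Prop where
  smooth : Smooth qP
  surjective : Function.Surjective qP
  proj_eq : ∀ p, Pbar.proj (qP p) = qX (P.proj p)
  map_smul : ∀ (z : Circle) (p : P.total), qP (z • p) = z • qP p
  orbits : ∀ p p' : P.total, qP p = qP p' ↔ ∃ g : G, g • p = p'

/-- The relation `(z₁ a, z₂ b, z₃ c) ∼ (a, b, c)` for `z₁ z₂⁻¹ z₃ = 1`. -/
def tensorSetoid (A B C : Type u) [MulAction Circle A] [MulAction Circle B] [MulAction Circle C] :
    Setoid (A × B × C) where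
  r p p' := ∃ z₁ z₂ z₃ : Circle, z₁ * z₂⁻¹ * z₃ = 1 ∧
    p' = (z₁ • p.1, z₂ • p.2.1, z₃ • p.2.2)
  iseqv := by
    refine ⟨fun p => ⟨1, 1, 1, by simp, by simp⟩, ?_, ?_⟩
    · rintro p _ ⟨z₁, z₂, z₃, h, rfl⟩
      refine ⟨z₁⁻¹, z₂⁻¹, z₃⁻¹, ?_, by simp⟩
      rw [← mul_inv, ← mul_inv, h, inv_one]
    · rintro p _ _ ⟨z₁, z₂, z₃, h, rfl⟩ ⟨w₁, w₂, w₃, h', rfl⟩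
      refine ⟨w₁ * z₁, w₂ * z₂, w₃ * z₃, ?_, by simp [mul_smul]⟩
      calc w₁ * z₁ * (w₂ * z₂)⁻¹ * (w₃ * z₃)
          = (w₁ * w₂⁻¹ * w₃) * (z₁ * z₂⁻¹ * z₃) := by
            rw [mul_inv]
            simp only [mul_assoc, mul_comm, mul_left_comm]
        _ = 1 := by rw [h, h', one_mul]

/-- The points `a ⊗ b⁻¹ ⊗ c`. The fibre of the `𝕋`-bundle `A ⊗ B^{⊗ -1} ⊗ C` over a point consists
of those with `a`, `b`, `c` in the fibres over that point. -/
def Tensor (A B C : Type u) [MulAction Circle A] [MulAction Circle B] [MulAction Circle C] :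
    Type u :=
  Quotient (tensorSetoid A B C)

/-- `a ⊗ b⁻¹ ⊗ c`. -/
def Tensor.mk {A B C : Type u} [MulAction Circle A] [MulAction Circle B] [MulAction Circle C]
    (a : A) (b : B) (c : C) : Tensor A B C :=
  Quotient.mk (tensorSetoid A B C) (a, b, c)

/-- `s` is (on `S`) a smooth section over `S ⊆ X` of the principal `𝕋`-bundle
`α^*A ⊗ β^*B^{⊗ -1} ⊗ γ^*C`: locally, `s = a ⊗ b⁻¹ ⊗ c` for smooth `a`, `b`, `c`. -/
def IsTensorSection {X XA XB XC : LCManifold.{u}} (S : Set X) {SA : Set XA} {SB : Set XB}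
    {SC : Set XC} (A : TBundle XA SA) (B : TBundle XB SB) (C : TBundle XC SC)
    (α : X → XA) (β : X → XB) (γ : X → XC)
    (s : X → Tensor A.total B.total C.total) : Prop :=
  ∀ x ∈ S, ∃ W : Set X, IsOpen W ∧ x ∈ W ∧
    ∃ (a : X → A.total) (b : X → B.total) (c : X → C.total),
      SmoothOn a W ∧ SmoothOn b W ∧ SmoothOn c W ∧ ∀ x' ∈ W ∩ S,
        A.proj (a x') = α x' ∧ B.proj (b x') = β x' ∧ C.proj (c x') = γ x' ∧
          s x' = Tensor.mk (a x') (b x') (c x')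

/-- The pull-back by the section `s` of the connection `ωA ⊗ ωB^{⊗ -1} ⊗ ωC` on
`α^*A ⊗ β^*B^{⊗ -1} ⊗ γ^*C` vanishes as a 1-form on the submanifold `S`, i.e. on the velocities of all
smooth curves in `S`. If `s = a ⊗ b⁻¹ ⊗ c` along a curve, its value there is
`ωA(a') - ωB(b') + ωC(c')`. -/
def PullbackVanishes {X XA XB XC : LCManifold.{u}} (S : Set X) {SA : Set XA} {SB : Set XB}
    {SC : Set XC} (A : TBundle XA SA) (B : TBundle XB SB) (C : TBundle XC SC)
    (α : X → XA) (β : X → XB) (γ : X → XC)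
    (s : X → Tensor A.total B.total C.total)
    (ωA : A.total → A.total.model → ℝ) (ωB : B.total → B.total.model → ℝ)
    (ωC : C.total → C.total.model → ℝ) : Prop :=
  ∀ (I : Set ℝ), IsOpen I → ∀ (x : ℝ → X) (a : ℝ → A.total) (b : ℝ → B.total) (c : ℝ → C.total),
    SmoothCurveOn x I → SmoothCurveOn a I → SmoothCurveOn b I → SmoothCurveOn c I →
    (∀ t ∈ I, x t ∈ S ∧ A.proj (a t) = α (x t) ∧ B.proj (b t) = β (x t) ∧
      C.proj (c t) = γ (x t) ∧ s (x t) = Tensor.mk (a t) (b t) (c t)) →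
    ∀ t ∈ I, ωA (a t) (velocity a t) - ωB (b t) (velocity b t) + ωC (c t) (velocity c t) = 0

/-! ### Bundle gerbes -/

/-- The fibre product `Y^[2]`. -/
def fib2 {Y M : LCManifold.{u}} (π : Y → M) : Set (Y.prod Y) :=
  {x | π x.1 = π x.2}

/-- The fibre product `Y^[3]`. -/
def fib3 {Y M : LCManifold.{u}} (π : Y → M) : Set (Y.prod (Y.prod Y)) :=
  {x | π x.1 = π x.2.1 ∧ π x.2.1 = π x.2.2}

/-- A bundle gerbe `(Y, P, s)` over `M`. With `π_i` omitting the `i`-th factor,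
`δP = π₁^*P ⊗ π₂^*P^{⊗ -1} ⊗ π₃^*P` has fibre `P_{y₂y₃} ⊗ P_{y₁y₃}^{⊗ -1} ⊗ P_{y₁y₂}`, and `s` is a section
of it over `Y^[3]`. The condition `δs = 1` over `Y^[4]` is expressed through the components `z_{ijk}` of
`s` with respect to points `p_{ij}` of the fibres, which cancel in `δδP`. -/
structure BundleGerbe (M : LCManifold.{u}) : Type (u + 1) where
  Y : LCManifold.{u}
  π : Y → M
  smooth_π : Smooth π
  submersion : IsSurjectiveSubmersion π
  P : TBundle (Y.prod Y) (fib2 π)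
  s : Y.prod (Y.prod Y) → Tensor P.total P.total P.total
  section_s : IsTensorSection (fib3 π) P P P
    (fun x => (x.2.1, x.2.2)) (fun x => (x.1, x.2.2)) (fun x => (x.1, x.2.1)) s
  delta_s : ∀ (y₁ y₂ y₃ y₄ : Y) (p₁₂ p₁₃ p₁₄ p₂₃ p₂₄ p₃₄ : P.total)
    (z₁₂₃ z₁₂₄ z₁₃₄ z₂₃₄ : Circle),
    P.proj p₁₂ = (y₁, y₂) → P.proj p₁₃ = (y₁, y₃) → P.proj p₁₄ = (y₁, y₄) →
    P.proj p₂₃ = (y₂, y₃) → P.proj p₂₄ = (y₂, y₄) → P.proj p₃₄ = (y₃, y₄) →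
    s (y₁, y₂, y₃) = Tensor.mk (z₁₂₃ • p₂₃) p₁₃ p₁₂ →
    s (y₁, y₂, y₄) = Tensor.mk (z₁₂₄ • p₂₄) p₁₄ p₁₂ →
    s (y₁, y₃, y₄) = Tensor.mk (z₁₃₄ • p₃₄) p₁₄ p₁₃ →
    s (y₂, y₃, y₄) = Tensor.mk (z₂₃₄ • p₃₄) p₂₄ p₂₃ →
    z₂₃₄ * z₁₃₄⁻¹ * z₁₂₄ * z₁₂₃⁻¹ = 1

/-- `√-1 A` is a connection `∇` on the bundle gerbe: a connection on `P` with `s^*(δ∇) = 0`. -/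
structure IsGerbeConnection {M : LCManifold.{u}} (𝒢 : BundleGerbe M)
    (A : 𝒢.P.total → 𝒢.P.total.model → ℝ) : Prop where
  connection : IsTConnection 𝒢.P A
  flat : PullbackVanishes (fib3 𝒢.π) 𝒢.P 𝒢.P 𝒢.P
    (fun x => (x.2.1, x.2.2)) (fun x => (x.1, x.2.2)) (fun x => (x.1, x.2.1)) 𝒢.s A A A

/-- `√-1 f` is a curving for the connection `∇ = √-1 A`: `δf = F(∇)`, where the curvature `F(∇)` is
the 2-form on `Y^[2]` whose pull-back to `P` is `d∇`, and `δf = π₁^*f - π₂^*f`. -/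
structure IsCurving {M : LCManifold.{u}} (𝒢 : BundleGerbe M)
    (A : 𝒢.P.total → 𝒢.P.total.model → ℝ) (f : 𝒢.Y → 𝒢.Y.model → 𝒢.Y.model → ℝ) : Prop where
  form : IsTwoForm 𝒢.Y f
  delta_eq : ∀ (p : 𝒢.P.total) (h k : 𝒢.P.total.model),
    f (𝒢.P.proj p).2 (tmap 𝒢.P.proj p h).2 (tmap 𝒢.P.proj p k).2 -
      f (𝒢.P.proj p).1 (tmap 𝒢.P.proj p h).1 (tmap 𝒢.P.proj p k).1 = extD 𝒢.P.total A p h k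

/-- A pseudo `𝕋`-bundle `(R, v)` for `𝒢 = (Y, P, s)`. With `δR = π₁^*R ⊗ π₂^*R^{⊗ -1}`, the fibre of
`δR^{⊗ -1} ⊗ P` over `(y₁, y₂)` is `R_{y₁} ⊗ R_{y₂}^{⊗ -1} ⊗ P_{y₁y₂}`, and `v` is a section of this bundle
over `Y^[2]`. The condition `δv = s` is expressed through the components `w_{ij}` of `v` with respect to
points `r_i` and `p_{ij}` of the fibres; the `r_i` cancel in `δδR^{⊗ -1} ⊗ δP = δP`. -/
structure PseudoTBundle {M : LCManifold.{u}} (𝒢 : BundleGerbe M) : Type (u + 1) where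
  R : TBundle 𝒢.Y univ
  v : 𝒢.Y.prod 𝒢.Y → Tensor R.total R.total 𝒢.P.total
  section_v : IsTensorSection (fib2 𝒢.π) R R 𝒢.P
    (fun x => x.1) (fun x => x.2) (fun x => x) v
  delta_v : ∀ (y₁ y₂ y₃ : 𝒢.Y) (r₁ r₂ r₃ : R.total) (p₁₂ p₁₃ p₂₃ : 𝒢.P.total)
    (w₁₂ w₁₃ w₂₃ : Circle),
    R.proj r₁ = y₁ → R.proj r₂ = y₂ → R.proj r₃ = y₃ →
    𝒢.P.proj p₁₂ = (y₁, y₂) → 𝒢.P.proj p₁₃ = (y₁, y₃) → 𝒢.P.proj p₂₃ = (y₂, y₃) →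
    v (y₁, y₂) = Tensor.mk (w₁₂ • r₁) r₂ p₁₂ →
    v (y₁, y₃) = Tensor.mk (w₁₃ • r₁) r₃ p₁₃ →
    v (y₂, y₃) = Tensor.mk (w₂₃ • r₂) r₃ p₂₃ →
    𝒢.s (y₁, y₂, y₃) = Tensor.mk ((w₂₃ * w₁₃⁻¹ * w₁₂) • p₂₃) p₁₃ p₁₂

/-- `√-1 H` is a connection `η` on the pseudo `𝕋`-bundle `(R, v)` for the bundle gerbe with connection
`(𝒢, √-1 A)`: a connection on `R` with `v^*(δη^{⊗ -1} ⊗ ∇) = 0`. -/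
structure IsPseudoConnection {M : LCManifold.{u}} {𝒢 : BundleGerbe M}
    (A : 𝒢.P.total → 𝒢.P.total.model → ℝ) (𝓡 : PseudoTBundle 𝒢)
    (H : 𝓡.R.total → 𝓡.R.total.model → ℝ) : Prop where
  connection : IsTConnection 𝓡.R H
  compatible : PullbackVanishes (fib2 𝒢.π) 𝓡.R 𝓡.R 𝒢.P
    (fun x => x.1) (fun x => x.2) (fun x => x) 𝓡.v H H A

/-! ### Equivariance and reduction -/

/-- The actions of `G` on `M`, `Y` and `P` make `𝒢 = (Y, P, s)` strongly `G`-equivariant. -/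
structure IsStronglyEquivariant (G : LCManifold.{u}) [Group G] {M : LCManifold.{u}} [MulAction G M]
    (𝒢 : BundleGerbe M) [MulAction G 𝒢.Y] [MulAction G 𝒢.P.total] : Prop where
  smooth : IsSmoothAction G 𝒢.Y
  π_smul : ∀ (g : G) (y : 𝒢.Y), 𝒢.π (g • y) = g • 𝒢.π y
  equivariant_P : IsEquivariantTBundle G 𝒢.P (fun g x => (g • x.1, g • x.2))
  invariant_s : ∀ (g : G) (y₁ y₂ y₃ : 𝒢.Y) (a b c : 𝒢.P.total),
    𝒢.π y₁ = 𝒢.π y₂ → 𝒢.π y₂ = 𝒢.π y₃ → 𝒢.s (y₁, y₂, y₃) = Tensor.mk a b c →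
    𝒢.s (g • y₁, g • y₂, g • y₃) = Tensor.mk (g • a) (g • b) (g • c)

/-- The action of `G` on `R` makes the pseudo `𝕋`-bundle `(R, v)` for the strongly equivariant bundle
gerbe `𝒢` a `G`-equivariant one. -/
structure IsEquivariantPseudo (G : LCManifold.{u}) [Group G] {M : LCManifold.{u}}
    {𝒢 : BundleGerbe M} [MulAction G 𝒢.Y] [MulAction G 𝒢.P.total]
    (𝓡 : PseudoTBundle 𝒢) [MulAction G 𝓡.R.total] : Prop where
  equivariant_R : IsEquivariantTBundle G 𝓡.R (fun g y => g • y)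
  invariant_v : ∀ (g : G) (y₁ y₂ : 𝒢.Y) (a b : 𝓡.R.total) (c : 𝒢.P.total),
    𝒢.π y₁ = 𝒢.π y₂ → 𝓡.v (y₁, y₂) = Tensor.mk a b c →
    𝓡.v (g • y₁, g • y₂) = Tensor.mk (g • a) (g • b) (g • c)

/-- `√-1 ρ` is the moment of the equivariant `𝕋`-bundle with invariant connection `(P, √-1 A)`, as a
function on the base: `⟨X | ρ(x)⟩ = A(p; X^*)` for every `p` over `x`. -/
def IsMoment (G : LCManifold.{u}) [Group G] {X : LCManifold.{u}} {S : Set X} (P : TBundle X S)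
    [MulAction G P.total] (A : P.total → P.total.model → ℝ) (ρ : X → G.model → ℝ) : Prop :=
  ∀ (p : P.total) (ξ : G.model), ρ (P.proj p) ξ = A p (infAct ξ p)

/-- The pair `(E, ζ)` associated with `λ` vanishes. It is given on `M` by
`2π√-1 ⟨X | π^*E⟩ = ⟨X | dλ⟩ + ι_{X^*} f` and `2π√-1 ⟨X | π^*ζ(g)⟩ = ⟨X | g^*λ - Ad_g λ⟩`, where
`⟨X | Ad_g λ⟩ = ⟨Ad_{g⁻¹} X | λ⟩`; since `π` is a surjective submersion, it vanishes if and only if the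
right-hand sides do. -/
structure ObstructionVanishes (G Y : LCManifold.{u}) [Group G] [MulAction G Y]
    (f : Y → Y.model → Y.model → ℝ) (lam : Y → G.model → ℝ) : Prop where
  E_eq_zero : ∀ (X : G.model) (y : Y) (h : Y.model),
    tmap (N := ofSpace ℝ) (fun y' => lam y' X) y h + f y (infAct X y) h = 0
  ζ_eq_zero : ∀ (g : G) (X : G.model) (y : Y), lam (g • y) X - lam y (Ad g⁻¹ X) = 0

/-- The 1-form `κ = ⟨π^*Ξ | λ⟩` on `Y` (divided by `√-1`). -/
def kappa {G M : LCManifold.{u}} (𝒢 : BundleGerbe M) (Ξ : M → M.model → G.model)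
    (lam : 𝒢.Y → G.model → ℝ) (y : 𝒢.Y) (h : 𝒢.Y.model) : ℝ :=
  lam y (Ξ (𝒢.π y) (tmap 𝒢.π y h))

/-- `𝒢bar = (Y/G, P/G, sbar)` is the quotient of the strongly equivariant bundle gerbe
`𝒢 = (Y, P, s)`, with projections `q : M → M/G`, `qY : Y → Y/G` and `qP : P → P/G`. -/
structure IsGerbeQuotient (G : LCManifold.{u}) [Group G] {M Mbar : LCManifold.{u}}
    (𝒢 : BundleGerbe M) [MulAction G 𝒢.Y] [MulAction G 𝒢.P.total]
    (𝒢bar : BundleGerbe Mbar) (q : M → Mbar) (qY : 𝒢.Y → 𝒢bar.Y)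
    (qP : 𝒢.P.total → 𝒢bar.P.total) : Prop where
  quotient_Y : IsPrincipalQuotient G 𝒢.Y 𝒢bar.Y qY
  π_eq : ∀ y, 𝒢bar.π (qY y) = q (𝒢.π y)
  quotient_P : IsTBundleQuotient G 𝒢.P 𝒢bar.P (fun x => (qY x.1, qY x.2)) qP
  s_eq : ∀ (y₁ y₂ y₃ : 𝒢.Y) (a b c : 𝒢.P.total),
    𝒢.π y₁ = 𝒢.π y₂ → 𝒢.π y₂ = 𝒢.π y₃ → 𝒢.s (y₁, y₂, y₃) = Tensor.mk a b c →
    𝒢bar.s (qY y₁, qY y₂, qY y₃) = Tensor.mk (qP a) (qP b) (qP c)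

/-- The forms `Abar` and `fbar` (times `√-1`) are the quotients of `∇ - δκ` and `f - dκ`, so that,
together with `𝒢bar`, they form the reduction of `(𝒢, ∇, f)` with respect to `λ` and `Ξ`. -/
structure IsFormReduction {G M Mbar : LCManifold.{u}} (𝒢 : BundleGerbe M)
    (A : 𝒢.P.total → 𝒢.P.total.model → ℝ) (f : 𝒢.Y → 𝒢.Y.model → 𝒢.Y.model → ℝ)
    (Ξ : M → M.model → G.model) (lam : 𝒢.Y → G.model → ℝ)
    (𝒢bar : BundleGerbe Mbar) (qY : 𝒢.Y → 𝒢bar.Y) (qP : 𝒢.P.total → 𝒢bar.P.total)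
    (Abar : 𝒢bar.P.total → 𝒢bar.P.total.model → ℝ)
    (fbar : 𝒢bar.Y → 𝒢bar.Y.model → 𝒢bar.Y.model → ℝ) : Prop where
  connection_eq : ∀ (p : 𝒢.P.total) (h : 𝒢.P.total.model),
    Abar (qP p) (tmap qP p h) = A p h -
      (kappa 𝒢 Ξ lam (𝒢.P.proj p).2 (tmap 𝒢.P.proj p h).2 -
        kappa 𝒢 Ξ lam (𝒢.P.proj p).1 (tmap 𝒢.P.proj p h).1)
  curving_eq : ∀ (y : 𝒢.Y) (h k : 𝒢.Y.model),
    fbar (qY y) (tmap qY y h) (tmap qY y k) = f y h k - extD 𝒢.Y (kappa 𝒢 Ξ lam) y h k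

end

universe z

noncomputable section

set_option linter.unusedSectionVars false

open LCManifold

/-! ### Calculus in locally convex spaces -/

section DirectionalDerivative

variable {E : Type u} [AddCommGroup E] [Module ℝ E] [TopologicalSpace E]
  {F : Type v} [AddCommGroup F] [Module ℝ F] [TopologicalSpace F]
  {H : Type w} [AddCommGroup H] [Module ℝ H] [TopologicalSpace H]

/-! The quotient bundle exists because the freeness of the action on `Y` passes to `R`. Over a small
open set of `Y/G`, a local section of `Y → Y/G` together with freeness lets every point of `R` be
moved, by a unique group element, into a fibre lying over that section. The circle coordinate of `R`
read off there is `G`-invariant and `𝕋`-equivariant. Joined to charts of `Y/G`, it gives charts of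
`R/G`, trivialises `R/G` over `Y/G`, and separates orbits in one fibre
(`exists_orbitTrivialization`, `exists_tBundleQuotient`).

The section `v` descends because two lifts to `Y^[2]` of one pair in `(Y/G)^[2]` differ by a single
group element, by freeness on `M`, and `v` is invariant. The identity `δv = s` is then checked on
lifts, where it holds already (`exists_pseudoTBundle_quotient`).

The connection descends because `η - κ` is basic. It is invariant, since the two adjoint twists in
`κ = ⟨π^*Ξ|λ⟩` cancel. It is horizontal, since its value on `X^*` is `⟨X|ρ⟩ - ⟨X|λ⟩`, which is
`⟨X|π^*μ⟩ = 0`. A basic form is pulled back from the quotient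
(`IsPrincipalQuotient.exists_descent`). Neither the values on the `𝕋`-direction nor `𝕋`-invariance
are affected by `κ`, a form from the base. Compatibility with `v` is tested on lifted curves: the
`κ`-terms of `η - κ` at the two points cancel against `δκ` in `∇ - δκ`, and what remains vanishes
because `η` is a connection on `(R, v)` (`pullbackVanishes_descent`).

The model spaces are only locally convex, so the calculus is built by hand. The chain rule and the
linearity of derivatives both come from the joint convergence of difference quotients
(`tendsto_diff_quotient`), itself a consequence of Hahn-Banach and the real mean value theorem. -/

theorem HasDirDeriv.dirDeriv_eq [T2Space F] {f : E → F} {x h : E} {d : F}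
    (hf : HasDirDeriv f x h d) : dirDeriv f x h = d :=
  Tendsto.limUnder_eq hf

theorem tendsto_line [IsTopologicalAddGroup E] [ContinuousSMul ℝ E] (x h : E) :
    Tendsto (fun t : ℝ => x + t • h) (𝓝[≠] 0) (𝓝 x) := by
  have : Tendsto (fun t : ℝ => x + t • h) (𝓝 0) (𝓝 (x + (0 : ℝ) • h)) :=
    Continuous.tendsto (by fun_prop) 0
  rw [zero_smul, add_zero] at this
  exact this.mono_left nhdsWithin_le_nhds

theorem HasDirDeriv.congr [IsTopologicalAddGroup E] [ContinuousSMul ℝ E] {f g : E → F} {x h : E}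
    {d : F} (hf : HasDirDeriv f x h d) (hfg : f =ᶠ[𝓝 x] g) : HasDirDeriv g x h d := by
  refine Tendsto.congr' ?_ hf
  filter_upwards [(tendsto_line x h).eventually hfg] with t ht
  rw [ht, hfg.eq_of_nhds]

/-- The difference quotients agree eventually, so their limits agree even when `limUnder` returns a
default value; existence of the derivative is not needed. -/
theorem dirDeriv_congr [IsTopologicalAddGroup E] [ContinuousSMul ℝ E] {f g : E → F} {x : E}
    (hfg : f =ᶠ[𝓝 x] g) (h : E) : dirDeriv f x h = dirDeriv g x h := by
  have : (fun t : ℝ => t⁻¹ • (f (x + t • h) - f x)) =ᶠ[𝓝[≠] 0]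
      (fun t : ℝ => t⁻¹ • (g (x + t • h) - g x)) := by
    filter_upwards [(tendsto_line x h).eventually hfg] with t ht
    rw [ht, hfg.eq_of_nhds]
  unfold dirDeriv limUnder
  rw [Filter.map_congr this]

theorem hasDirDeriv_clm (L : E →L[ℝ] F) (x h : E) : HasDirDeriv L x h (L h) := by
  refine (tendsto_const_nhds (x := L h)).congr' ?_
  filter_upwards [self_mem_nhdsWithin] with t ht
  have ht' : t ≠ 0 := ht
  simp [smul_smul, ht']

theorem hasDirDeriv_const (c : F) (x h : E) : HasDirDeriv (fun _ : E => c) x h 0 := by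
  simpa [HasDirDeriv] using tendsto_const_nhds

theorem HasDirDeriv.smul [ContinuousSMul ℝ F] {f : E → F} {x h : E} {d : F}
    (hf : HasDirDeriv f x h d) (c : ℝ) : HasDirDeriv f x (c • h) (c • d) := by
  rcases eq_or_ne c 0 with rfl | hc
  · simpa [HasDirDeriv] using tendsto_const_nhds
  -- Substitute `t * c` for `t` in the difference quotient; this needs `c ≠ 0` to stay away from
  -- `0`.
  · have h1 : Tendsto (fun t : ℝ => t * c) (𝓝[≠] 0) (𝓝[≠] 0) := by
      refine tendsto_nhdsWithin_iff.2 ⟨?_, ?_⟩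
      · have : Tendsto (fun t : ℝ => t * c) (𝓝 0) (𝓝 (0 * c)) := Continuous.tendsto (by fun_prop) 0
        rw [zero_mul] at this
        exact this.mono_left nhdsWithin_le_nhds
      · filter_upwards [self_mem_nhdsWithin] with t ht
        exact mul_ne_zero ht hc
    refine ((Tendsto.comp hf h1).const_smul c).congr fun t => ?_
    simp only [Function.comp, smul_smul, mul_inv]
    rw [mul_comm t⁻¹, ← mul_assoc, mul_inv_cancel₀ hc, one_mul]

/-- The mean value theorem: an increment lies in every closed convex set that contains the
derivatives along the segment. -/
theorem mem_of_hasDirDeriv_segment [IsTopologicalAddGroup F] [ContinuousSMul ℝ F]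
    [LocallyConvexSpace ℝ F] {f : E → F} {x h : E} {d : ℝ → F} {C : Set F} (hC : Convex ℝ C)
    (hCc : IsClosed C) (hd : ∀ t ∈ Icc (0 : ℝ) 1, HasDirDeriv f (x + t • h) h (d t))
    (hdC : ∀ t ∈ Icc (0 : ℝ) 1, d t ∈ C) : f (x + h) - f x ∈ C := by
  by_contra hn
  -- A functional separating the increment from `C` reduces the claim to the mean value theorem on
  -- `[0, 1]`.
  obtain ⟨L, u, hL, hu⟩ := geometric_hahn_banach_closed_point hC hCc hn
  have hder : ∀ t ∈ Icc (0 : ℝ) 1, HasDerivAt (fun t => L (f (x + t • h))) (L (d t)) t := by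
    intro t ht
    rw [hasDerivAt_iff_tendsto_slope_zero]
    refine ((L.continuous.tendsto _).comp (hd t ht)).congr fun s => ?_
    simp [add_smul, add_assoc]
  obtain ⟨c, hc, hceq⟩ := exists_hasDerivAt_eq_slope (fun t => L (f (x + t • h)))
    (fun t => L (d t)) zero_lt_one
    (fun t ht => (hder t ht).continuousAt.continuousWithinAt)
    (fun t ht => hder t (Ioo_subset_Icc_self ht))
  have hc' := Ioo_subset_Icc_self hc
  have h1 := hL _ (hdC c hc')
  rw [hceq] at h1
  simp at h1 hu
  linarith

/-- By regularity, shrink first to a closed neighbourhood, then to a convex one inside it, whose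
closure is still convex and cannot leave. -/
theorem exists_closed_convex_nhds [IsTopologicalAddGroup F] [ContinuousSMul ℝ F]
    [LocallyConvexSpace ℝ F] {y : F} {V : Set F} (hV : V ∈ 𝓝 y) :
    ∃ C ∈ 𝓝 y, Convex ℝ C ∧ IsClosed C ∧ C ⊆ V := by
  obtain ⟨K, hK, hKc, hKV⟩ := exists_mem_nhds_isClosed_subset hV
  obtain ⟨C, ⟨hC, hCc⟩, hCK⟩ := (LocallyConvexSpace.convex_basis (𝕜 := ℝ) y).mem_iff.1 hK
  exact ⟨closure C, mem_of_superset hC subset_closure, hCc.closure, isClosed_closure,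
    (closure_minimal hCK hKc).trans hKV⟩

/-- The difference quotient of a `C^1` map converges jointly in the point and the direction. -/
theorem tendsto_diff_quotient [IsTopologicalAddGroup E] [ContinuousSMul ℝ E]
    [IsTopologicalAddGroup F] [ContinuousSMul ℝ F] [LocallyConvexSpace ℝ F]
    {f : E → F} {U : Set E} (hU : IsOpen U) {df : E × E → F}
    (hd : ∀ x ∈ U, ∀ h, HasDirDeriv f x h (df (x, h)))
    (hc : ContinuousOn df (U ×ˢ (univ : Set E))) {x : E} (hx : x ∈ U) (h : E) :
    Tendsto (fun p : ℝ × E × E => p.1⁻¹ • (f (p.2.1 + p.1 • p.2.2) - f p.2.1))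
      (𝓝[≠] 0 ×ˢ 𝓝 (x, h)) (𝓝 (df (x, h))) := by
  intro V hV
  obtain ⟨C, hC, hconv, hclosed, hCV⟩ := exists_closed_convex_nhds hV
  have hcx : ContinuousAt df (x, h) :=
    hc.continuousAt ((hU.prod isOpen_univ).mem_nhds ⟨hx, mem_univ _⟩)
  have hN : ∀ᶠ p : E × E in 𝓝 (x, h), p.1 ∈ U ∧ df p ∈ C :=
    (continuousAt_fst.eventually (hU.mem_nhds hx)).and (hcx.eventually hC)
  -- At `t = 0` the whole segment collapses to `x`; compactness of `[0, 1]` makes the neighbourhood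
  -- uniform in the segment parameter.
  have key : ∀ᶠ p : ℝ × E × E in 𝓝 (0, x, h), ∀ s ∈ Icc (0 : ℝ) 1,
      (p.2.1 + s • p.1 • p.2.2) ∈ U ∧ df (p.2.1 + s • p.1 • p.2.2, p.2.2) ∈ C := by
    refine isCompact_Icc.eventually_forall_of_forall_eventually fun s _ => ?_
    have : Tendsto (fun z : (ℝ × E × E) × ℝ => (z.1.2.1 + z.2 • z.1.1 • z.1.2.2, z.1.2.2))
        (𝓝 ((0, x, h), s)) (𝓝 (x + s • (0 : ℝ) • h, h)) :=
      Continuous.tendsto (f := fun z : (ℝ × E × E) × ℝ =>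
        (z.1.2.1 + z.2 • z.1.1 • z.1.2.2, z.1.2.2)) (by fun_prop) ((0, x, h), s)
    rw [zero_smul, smul_zero, add_zero] at this
    exact this.eventually hN
  have key' : ∀ᶠ p : ℝ × E × E in 𝓝[≠] 0 ×ˢ 𝓝 (x, h), p.1 ≠ 0 ∧ ∀ s ∈ Icc (0 : ℝ) 1,
      (p.2.1 + s • p.1 • p.2.2) ∈ U ∧ df (p.2.1 + s • p.1 • p.2.2, p.2.2) ∈ C := by
    refine Filter.Eventually.and ?_ ?_
    · exact Filter.Eventually.prod_inl (p := fun t : ℝ => t ≠ 0) self_mem_nhdsWithin _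
    · rw [nhds_prod_eq] at key
      exact key.filter_mono (Filter.prod_mono nhdsWithin_le_nhds le_rfl)
  rw [Filter.mem_map]
  filter_upwards [key'] with p hp
  obtain ⟨hp0, hp⟩ := hp
  refine hCV ?_
  -- The quotient is the increment of `p.1⁻¹ • f` in the direction `p.1 • p.2.2`; the two scalars
  -- cancel in its derivative.
  have := mem_of_hasDirDeriv_segment (f := fun y => p.1⁻¹ • f y) (x := p.2.1) (h := p.1 • p.2.2)
    (d := fun s => df (p.2.1 + s • p.1 • p.2.2, p.2.2)) hconv hclosed ?_ (fun s hs => (hp s hs).2)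
  · rwa [← smul_sub] at this
  · intro s hs
    have h1 := ((hd _ (hp s hs).1 p.2.2).smul p.1).const_smul p.1⁻¹
    rw [inv_smul_smul₀ hp0] at h1
    refine h1.congr fun t => ?_
    rw [smul_comm, smul_sub]

/-- For `t ≠ 0` the point `f (x + t • h)` is exactly `f x + t • k` with `k` the difference quotient
of `f`. As `k` tends to `d`, joint convergence in the direction suffices. -/
theorem HasDirDeriv.comp [IsTopologicalAddGroup F] [ContinuousSMul ℝ F]
    [IsTopologicalAddGroup H] [ContinuousSMul ℝ H] [LocallyConvexSpace ℝ H]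
    {g : F → H} {V : Set F} (hV : IsOpen V) {dg : F × F → H}
    (hdg : ∀ y ∈ V, ∀ k, HasDirDeriv g y k (dg (y, k)))
    (hc : ContinuousOn dg (V ×ˢ (univ : Set F))) {f : E → F} {x h : E} {d : F}
    (hf : HasDirDeriv f x h d) (hx : f x ∈ V) :
    HasDirDeriv (fun z => g (f z)) x h (dg (f x, d)) := by
  have h1 := tendsto_diff_quotient hV hdg hc hx d
  have h2 : Tendsto (fun t : ℝ => (t, f x, t⁻¹ • (f (x + t • h) - f x))) (𝓝[≠] 0)
      (𝓝[≠] 0 ×ˢ 𝓝 (f x, d)) :=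
    tendsto_id.prodMk (tendsto_const_nhds.prodMk_nhds hf)
  refine (h1.comp h2).congr' ?_
  filter_upwards [self_mem_nhdsWithin] with t ht
  have ht' : t ≠ 0 := ht
  simp [smul_smul, ht']

/-- Telescope the increment through `x + t • h`. The second piece has a moving base point, which is
why joint convergence is needed. -/
theorem hasDirDeriv_add [IsTopologicalAddGroup E] [ContinuousSMul ℝ E]
    [IsTopologicalAddGroup F] [ContinuousSMul ℝ F] [LocallyConvexSpace ℝ F]
    {f : E → F} {U : Set E} (hU : IsOpen U) {df : E × E → F}
    (hd : ∀ x ∈ U, ∀ h, HasDirDeriv f x h (df (x, h)))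
    (hc : ContinuousOn df (U ×ˢ (univ : Set E))) {x : E} (hx : x ∈ U) (h k : E) :
    HasDirDeriv f x (h + k) (df (x, h) + df (x, k)) := by
  have h1 := tendsto_diff_quotient hU hd hc hx k
  have h2 : Tendsto (fun t : ℝ => (t, x + t • h, k)) (𝓝[≠] 0) (𝓝[≠] 0 ×ˢ 𝓝 (x, k)) :=
    tendsto_id.prodMk ((tendsto_line x h).prodMk_nhds tendsto_const_nhds)
  refine (Tendsto.add (hd x hx h) (h1.comp h2)).congr fun t => ?_
  simp only [Function.comp, ← smul_add]
  congr 1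
  rw [smul_add, add_assoc]
  abel

end DirectionalDerivative

/-! ### Finite differentiability: locality and composition -/

section Ck

variable {E : Type u} [AddCommGroup E] [Module ℝ E] [TopologicalSpace E]
  {F : Type v} [AddCommGroup F] [Module ℝ F] [TopologicalSpace F]

theorem IsCk.continuousOn {k : ℕ} {f : E → F} {U : Set E} (hf : IsCk k f U) :
    ContinuousOn f U := by
  cases k with
  | zero => exact hf
  | succ k => exact hf.1

theorem IsCk.of_succ {k : ℕ} {f : E → F} {U : Set E} (hf : IsCk (k + 1) f U) : IsCk k f U := by
  induction k generalizing E with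
  | zero => exact hf.1
  | succ k ih =>
    obtain ⟨hc, df, hd, hk⟩ := hf
    exact ⟨hc, df, hd, ih hk⟩

theorem IsCk.congr [IsTopologicalAddGroup E] [ContinuousSMul ℝ E] {k : ℕ} {f g : E → F} {U : Set E}
    (hU : IsOpen U) (hf : IsCk k f U) (hfg : EqOn f g U) : IsCk k g U := by
  cases k with
  | zero => exact ContinuousOn.congr hf hfg.symm
  | succ k =>
    obtain ⟨hc, df, hd, hk⟩ := hf
    exact ⟨hc.congr hfg.symm, df, fun x hx h => (hd x hx h).congr
      (Filter.mem_of_superset (hU.mem_nhds hx) hfg), hk⟩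

/-- Limits are unique in a Hausdorff space, so the derivative hidden in the existential is
`dirDeriv`. A canonical derivative is what allows local statements to be glued. -/
theorem isCk_succ_iff [IsTopologicalAddGroup E] [ContinuousSMul ℝ E] [T2Space F] {k : ℕ}
    {f : E → F} {U : Set E} (hU : IsOpen U) : IsCk (k + 1) f U ↔ ContinuousOn f U ∧
      (∀ x ∈ U, ∀ h, HasDirDeriv f x h (dirDeriv f x h)) ∧
      IsCk k (fun p : E × E => dirDeriv f p.1 p.2) (U ×ˢ (univ : Set E)) := by
  constructor
  · rintro ⟨hc, df, hd, hk⟩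
    refine ⟨hc, fun x hx h => ?_, hk.congr (hU.prod isOpen_univ) fun p hp => ?_⟩
    · rw [(hd x hx h).dirDeriv_eq]
      exact hd x hx h
    · exact ((hd p.1 hp.1 p.2).dirDeriv_eq).symm
  · rintro ⟨hc, hd, hk⟩
    exact ⟨hc, _, hd, hk⟩

theorem isCk_of_locally [IsTopologicalAddGroup E] [ContinuousSMul ℝ E] [T2Space F] {k : ℕ}
    {f : E → F} {U : Set E} (hU : IsOpen U)
    (h : ∀ x ∈ U, ∃ V, IsOpen V ∧ x ∈ V ∧ IsCk k f V) : IsCk k f U := by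
  have hcont : ContinuousOn f U := fun x hx => by
    obtain ⟨V, hV, hxV, hk⟩ := h x hx
    exact (hk.continuousOn.continuousAt (hV.mem_nhds hxV)).continuousWithinAt
  induction k generalizing E with
  | zero => exact hcont
  | succ k ih =>
    rw [isCk_succ_iff hU]
    refine ⟨hcont, fun x hx h' => ?_, ?_⟩
    · obtain ⟨V, hV, hxV, hk⟩ := h x hx
      exact ((isCk_succ_iff hV).1 hk).2.1 x hxV h'
    · have h' : ∀ p ∈ U ×ˢ (univ : Set E), ∃ V : Set (E × E), IsOpen V ∧ p ∈ V ∧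
          IsCk k (fun p : E × E => dirDeriv f p.1 p.2) V := by
        rintro p ⟨hp, -⟩
        obtain ⟨V, hV, hxV, hk⟩ := h p.1 hp
        exact ⟨V ×ˢ univ, hV.prod isOpen_univ, ⟨hxV, mem_univ _⟩, ((isCk_succ_iff hV).1 hk).2.2⟩
      refine ih (hU.prod isOpen_univ) h' fun p hp => ?_
      obtain ⟨V, hV, hxV, hk⟩ := h' p hp
      exact (hk.continuousOn.continuousAt (hV.mem_nhds hxV)).continuousWithinAt

/-- The derivative of the composite is `dg ∘ (f ∘ fst, df)`, again a composite, one order lower;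
hence the induction over all spaces at once. -/
theorem IsCk.comp {H : Type w} [AddCommGroup H] [Module ℝ H] [TopologicalSpace H]
    [IsTopologicalAddGroup F] [ContinuousSMul ℝ F]
    [IsTopologicalAddGroup H] [ContinuousSMul ℝ H] [LocallyConvexSpace ℝ H]
    {k : ℕ} {g : F → H} {f : E → F} {V : Set F} {U : Set E} (hV : IsOpen V)
    (hg : IsCk k g V) (hf : IsCk k f U) (hUV : MapsTo f U V) : IsCk k (fun x => g (f x)) U := by
  induction k generalizing E F with
  | zero => exact ContinuousOn.comp hg hf hUV
  | succ k ih =>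
    have hf' := hf.of_succ
    obtain ⟨hgc, dg, hdg, hgk⟩ := hg
    obtain ⟨hfc, df, hdf, hfk⟩ := hf
    refine ⟨hgc.comp hfc hUV, fun p => dg (f p.1, df p), fun x hx h => ?_, ?_⟩
    · exact (hdf x hx h).comp hV hdg hgk.continuousOn (hUV hx)
    · refine ih (f := fun p : E × E => (f p.1, df p)) (hV.prod isOpen_univ) hgk ?_
        fun p hp => ⟨hUV hp.1, mem_univ _⟩
      refine IsCk.prodMk k (IsCk.mono k (IsCk.comp_linear k (ContinuousLinearMap.fst ℝ E E) hf') ?_)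
        hfk
      intro p hp
      exact hp.1

/-- This imports the classical smoothness of multiplication, exponential and logarithm on `ℂ`. -/
theorem ContDiffOn.isCk {k : ℕ} {E : Type u} [NormedAddCommGroup E] [NormedSpace ℝ E]
    {F : Type v} [NormedAddCommGroup F] [NormedSpace ℝ F] {f : E → F} {U : Set E} (hU : IsOpen U)
    (hf : ContDiffOn ℝ k f U) : IsCk k f U := by
  induction k generalizing E with
  | zero => exact hf.continuousOn
  | succ k ih =>
    refine ⟨hf.continuousOn, fun p => fderiv ℝ f p.1 p.2, fun x hx h => ?_, ?_⟩
    · have h1 : DifferentiableAt ℝ f x :=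
        (hf.contDiffAt (hU.mem_nhds hx)).differentiableAt (by simp)
      have h2 := (h1.hasFDerivAt.hasLineDerivAt h)
      simpa [HasDirDeriv, HasLineDerivAt, hasDerivAt_iff_tendsto_slope_zero] using h2
    · refine ih (hU.prod isOpen_univ) ?_
      have h1 : ContDiffOn ℝ k (fderiv ℝ f) U :=
        hf.fderiv_of_isOpen hU (by norm_cast)
      exact (h1.comp contDiffOn_fst fun p hp => hp.1).clm_apply contDiffOn_snd

end Ck

/-! ### Smooth maps between locally convex spaces -/

section CInf

variable {E : Type u} [AddCommGroup E] [Module ℝ E] [TopologicalSpace E]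
  {F : Type v} [AddCommGroup F] [Module ℝ F] [TopologicalSpace F]

theorem IsCInf.continuousOn {f : E → F} {U : Set E} (hf : IsCInf f U) : ContinuousOn f U :=
  (hf 0).continuousOn

theorem IsCInf.mono {f : E → F} {U V : Set E} (hf : IsCInf f U) (h : V ⊆ U) : IsCInf f V :=
  fun k => IsCk.mono k (hf k) h

theorem IsCInf.congr [IsTopologicalAddGroup E] [ContinuousSMul ℝ E] {f g : E → F} {U : Set E}
    (hU : IsOpen U) (hf : IsCInf f U) (hfg : EqOn f g U) : IsCInf g U :=
  fun k => (hf k).congr hU hfg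

theorem isCInf_of_locally [IsTopologicalAddGroup E] [ContinuousSMul ℝ E] [T2Space F]
    {f : E → F} {U : Set E} (hU : IsOpen U)
    (h : ∀ x ∈ U, ∃ V, IsOpen V ∧ x ∈ V ∧ IsCInf f V) : IsCInf f U :=
  fun k => isCk_of_locally hU fun x hx => by
    obtain ⟨V, hV, hxV, hf⟩ := h x hx
    exact ⟨V, hV, hxV, hf k⟩

theorem IsCInf.comp {H : Type w} [AddCommGroup H] [Module ℝ H] [TopologicalSpace H]
    [IsTopologicalAddGroup F] [ContinuousSMul ℝ F]
    [IsTopologicalAddGroup H] [ContinuousSMul ℝ H] [LocallyConvexSpace ℝ H]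
    {g : F → H} {f : E → F} {V : Set F} {U : Set E} (hV : IsOpen V)
    (hg : IsCInf g V) (hf : IsCInf f U) (hUV : MapsTo f U V) : IsCInf (fun x => g (f x)) U :=
  fun k => (hg k).comp hV (hf k) hUV

theorem IsCInf.prodMk {F' : Type w} [AddCommGroup F'] [Module ℝ F'] [TopologicalSpace F']
    {f : E → F} {g : E → F'} {U : Set E} (hf : IsCInf f U) (hg : IsCInf g U) :
    IsCInf (fun x => (f x, g x)) U :=
  fun k => IsCk.prodMk k (hf k) (hg k)

theorem isCInf_clm (L : E →L[ℝ] F) (U : Set E) : IsCInf L U :=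
  fun k => isCk_linear k L U

theorem isCInf_const (c : F) (U : Set E) : IsCInf (fun _ : E => c) U := by
  intro k
  induction k generalizing E c with
  | zero => exact continuousOn_const
  | succ k ih => exact ⟨continuousOn_const, fun _ => 0, fun x _ h => hasDirDeriv_const c x h,
      ih 0 _⟩

theorem IsCInf.hasDirDeriv [IsTopologicalAddGroup E] [ContinuousSMul ℝ E] [T2Space F]
    {f : E → F} {U : Set E} (hU : IsOpen U) (hf : IsCInf f U) {x : E} (hx : x ∈ U) (h : E) :
    HasDirDeriv f x h (dirDeriv f x h) :=
  ((isCk_succ_iff hU).1 (hf 1)).2.1 x hx h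

theorem IsCInf.dirDeriv [IsTopologicalAddGroup E] [ContinuousSMul ℝ E] [T2Space F]
    {f : E → F} {U : Set E} (hU : IsOpen U) (hf : IsCInf f U) :
    IsCInf (fun p : E × E => dirDeriv f p.1 p.2) (U ×ˢ (univ : Set E)) :=
  fun k => ((isCk_succ_iff hU).1 (hf (k + 1))).2.2

theorem IsCInf.isLinearMap [IsTopologicalAddGroup E] [ContinuousSMul ℝ E]
    [IsTopologicalAddGroup F] [ContinuousSMul ℝ F] [LocallyConvexSpace ℝ F] [T2Space F]
    {f : E → F} {U : Set E} (hU : IsOpen U) (hf : IsCInf f U) {x : E} (hx : x ∈ U) :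
    IsLinearMap ℝ (_root_.dirDeriv f x) where
  map_add h k := (hasDirDeriv_add hU (fun _ hy l => hf.hasDirDeriv hU hy l)
    (hf.dirDeriv hU).continuousOn hx h k).dirDeriv_eq
  map_smul c h := ((hf.hasDirDeriv hU hx h).smul c).dirDeriv_eq

theorem HasDirDeriv.comp_isCInf {H : Type w} [AddCommGroup H] [Module ℝ H] [TopologicalSpace H]
    [IsTopologicalAddGroup F] [ContinuousSMul ℝ F]
    [IsTopologicalAddGroup H] [ContinuousSMul ℝ H] [LocallyConvexSpace ℝ H] [T2Space H]
    {g : F → H} {V : Set F} (hV : IsOpen V) (hg : IsCInf g V) {f : E → F} {x h : E} {d : F}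
    (hf : HasDirDeriv f x h d) (hx : f x ∈ V) :
    HasDirDeriv (fun z => g (f z)) x h (_root_.dirDeriv g (f x) d) :=
  hf.comp hV (dg := fun p => _root_.dirDeriv g p.1 p.2)
    (fun _ hy l => hg.hasDirDeriv hV hy l) (hg.dirDeriv hV).continuousOn hx

theorem ContDiffOn.isCInf {E : Type u} [NormedAddCommGroup E] [NormedSpace ℝ E]
    {F : Type v} [NormedAddCommGroup F] [NormedSpace ℝ F] {f : E → F} {U : Set E} (hU : IsOpen U)
    (hf : ∀ k : ℕ, ContDiffOn ℝ k f U) : IsCInf f U :=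
  fun k => (hf k).isCk hU

end CInf

/-! ### Smooth maps of manifolds -/

/-- `f` is smooth on a neighbourhood of `x`. -/
def SmoothNear (M : LCManifold.{u}) (N : LCManifold.{v}) (f : M → N) (x : M) : Prop :=
  ∃ W : Set M, IsOpen W ∧ x ∈ W ∧ SmoothOn f W

section SmoothNear

variable {M : LCManifold.{u}} {N : LCManifold.{v}} {K : LCManifold.{w}}

theorem SmoothOn.mono {f : M → N} {W V : Set M} (hf : SmoothOn f W) (h : V ⊆ W) : SmoothOn f V :=
  ⟨hf.1.mono h, fun e he e' he' => (hf.2 e he e' he').mono fun _ hx => ⟨hx.1, h hx.2.1, hx.2.2⟩⟩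

theorem isOpen_chart_domain {f : M → N} {W : Set M} (hW : IsOpen W) (hf : ContinuousOn f W)
    (e : OpenPartialHomeomorph M.carrier M.model) (e' : OpenPartialHomeomorph N.carrier N.model) :
    IsOpen (e.target ∩ e.symm ⁻¹' (W ∩ f ⁻¹' e'.source)) :=
  e.isOpen_inter_preimage_symm (hf.isOpen_inter_preimage hW e'.open_source)

theorem SmoothOn.smoothNear {f : M → N} {W : Set M} (hf : SmoothOn f W) (hW : IsOpen W) {x : M}
    (hx : x ∈ W) : SmoothNear M N f x :=
  ⟨W, hW, hx, hf⟩

theorem Smooth.smoothNear {f : M → N} (hf : Smooth f) (x : M) : SmoothNear M N f x :=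
  ⟨univ, isOpen_univ, mem_univ x, hf⟩

theorem SmoothNear.continuousAt {f : M → N} {x : M} (hf : SmoothNear M N f x) :
    ContinuousAt f x := by
  obtain ⟨W, hW, hx, hf⟩ := hf
  exact hf.1.continuousAt (hW.mem_nhds hx)

theorem SmoothNear.eventually {f : M → N} {x : M} (hf : SmoothNear M N f x) :
    ∀ᶠ x' in 𝓝 x, SmoothNear M N f x' := by
  obtain ⟨W, hW, hx, hf⟩ := hf
  filter_upwards [hW.mem_nhds hx] with x' hx' using ⟨W, hW, hx', hf⟩

theorem smoothOn_of_smoothNear {f : M → N} {W : Set M} (hW : IsOpen W)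
    (h : ∀ x ∈ W, SmoothNear M N f x) : SmoothOn f W := by
  have hc : ContinuousOn f W := fun x hx => (h x hx).continuousAt.continuousWithinAt
  refine ⟨hc, fun e he e' he' => ?_⟩
  refine isCInf_of_locally (isOpen_chart_domain hW hc e e') fun u hu => ?_
  obtain ⟨V, hV, hxV, hf⟩ := h _ hu.2.1
  exact ⟨_, isOpen_chart_domain hV hf.1 e e', ⟨hu.1, hxV, hu.2.2⟩, hf.2 e he e' he'⟩

theorem smooth_of_smoothNear {f : M → N} (h : ∀ x, SmoothNear M N f x) : Smooth f :=
  smoothOn_of_smoothNear isOpen_univ fun x _ => h x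

theorem SmoothNear.congr {f g : M → N} {x : M} (hf : SmoothNear M N f x) (hfg : f =ᶠ[𝓝 x] g) :
    SmoothNear M N g x := by
  obtain ⟨W, hW, hx, hf⟩ := hf
  obtain ⟨V, hVs, hV, hxV⟩ := mem_nhds_iff.1 hfg
  have hWV := hW.inter hV
  have hf' := hf.mono (V := W ∩ V) inter_subset_left
  have heq : EqOn f g (W ∩ V) := fun y hy => hVs hy.2
  have hc : ContinuousOn g (W ∩ V) := hf'.1.congr heq.symm
  refine ⟨W ∩ V, hWV, ⟨hx, hxV⟩, hc, fun e he e' he' => ?_⟩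
  refine IsCInf.congr (isOpen_chart_domain hWV hc e e') ((hf'.2 e he e' he').mono ?_) ?_
  · rintro u ⟨hu, hu', hu''⟩
    refine ⟨hu, hu', ?_⟩
    rw [mem_preimage, heq hu']
    exact hu''
  · intro u hu
    simp only [heq hu.2.1]

theorem SmoothNear.comp {g : N → K} {f : M → N} {x : M} (hg : SmoothNear N K g (f x))
    (hf : SmoothNear M N f x) : SmoothNear M K (fun z => g (f z)) x := by
  obtain ⟨V, hV, hxV, hg⟩ := hg
  obtain ⟨W, hW, hxW, hf⟩ := hf
  have hO : IsOpen (W ∩ f ⁻¹' V) := hf.1.isOpen_inter_preimage hW hV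
  have hc : ContinuousOn (fun z => g (f z)) (W ∩ f ⁻¹' V) :=
    hg.1.comp (hf.1.mono inter_subset_left) fun z hz => hz.2
  refine ⟨W ∩ f ⁻¹' V, hO, ⟨hxW, hxV⟩, hc, fun e he e'' he'' => ?_⟩
  refine isCInf_of_locally (isOpen_chart_domain hO hc e e'') fun u hu => ?_
  -- An intermediate chart exists only near each point, so smoothness is checked locally, with `e'`
  -- centred at the image point.
  let e' := N.chart (f (e.symm u))
  have he' : e' ∈ atlas N.model N.carrier := chart_mem_atlas _ _
  have h1 := isOpen_chart_domain hO (hf.1.mono inter_subset_left) e e'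
  have h2 := isOpen_chart_domain hO hc e e''
  refine ⟨_, h1.inter h2, ⟨⟨hu.1, hu.2.1, mem_chart_source _ _⟩, hu⟩, ?_⟩
  have h3 := IsCInf.comp (isOpen_chart_domain hV hg.1 e' e'') (hg.2 e' he' e'' he'')
    ((hf.2 e he e' he').mono (V := (e.target ∩ e.symm ⁻¹' (W ∩ f ⁻¹' V ∩ f ⁻¹' e'.source)) ∩
      (e.target ∩ e.symm ⁻¹' (W ∩ f ⁻¹' V ∩ (fun z => g (f z)) ⁻¹' e''.source)))
      fun z hz => ⟨hz.1.1, hz.1.2.1.1, hz.1.2.2⟩) fun z hz => ?_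
  · refine h3.congr (h1.inter h2) fun z hz => ?_
    simp only [e'.left_inv hz.1.2.2]
  · have hz' := hz.1.2.2
    refine ⟨e'.map_source hz', ?_, ?_⟩
    · simp only [e'.left_inv hz']
      exact hz.1.2.1.2
    · change g (e'.symm (e' (f (e.symm z)))) ∈ e''.source
      rw [e'.left_inv hz']
      exact hz.2.2.2

theorem smoothNear_chart {e : OpenPartialHomeomorph M.carrier M.model}
    (he : e ∈ atlas M.model M.carrier) {x : M} (hx : x ∈ e.source) :
    SmoothNear M (ofSpace M.model) e x := by
  refine ⟨e.source, e.open_source, hx, e.continuousOn, fun e₁ he₁ e' he' => ?_⟩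
  rw [chartedSpaceSelf_atlas] at he'
  subst he'
  exact (M.compatible e₁ he₁ e he).mono fun u hu => ⟨hu.1, hu.2.1⟩

theorem smoothNear_chart_symm {e : OpenPartialHomeomorph M.carrier M.model}
    (he : e ∈ atlas M.model M.carrier) {u : M.model} (hu : u ∈ e.target) :
    SmoothNear (ofSpace M.model) M e.symm u := by
  refine ⟨e.target, e.open_target, hu, e.continuousOn_symm, fun e₁ he₁ e' he' => ?_⟩
  rw [chartedSpaceSelf_atlas] at he₁
  subst he₁
  exact (M.compatible e he e' he').mono fun u hu => hu.2

theorem smoothNear_id (x : M) : SmoothNear M M (fun z => z) x :=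
  ⟨univ, isOpen_univ, mem_univ _, continuousOn_id, fun e he e' he' =>
    (M.compatible e he e' he').mono fun _ hu => ⟨hu.1, hu.2.2⟩⟩

theorem smoothNear_const (c : N) (x : M) : SmoothNear M N (fun _ => c) x :=
  ⟨univ, isOpen_univ, mem_univ _, continuousOn_const, fun _ _ e' _ => isCInf_const (e' c) _⟩

theorem smoothNear_fst (x : M.prod N) : SmoothNear (M.prod N) M Prod.fst x := by
  refine ⟨univ, isOpen_univ, mem_univ _, continuousOn_fst, ?_⟩
  rintro _ ⟨e₁, h₁, e₂, h₂, rfl⟩ e' he'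
  refine IsCInf.comp (g := fun x => e' (e₁.symm x)) (V := e₁.target ∩ e₁.symm ⁻¹' e'.source)
    ?_ (M.compatible e₁ h₁ e' he')
    (isCInf_clm (ContinuousLinearMap.fst ℝ M.model N.model) _) ?_
  · exact e₁.isOpen_inter_preimage_symm e'.open_source
  · intro u hu
    exact ⟨hu.1.1, hu.2.2⟩

theorem smoothNear_snd (x : M.prod N) : SmoothNear (M.prod N) N Prod.snd x := by
  refine ⟨univ, isOpen_univ, mem_univ _, continuousOn_snd, ?_⟩
  rintro _ ⟨e₁, h₁, e₂, h₂, rfl⟩ e' he'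
  refine IsCInf.comp (g := fun x => e' (e₂.symm x)) (V := e₂.target ∩ e₂.symm ⁻¹' e'.source)
    ?_ (N.compatible e₂ h₂ e' he')
    (isCInf_clm (ContinuousLinearMap.snd ℝ M.model N.model) _) ?_
  · exact e₂.isOpen_inter_preimage_symm e'.open_source
  · intro u hu
    exact ⟨hu.1.2, hu.2.2⟩

theorem SmoothNear.prodMk {f : K → M} {g : K → N} {x : K} (hf : SmoothNear K M f x)
    (hg : SmoothNear K N g x) : SmoothNear K (M.prod N) (fun z => (f z, g z)) x := by
  obtain ⟨W, hW, hxW, hf⟩ := hf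
  obtain ⟨V, hV, hxV, hg⟩ := hg
  refine ⟨W ∩ V, hW.inter hV, ⟨hxW, hxV⟩,
    (hf.1.mono inter_subset_left).prodMk (hg.1.mono inter_subset_right), ?_⟩
  rintro e he _ ⟨e₁, h₁, e₂, h₂, rfl⟩
  refine IsCInf.prodMk ((hf.2 e he e₁ h₁).mono ?_) ((hg.2 e he e₂ h₂).mono ?_)
  · intro u hu
    exact ⟨hu.1, hu.2.1.1, hu.2.2.1⟩
  · intro u hu
    exact ⟨hu.1, hu.2.1.2, hu.2.2.2⟩

theorem SmoothNear.comp₂ {L : LCManifold.{z}} {F : M.prod N → L} {a : K → M} {b : K → N} {x : K}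
    (hF : SmoothNear (M.prod N) L F (a x, b x)) (ha : SmoothNear K M a x)
    (hb : SmoothNear K N b x) : SmoothNear K L (fun z => F (a z, b z)) x :=
  SmoothNear.comp (N := M.prod N) (g := F) (f := fun z => (a z, b z)) hF (ha.prodMk hb)

end SmoothNear

/-! ### Vector spaces as manifolds -/

section Space

variable {E : Type u} [AddCommGroup E] [Module ℝ E] [TopologicalSpace E]
    [IsTopologicalAddGroup E] [ContinuousSMul ℝ E] [LocallyConvexSpace ℝ E] [T2Space E]
  {F : Type v} [AddCommGroup F] [Module ℝ F] [TopologicalSpace F]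
    [IsTopologicalAddGroup F] [ContinuousSMul ℝ F] [LocallyConvexSpace ℝ F] [T2Space F]

theorem smoothNear_ofSpace_iff {f : E → F} {x : E} :
    SmoothNear (ofSpace E) (ofSpace F) f x ↔ ∃ U, IsOpen U ∧ x ∈ U ∧ IsCInf f U := by
  constructor
  · rintro ⟨W, hW, hx, hf⟩
    refine ⟨W, hW, hx, ?_⟩
    have := hf.2 (OpenPartialHomeomorph.refl E) (by rw [chartedSpaceSelf_atlas])
      (OpenPartialHomeomorph.refl F) (by rw [chartedSpaceSelf_atlas])
    exact this.mono fun u hu => ⟨mem_univ _, hu, mem_univ _⟩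
  · rintro ⟨W, hW, hx, hf⟩
    refine ⟨W, hW, hx, hf.continuousOn, fun e he e' he' => ?_⟩
    rw [chartedSpaceSelf_atlas] at he he'
    subst he he'
    exact hf.mono fun u hu => hu.2.1

theorem isCInf_of_smoothNear {f : E → F} {U : Set E} (hU : IsOpen U)
    (h : ∀ x ∈ U, SmoothNear (ofSpace E) (ofSpace F) f x) : IsCInf f U :=
  isCInf_of_locally hU fun x hx => by
    obtain ⟨V, hV, hxV, hf⟩ := smoothNear_ofSpace_iff.1 (h x hx)
    exact ⟨V, hV, hxV, hf⟩

theorem IsCInf.smoothNear {f : E → F} {U : Set E} (hf : IsCInf f U) (hU : IsOpen U) {x : E}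
    (hx : x ∈ U) : SmoothNear (ofSpace E) (ofSpace F) f x :=
  smoothNear_ofSpace_iff.2 ⟨U, hU, hx, hf⟩

theorem smoothNear_clm (L : E →L[ℝ] F) (x : E) : SmoothNear (ofSpace E) (ofSpace F) L x :=
  (isCInf_clm L univ).smoothNear isOpen_univ (mem_univ x)

/-- A manifold `ofSpace E × ofSpace F` and the space `E × F` have the same smooth maps into them. -/
theorem SmoothNear.prodMk_space {K : LCManifold.{w}} {f : K → E} {g : K → F} {x : K}
    (hf : SmoothNear K (ofSpace E) f x) (hg : SmoothNear K (ofSpace F) g x) :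
    SmoothNear K (ofSpace (E × F)) (fun z => (f z, g z)) x := by
  obtain ⟨W, hW, hxW, hf⟩ := hf
  obtain ⟨V, hV, hxV, hg⟩ := hg
  refine ⟨W ∩ V, hW.inter hV, ⟨hxW, hxV⟩,
    (hf.1.mono inter_subset_left).prodMk (hg.1.mono inter_subset_right), fun e he e' he' => ?_⟩
  rw [chartedSpaceSelf_atlas] at he'
  subst he'
  refine IsCInf.prodMk ((hf.2 e he (OpenPartialHomeomorph.refl E)
    (by rw [chartedSpaceSelf_atlas])).mono ?_) ((hg.2 e he (OpenPartialHomeomorph.refl F)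
    (by rw [chartedSpaceSelf_atlas])).mono ?_)
  · intro u hu
    exact ⟨hu.1, hu.2.1.1, mem_univ _⟩
  · intro u hu
    exact ⟨hu.1, hu.2.1.2, mem_univ _⟩

end Space

/-! ### Tangent maps -/

section Tangent

variable {M : LCManifold.{u}} {N : LCManifold.{v}} {K : LCManifold.{w}}

/-- The expression of `f` in the preferred charts at `x` and `f x`. -/
def chartRep (M : LCManifold.{u}) (N : LCManifold.{v}) (f : M → N) (x : M) : M.model → N.model :=
  fun x' => N.chart (f x) (f ((M.chart x).symm x'))

theorem chart_symm_chart (x : M) : (M.chart x).symm (M.chart x x) = x :=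
  (M.chart x).left_inv (mem_chart_source _ x)

theorem chart_mem_target (x : M) : M.chart x x ∈ (M.chart x).target :=
  (M.chart x).map_source (mem_chart_source _ x)

theorem continuousAt_chart_symm (x : M) :
    Tendsto (M.chart x).symm (𝓝 (M.chart x x)) (𝓝 x) := by
  have := (M.chart x).symm.continuousAt (x := M.chart x x) (chart_mem_target x)
  rwa [ContinuousAt, chart_symm_chart] at this

theorem SmoothNear.exists_isCInf_chartRep {f : M → N} {x : M} (hf : SmoothNear M N f x) :
    ∃ U, IsOpen U ∧ M.chart x x ∈ U ∧ IsCInf (chartRep M N f x) U := by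
  rw [← smoothNear_ofSpace_iff]
  have h1 := smoothNear_chart_symm (chart_mem_atlas _ x) (chart_mem_target x)
  have h2 : SmoothNear N (ofSpace N.model) (N.chart (f x)) (f x) :=
    smoothNear_chart (chart_mem_atlas _ _) (mem_chart_source _ _)
  have h3 : SmoothNear M (ofSpace N.model) (fun z => N.chart (f x) (f z)) x := h2.comp hf
  rw [← chart_symm_chart x] at h3
  exact (h3.comp h1).congr (Eventually.of_forall fun u => by
    simp only [chartRep, chart_symm_chart])

theorem SmoothNear.hasDirDeriv {f : M → N} {x : M} (hf : SmoothNear M N f x) (h : M.model) :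
    HasDirDeriv (chartRep M N f x) (M.chart x x) h (tmap f x h) := by
  obtain ⟨U, hU, hx, hf⟩ := hf.exists_isCInf_chartRep
  exact hf.hasDirDeriv hU hx h

theorem SmoothNear.isLinearMap_tmap {f : M → N} {x : M} (hf : SmoothNear M N f x) :
    IsLinearMap ℝ (tmap f x) := by
  obtain ⟨U, hU, hx, hf⟩ := hf.exists_isCInf_chartRep
  exact hf.isLinearMap hU hx

/-- Only germs matter, and no smoothness is assumed: the preferred charts used are the same because
`f x = g x`. -/
theorem tmap_congr {f g : M → N} {x : M} (hfg : f =ᶠ[𝓝 x] g) (h : M.model) :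
    tmap f x h = tmap g x h := by
  have := hfg.eq_of_nhds
  unfold tmap
  rw [this]
  refine dirDeriv_congr ?_ h
  filter_upwards [(continuousAt_chart_symm x).eventually hfg] with u hu
  rw [hu]

/-- The preferred chart at `f x` and its inverse cancel near `x`, which leaves the chain rule for
the local expressions. -/
theorem tmap_comp {g : N → K} {f : M → N} {x : M} (hg : SmoothNear N K g (f x))
    (hf : SmoothNear M N f x) (h : M.model) :
    tmap (M := M) (N := K) (fun z => g (f z)) x h = tmap g (f x) (tmap f x h) := by
  obtain ⟨U, hU, hx, hg'⟩ := hg.exists_isCInf_chartRep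
  have e1 : chartRep M N f x (M.chart x x) = N.chart (f x) (f x) := by
    simp only [chartRep, chart_symm_chart]
  have h1 := HasDirDeriv.comp_isCInf hU hg' (hf.hasDirDeriv h) (by rwa [e1])
  rw [e1] at h1
  refine (h1.congr ?_).dirDeriv_eq
  have h2 : ∀ᶠ z in 𝓝 x, f z ∈ (N.chart (f x)).source :=
    hf.continuousAt.eventually ((N.chart (f x)).open_source.mem_nhds (mem_chart_source _ _))
  filter_upwards [(continuousAt_chart_symm x).eventually h2] with u hu
  simp only [chartRep, (N.chart (f x)).left_inv hu]

theorem tmap_id (x : M) (h : M.model) : tmap (M := M) (N := M) (fun z => z) x h = h := by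
  refine ((hasDirDeriv_clm (ContinuousLinearMap.id ℝ M.model) _ h).congr ?_).dirDeriv_eq
  filter_upwards [(M.chart x).open_target.mem_nhds (chart_mem_target x)] with u hu
  exact ((M.chart x).right_inv hu).symm

theorem tmap_const (c : N) (x : M) (h : M.model) :
    tmap (M := M) (N := N) (fun _ => c) x h = 0 :=
  (hasDirDeriv_const _ _ _).dirDeriv_eq

theorem tmap_prodMk {f : K → M} {g : K → N} {x : K} (hf : SmoothNear K M f x)
    (hg : SmoothNear K N g x) (h : K.model) :
    tmap (M := K) (N := M.prod N) (fun z => (f z, g z)) x h = (tmap f x h, tmap g x h) :=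
  HasDirDeriv.dirDeriv_eq ((hf.hasDirDeriv h).prodMk_nhds (hg.hasDirDeriv h))

theorem tmap_fst (x : M.prod N) (h : (M.prod N).model) :
    tmap (M := M.prod N) (N := M) Prod.fst x h = h.1 := by
  refine ((hasDirDeriv_clm (ContinuousLinearMap.fst ℝ M.model N.model)
    ((M.prod N).chart x x) h).congr ?_).dirDeriv_eq
  filter_upwards [((M.prod N).chart x).open_target.mem_nhds (chart_mem_target x)] with u hu
  exact ((M.chart x.1).right_inv hu.1).symm

theorem tmap_snd (x : M.prod N) (h : (M.prod N).model) :
    tmap (M := M.prod N) (N := N) Prod.snd x h = h.2 := by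
  refine ((hasDirDeriv_clm (ContinuousLinearMap.snd ℝ M.model N.model)
    ((M.prod N).chart x x) h).congr ?_).dirDeriv_eq
  filter_upwards [((M.prod N).chart x).open_target.mem_nhds (chart_mem_target x)] with u hu
  exact ((N.chart x.2).right_inv hu.2).symm

theorem tmap_fst_comp {f : K → M.prod N} {x : K} (hf : SmoothNear K (M.prod N) f x)
    (h : K.model) : tmap (M := K) (N := M) (fun z => (f z).1) x h =
      (tmap (M := K) (N := M.prod N) f x h).1 := by
  rw [tmap_comp (g := Prod.fst) (smoothNear_fst _) hf, tmap_fst]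

theorem tmap_snd_comp {f : K → M.prod N} {x : K} (hf : SmoothNear K (M.prod N) f x)
    (h : K.model) : tmap (M := K) (N := N) (fun z => (f z).2) x h =
      (tmap (M := K) (N := M.prod N) f x h).2 := by
  rw [tmap_comp (g := Prod.snd) (smoothNear_snd _) hf, tmap_snd]

/-- The derivative of a map of two variables along a pair of maps is the sum of the partial
derivatives. -/
theorem tmap_partial {L : LCManifold.{z}} {F : M.prod N → L} {a : K → M} {b : K → N} {x : K}
    (hF : SmoothNear (M.prod N) L F (a x, b x)) (ha : SmoothNear K M a x)
    (hb : SmoothNear K N b x) (h : K.model) :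
    tmap (M := K) (N := L) (fun z => F (a z, b z)) x h =
      tmap (M := M) (N := L) (fun m => F (m, b x)) (a x) (tmap a x h) +
        tmap (M := N) (N := L) (fun n => F (a x, n)) (b x) (tmap b x h) := by
  -- Both partial derivatives are values of the tangent map of `F`, on vectors with one component
  -- zero; additivity recombines them.
  rw [tmap_comp (f := fun z => (a z, b z)) (g := F) hF (ha.prodMk hb), tmap_prodMk ha hb,
    tmap_comp (M := M) (f := fun m => (m, b x)) (g := F) hF
      ((smoothNear_id _).prodMk (smoothNear_const _ _)),
    tmap_comp (M := N) (f := fun n => (a x, n)) (g := F) hF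
      ((smoothNear_const _ _).prodMk (smoothNear_id _)),
    tmap_prodMk (smoothNear_id _) (smoothNear_const _ _),
    tmap_prodMk (smoothNear_const _ _) (smoothNear_id _), tmap_id, tmap_id, tmap_const, tmap_const,
    ← hF.isLinearMap_tmap.map_add]
  simp

/-- True by definition because the preferred chart of a vector space is the identity. Chart
components of forms thereby become statements about tangent maps. -/
theorem ofChart_eq_tmap (e : OpenPartialHomeomorph M.carrier M.model) (u h : M.model) :
    M.ofChart e u h = tmap (M := ofSpace M.model) (N := M) e.symm u h :=
  rfl

theorem tmap_ofSpace {E : Type u} [AddCommGroup E] [Module ℝ E] [TopologicalSpace E]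
    [IsTopologicalAddGroup E] [ContinuousSMul ℝ E] [LocallyConvexSpace ℝ E] [T2Space E]
    {F : Type v} [AddCommGroup F] [Module ℝ F] [TopologicalSpace F]
    [IsTopologicalAddGroup F] [ContinuousSMul ℝ F] [LocallyConvexSpace ℝ F] [T2Space F]
    (f : E → F) (x h : E) : tmap (M := ofSpace E) (N := ofSpace F) f x h = dirDeriv f x h :=
  rfl

theorem velocity_comp {f : M → N} {c : ℝ → M} {t : ℝ} (hf : SmoothNear M N f (c t))
    (hc : SmoothNear (ofSpace ℝ) M c t) :
    velocity (M := N) (fun s => f (c s)) t = tmap f (c t) (velocity c t) :=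
  tmap_comp hf hc 1

/-- The pull-back of a smooth 1-form along a smooth map from an open set is smooth. -/
theorem IsOneForm.smoothNear_pullback {E : Type w} [AddCommGroup E] [Module ℝ E]
    [TopologicalSpace E] [IsTopologicalAddGroup E] [ContinuousSMul ℝ E] [LocallyConvexSpace ℝ E]
    [T2Space E] {F : Type v} [AddCommGroup F] [Module ℝ F] [TopologicalSpace F]
    [IsTopologicalAddGroup F] [ContinuousSMul ℝ F] [LocallyConvexSpace ℝ F] [T2Space F]
    {α : M → M.model → F} (hα : IsOneForm M α) {s : E → M} {u : E}
    (hs : SmoothNear (ofSpace E) M s u) (k : E) :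
    SmoothNear (ofSpace (E × E)) (ofSpace F)
      (fun p : E × E => α (s p.1) (tmap (M := ofSpace E) (N := M) s p.1 p.2)) (u, k) := by
  let e := M.chart (s u)
  have he : e ∈ atlas M.model M.carrier := chart_mem_atlas _ _
  have hsu : s u ∈ e.source := mem_chart_source _ _
  obtain ⟨U, hU, huU, hes⟩ := smoothNear_ofSpace_iff.1 ((smoothNear_chart he hsu).comp hs)
  obtain ⟨W, hW, huW, hs⟩ := hs
  let V := U ∩ (W ∩ s ⁻¹' e.source)
  have hV : IsOpen V := hU.inter (hs.1.isOpen_inter_preimage hW e.open_source)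
  have huV : u ∈ V := ⟨huU, huW, hsu⟩
  have hes' : IsCInf (fun z => e (s z)) V := hes.mono inter_subset_left
  -- The pull-back is the coordinate expression of `α` in `e`, evaluated on `e ∘ s` and its
  -- derivative.
  have h1 : IsCInf (fun p : E × E => (e (s p.1), dirDeriv (fun z => e (s z)) p.1 p.2))
      (V ×ˢ (univ : Set E)) :=
    IsCInf.prodMk (IsCInf.comp (g := fun z => e (s z)) hV hes' (isCInf_clm (ContinuousLinearMap.fst ℝ E E) _)
      fun p hp => hp.1) (hes'.dirDeriv hV)
  have h2 := IsCInf.comp (e.open_target.prod isOpen_univ) (hα.smooth e he) h1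
    fun p hp => ⟨e.map_source hp.1.2.2, mem_univ _⟩
  refine (h2.congr (hV.prod isOpen_univ) fun p hp => ?_).smoothNear (hV.prod isOpen_univ)
    ⟨huV, mem_univ k⟩
  have hp1 : s p.1 ∈ e.source := hp.1.2.2
  have hsp : SmoothNear (ofSpace E) M s p.1 := hs.smoothNear hW hp.1.2.1
  simp only [e.left_inv hp1]
  congr 1
  rw [ofChart_eq_tmap, ← tmap_ofSpace, ← tmap_comp (M := ofSpace E) (N := ofSpace M.model)
    (f := fun z => e (s z)) (g := e.symm) (smoothNear_chart_symm he (e.map_source hp1))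
    ((smoothNear_chart he hp1).comp hsp)]
  refine tmap_congr ?_ _
  filter_upwards [hsp.continuousAt.eventually (e.open_source.mem_nhds hp1)] with z hz
  exact e.left_inv hz

end Tangent

/-! ### Circle-valued functions and circle bundles -/

section CircleFunctions

variable {M : LCManifold.{u}} {N : LCManifold.{v}}

/-- The `𝕋`-valued function `τ` is smooth on a neighbourhood of `x`. -/
def CircleSmoothNear (M : LCManifold.{u}) (τ : M → Circle) (x : M) : Prop :=
  SmoothNear M (ofSpace ℂ) (fun z => (τ z : ℂ)) x

theorem smoothNear_of_contDiffOn {E : Type u} [NormedAddCommGroup E] [NormedSpace ℝ E]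
    {F : Type v} [NormedAddCommGroup F] [NormedSpace ℝ F] {f : E → F} {U : Set E} (hU : IsOpen U)
    (hf : ∀ k : ℕ, ContDiffOn ℝ k f U) {x : E} (hx : x ∈ U) :
    SmoothNear (ofSpace E) (ofSpace F) f x :=
  (ContDiffOn.isCInf hU hf).smoothNear hU hx

theorem SmoothNear.add_space {E : Type v} [AddCommGroup E] [Module ℝ E] [TopologicalSpace E]
    [IsTopologicalAddGroup E] [ContinuousSMul ℝ E] [LocallyConvexSpace ℝ E] [T2Space E]
    {a b : M → E} {x : M} (ha : SmoothNear M (ofSpace E) a x) (hb : SmoothNear M (ofSpace E) b x) :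
    SmoothNear M (ofSpace E) (fun z => a z + b z) x :=
  (smoothNear_clm (ContinuousLinearMap.fst ℝ E E + ContinuousLinearMap.snd ℝ E E)
    (a x, b x)).comp (ha.prodMk_space hb)

theorem SmoothNear.sub_space {E : Type v} [AddCommGroup E] [Module ℝ E] [TopologicalSpace E]
    [IsTopologicalAddGroup E] [ContinuousSMul ℝ E] [LocallyConvexSpace ℝ E] [T2Space E]
    {a b : M → E} {x : M} (ha : SmoothNear M (ofSpace E) a x) (hb : SmoothNear M (ofSpace E) b x) :
    SmoothNear M (ofSpace E) (fun z => a z - b z) x :=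
  (smoothNear_clm (ContinuousLinearMap.fst ℝ E E - ContinuousLinearMap.snd ℝ E E)
    (a x, b x)).comp (ha.prodMk_space hb)

theorem circleSmoothNear_const (c : Circle) (x : M) : CircleSmoothNear M (fun _ => c) x :=
  smoothNear_const (N := ofSpace ℂ) (c : ℂ) x

theorem CircleSmoothNear.mul {τ τ' : M → Circle} {x : M} (h : CircleSmoothNear M τ x)
    (h' : CircleSmoothNear M τ' x) : CircleSmoothNear M (fun z => τ z * τ' z) x := by
  have h1 : SmoothNear (ofSpace (ℂ × ℂ)) (ofSpace ℂ) (fun p : ℂ × ℂ => p.1 * p.2)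
      ((τ x : ℂ), (τ' x : ℂ)) :=
    smoothNear_of_contDiffOn isOpen_univ
      (fun k => (contDiff_fst.mul contDiff_snd).contDiffOn) (mem_univ _)
  exact h1.comp (SmoothNear.prodMk_space h h')

/-- On the unit circle inversion is complex conjugation, which is real-linear. -/
theorem CircleSmoothNear.inv {τ : M → Circle} {x : M} (h : CircleSmoothNear M τ x) :
    CircleSmoothNear M (fun z => (τ z)⁻¹) x := by
  have := (smoothNear_clm (Complex.conjCLE : ℂ →L[ℝ] ℂ) (τ x : ℂ)).comp h
  refine this.congr (Eventually.of_forall fun z => ?_)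
  exact (Circle.coe_inv_eq_conj _).symm

theorem CircleSmoothNear.congr {τ τ' : M → Circle} {x : M} (h : CircleSmoothNear M τ x)
    (h' : τ =ᶠ[𝓝 x] τ') : CircleSmoothNear M τ' x :=
  SmoothNear.congr h (h'.mono fun _ hz => congrArg (fun c : Circle => (c : ℂ)) hz)

theorem CircleSmoothNear.comp {τ : N → Circle} {f : M → N} {x : M}
    (h : CircleSmoothNear N τ (f x)) (hf : SmoothNear M N f x) :
    CircleSmoothNear M (fun z => τ (f z)) x :=
  SmoothNear.comp h hf

theorem SmoothNear.circleExp {θ : M → ℝ} {x : M} (h : SmoothNear M (ofSpace ℝ) θ x) :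
    CircleSmoothNear M (fun z => Circle.exp (θ z)) x := by
  have h1 : SmoothNear (ofSpace ℝ) (ofSpace ℂ) (fun t : ℝ => Complex.exp (t * Complex.I)) (θ x) :=
    smoothNear_of_contDiffOn isOpen_univ
      (fun k => (((Complex.ofRealCLM.contDiff).mul contDiff_const).cexp).contDiffOn) (mem_univ _)
  exact (h1.comp h).congr (Eventually.of_forall fun z => (Circle.coe_exp _).symm)

theorem CircleSmoothNear.arg {τ : M → Circle} {x : M} (h : CircleSmoothNear M τ x)
    (hx : (τ x : ℂ) ∈ Complex.slitPlane) :
    SmoothNear M (ofSpace ℝ) (fun z => Complex.arg (τ z)) x := by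
  -- The argument is the imaginary part of the logarithm, smooth off the cut.
  have h1 : SmoothNear (ofSpace ℂ) (ofSpace ℝ) (fun w : ℂ => (Complex.log w).im) (τ x : ℂ) := by
    refine smoothNear_of_contDiffOn Complex.isOpen_slitPlane (fun k z hz => ?_) hx
    exact (Complex.imCLM.contDiff.contDiffAt.comp z
      ((Complex.contDiffAt_log hz).restrict_scalars ℝ)).contDiffWithinAt
  exact (h1.comp h).congr (Eventually.of_forall fun z => Complex.log_im _)

theorem CircleSmoothNear.continuousAt {τ : M → Circle} {x : M} (h : CircleSmoothNear M τ x) :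
    ContinuousAt τ x := by
  have : Topology.IsInducing (fun c : Circle => (c : ℂ)) := ⟨rfl⟩
  exact this.continuousAt_iff.2 (SmoothNear.continuousAt h)

/-- Locally, a smooth circle-valued function is the exponential of a smooth function. -/
theorem CircleSmoothNear.exists_lift {τ : M → Circle} {x : M} (h : CircleSmoothNear M τ x) :
    ∃ θ : M → ℝ, SmoothNear M (ofSpace ℝ) θ x ∧ ∀ z, τ z = Circle.exp (θ z) := by
  -- Division by `τ x` moves the value at `x` to `1`, off the cut. The lift is smooth only near `x`,
  -- but it exponentiates to `τ` everywhere.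
  refine ⟨fun z => Complex.arg ((τ x)⁻¹ * τ z : Circle) + Complex.arg (τ x), ?_, fun z => ?_⟩
  · refine SmoothNear.add_space (CircleSmoothNear.arg ((circleSmoothNear_const _ _).mul h) ?_)
      (smoothNear_const (N := ofSpace ℝ) _ _)
    simp
  · rw [Circle.exp_add, Circle.exp_arg, Circle.exp_arg]
    simp

end CircleFunctions

/-! ### Circle bundles -/

section TBundle

variable {X : LCManifold.{u}} {S : Set X} (P : TBundle X S) {M : LCManifold.{v}}

theorem TBundle.eq_of_smul_eq {z z' : Circle} {p : P.total} (h : z • p = z' • p) : z = z' := by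
  have := P.free (z'⁻¹ * z) p (by rw [mul_smul, h, inv_smul_smul])
  exact (inv_mul_eq_one.1 this).symm

/-- The action is known to be smooth only through `ℝ → 𝕋`, so `τ` is first lifted to an angle. -/
theorem TBundle.smoothNear_smul {τ : M → Circle} {a : M → P.total} {x : M}
    (hτ : CircleSmoothNear M τ x) (ha : SmoothNear M P.total a x) :
    SmoothNear M P.total (fun z => τ z • a z) x := by
  obtain ⟨θ, hθ, h⟩ := hτ.exists_lift
  have := SmoothNear.comp₂ (M := ofSpace ℝ) (P.smooth_act.smoothNear (θ x, a x)) hθ ha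
  exact this.congr (Eventually.of_forall fun z => by simp only [h])

/-- Each fibre is a single `𝕋`-orbit, smoothly in parameters. -/
theorem TBundle.exists_smooth_ratio {a b : M → P.total} {x : M} (ha : SmoothNear M P.total a x)
    (hb : SmoothNear M P.total b x) (hab : ∀ᶠ z in 𝓝 x, P.proj (a z) = P.proj (b z)) :
    ∃ τ : M → Circle, CircleSmoothNear M τ x ∧ ∀ᶠ z in 𝓝 x, b z = τ z • a z := by
  obtain ⟨W, hW, hxW, σ, τ, -, hτ, -, hp⟩ := P.locally_trivial (P.proj (a x)) (P.proj_mem _)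
  have hWo : IsOpen (P.proj ⁻¹' W) := hW.preimage (by
    exact continuousOn_univ.1 P.smooth_proj.1)
  have haW : ∀ᶠ z in 𝓝 x, a z ∈ P.proj ⁻¹' W :=
    ha.continuousAt.eventually (hWo.mem_nhds hxW)
  have hτ' : ∀ p ∈ P.proj ⁻¹' W, CircleSmoothNear P.total τ p := fun p hp =>
    hτ.smoothNear hWo hp
  have hbx : P.proj (b x) ∈ W := by
    rw [← hab.self_of_nhds]
    exact hxW
  -- Both points are multiples of the same value of `σ`, so their ratio is that of their
  -- coordinates.
  refine ⟨fun z => τ (b z) * (τ (a z))⁻¹, ((hτ' _ hbx).comp hb).mul ((hτ' _ hxW).comp ha).inv, ?_⟩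
  filter_upwards [hab, haW] with z hz hzW
  have h1 := hp (a z) hzW
  have h2 := hp (b z) (by rw [mem_preimage, ← hz]; exact hzW)
  have h3 : σ (P.proj (a z)) = (τ (a z))⁻¹ • a z := by
    rw [eq_inv_smul_iff]
    exact h1.symm
  rw [mul_smul, ← h3, hz]
  exact h2

theorem TBundle.exists_smul_eq {p p' : P.total} (h : P.proj p = P.proj p') :
    ∃ z : Circle, p' = z • p := by
  obtain ⟨τ, -, hτ⟩ := P.exists_smooth_ratio (M := P.total) (x := p) (smoothNear_const p p)
    (smoothNear_const p' p) (Eventually.of_forall fun _ => h)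
  exact ⟨τ p, hτ.self_of_nhds⟩

/-- The action is free, so a ratio chosen pointwise must coincide with the smooth one. -/
theorem TBundle.circleSmoothNear_ratio {a b : M → P.total} {x : M}
    (ha : SmoothNear M P.total a x) (hb : SmoothNear M P.total b x) {τ : M → Circle}
    (hτ : ∀ᶠ z in 𝓝 x, b z = τ z • a z) : CircleSmoothNear M τ x := by
  obtain ⟨τ', hτ', h⟩ := P.exists_smooth_ratio ha hb (hτ.mono fun z hz => by
    rw [hz, P.proj_smul])
  refine hτ'.congr ?_
  filter_upwards [hτ, h] with z hz hz'
  exact P.eq_of_smul_eq (hz'.symm.trans hz)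

theorem TBundle.exists_proj_eq {x : X} (hx : x ∈ S) : ∃ p : P.total, P.proj p = x := by
  obtain ⟨W, -, hxW, σ, τ, -, -, hσ, -⟩ := P.locally_trivial x hx
  exact ⟨σ x, hσ x ⟨hxW, hx⟩⟩

theorem TBundle.smoothNear_const_smul (z : Circle) (p : P.total) :
    SmoothNear P.total P.total (fun p' => z • p') p :=
  P.smoothNear_smul (circleSmoothNear_const z p) (smoothNear_id p)

theorem TBundle.smoothNear_proj (p : P.total) : SmoothNear P.total X P.proj p :=
  P.smooth_proj.smoothNear p

end TBundle

/-! ### Group actions and principal quotients -/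

section Action

variable {G M B : LCManifold.{u}} [Group G] [MulAction G M] {K : LCManifold.{v}}

theorem IsLieGroup.smoothNear_mul (hG : IsLieGroup G) {a b : K → G} {x : K}
    (ha : SmoothNear K G a x) (hb : SmoothNear K G b x) :
    SmoothNear K G (fun z => a z * b z) x :=
  SmoothNear.comp₂ (F := fun p : G.prod G => p.1 * p.2) (hG.smooth_mul.smoothNear (a x, b x)) ha hb

theorem IsLieGroup.smoothNear_inv (hG : IsLieGroup G) {a : K → G} {x : K}
    (ha : SmoothNear K G a x) : SmoothNear K G (fun z => (a z)⁻¹) x :=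
  (hG.smooth_inv.smoothNear (a x)).comp ha

theorem IsSmoothAction.smoothNear_smul (hM : IsSmoothAction G M) {a : K → G} {b : K → M} {x : K}
    (ha : SmoothNear K G a x) (hb : SmoothNear K M b x) :
    SmoothNear K M (fun z => a z • b z) x :=
  SmoothNear.comp₂ (F := fun p : G.prod M => p.1 • p.2)
    (Smooth.smoothNear (M := G.prod M) hM (a x, b x)) ha hb

theorem IsSmoothAction.smoothNear_const_smul (hM : IsSmoothAction G M) (g : G) (m : M) :
    SmoothNear M M (fun m' => g • m') m :=
  hM.smoothNear_smul (smoothNear_const g m) (smoothNear_id m)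

theorem IsSmoothAction.smoothNear_smul_const (hM : IsSmoothAction G M) (g : G) (m : M) :
    SmoothNear G M (fun g' => g' • m) g :=
  hM.smoothNear_smul (smoothNear_id g) (smoothNear_const m g)

variable {q : M → B}

theorem IsPrincipalQuotient.eq_of_smul_eq (hq : IsPrincipalQuotient G M B q) {g g' : G} {m : M}
    (h : g • m = g' • m) : g = g' := by
  have := hq.free (g'⁻¹ * g) m (by rw [mul_smul, h, inv_smul_smul])
  exact (inv_mul_eq_one.1 this).symm

theorem IsPrincipalQuotient.map_smul (hq : IsPrincipalQuotient G M B q) (g : G) (m : M) :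
    q (g • m) = q m :=
  ((hq.orbits m (g • m)).2 ⟨g, rfl⟩).symm

theorem IsPrincipalQuotient.continuous (hq : IsPrincipalQuotient G M B q) : Continuous q :=
  continuousOn_univ.1 hq.smooth.1

/-- Where two maps take values in the same orbits, they differ by a smooth map into the group. -/
theorem IsPrincipalQuotient.exists_smooth_transporter_imp (hG : IsLieGroup G)
    (hq : IsPrincipalQuotient G M B q) {a b : K → M} {x : K} (ha : SmoothNear K M a x)
    (hb : SmoothNear K M b x) (hab : q (a x) = q (b x)) :
    ∃ g : K → G, SmoothNear K G g x ∧ ∀ᶠ z in 𝓝 x, q (a z) = q (b z) → b z = g z • a z := by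
  obtain ⟨W, hW, hxW, σ, c, -, hc, -, hm⟩ := hq.locally_trivial (q (a x))
  have hWo : IsOpen (q ⁻¹' W) := hW.preimage hq.continuous
  have haW : ∀ᶠ z in 𝓝 x, a z ∈ q ⁻¹' W := ha.continuousAt.eventually (hWo.mem_nhds hxW)
  -- `c` measures position relative to `σ`. The map obtained is smooth near `x` even at parameters
  -- where the orbits differ; this matters on fibre products, which are not open.
  refine ⟨fun z => c (b z) * (c (a z))⁻¹,
    hG.smoothNear_mul ((hc.smoothNear hWo (show q (b x) ∈ W from hab ▸ hxW)).comp hb)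
      (hG.smoothNear_inv ((hc.smoothNear hWo hxW).comp ha)), ?_⟩
  filter_upwards [haW] with z hzW hz
  have h1 := hm (a z) hzW
  have h2 := hm (b z) (by rw [mem_preimage, ← hz]; exact hzW)
  have h3 : σ (q (a z)) = (c (a z))⁻¹ • a z := by
    rw [eq_inv_smul_iff]
    exact h1.symm
  rw [mul_smul, ← h3, hz]
  exact h2

theorem IsPrincipalQuotient.exists_smooth_transporter (hG : IsLieGroup G)
    (hq : IsPrincipalQuotient G M B q) {a b : K → M} {x : K} (ha : SmoothNear K M a x)
    (hb : SmoothNear K M b x) (hab : ∀ᶠ z in 𝓝 x, q (a z) = q (b z)) :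
    ∃ g : K → G, SmoothNear K G g x ∧ ∀ᶠ z in 𝓝 x, b z = g z • a z := by
  obtain ⟨g, hg, h⟩ := hq.exists_smooth_transporter_imp hG ha hb hab.self_of_nhds
  exact ⟨g, hg, (h.and hab).mono fun z hz => hz.1 hz.2⟩

theorem IsPrincipalQuotient.smoothNear_transporter (hG : IsLieGroup G)
    (hq : IsPrincipalQuotient G M B q) {a b : K → M} {x : K} (ha : SmoothNear K M a x)
    (hb : SmoothNear K M b x) {g : K → G} (hg : ∀ᶠ z in 𝓝 x, b z = g z • a z) :
    SmoothNear K G g x := by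
  obtain ⟨g', hg', h⟩ := hq.exists_smooth_transporter hG ha hb (hg.mono fun z hz => by
    rw [hz, hq.map_smul])
  refine hg'.congr ?_
  filter_upwards [hg, h] with z hz hz'
  exact hq.eq_of_smul_eq (hz'.symm.trans hz)

/-- Every point lies on a smooth local section. -/
theorem IsPrincipalQuotient.exists_section (hM : IsSmoothAction G M)
    (hq : IsPrincipalQuotient G M B q) (m : M) :
    ∃ s : B → M, SmoothNear B M s (q m) ∧ s (q m) = m ∧ ∀ᶠ b in 𝓝 (q m), q (s b) = b := by
  obtain ⟨W, hW, hmW, σ, c, hσ, -, hσq, hm⟩ := hq.locally_trivial (q m)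
  refine ⟨fun b => c m • σ b, ?_, (hm m hmW).symm, ?_⟩
  · exact hM.smoothNear_smul (smoothNear_const _ _) (hσ.smoothNear hW hmW)
  · filter_upwards [hW.mem_nhds hmW] with b hb
    rw [hq.map_smul, hσq b hb]

end Action

/-! ### Quotient manifolds -/

section QuotientManifold

variable (N : LCManifold.{u}) {X : Type u} [TopologicalSpace X] (p : N → X)
  {E : Type u} [AddCommGroup E] [Module ℝ E] [TopologicalSpace E]
    [IsTopologicalAddGroup E] [ContinuousSMul ℝ E] [LocallyConvexSpace ℝ E] [T2Space E]

/-- `e` is a chart of the smooth structure on `X` for which `p : N → X` is smooth with smooth local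
sections. -/
structure IsQuotientChart (e : OpenPartialHomeomorph X E) : Prop where
  smooth_comp : ∀ n, p n ∈ e.source → SmoothNear N (ofSpace E) (fun n => e (p n)) n
  lift : ∀ x ∈ e.target, ∃ s : E → N, SmoothNear (ofSpace E) N s x ∧ ∀ᶠ x' in 𝓝 x, p (s x') = e.symm x'

/-- The quotient manifold `X` of `N`. -/
def quotientManifold [T2Space X] (h : ∀ x : X, ∃ e : OpenPartialHomeomorph X E,
    x ∈ e.source ∧ IsQuotientChart N p e) : LCManifold.{u} where
  carrier := X
  model := E
  charted :=
    { atlas := {e | IsQuotientChart N p e}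
      chartAt := fun x => (h x).choose
      mem_chart_source := fun x => (h x).choose_spec.1
      chart_mem_atlas := fun x => (h x).choose_spec.2 }
  compatible := by
    intro e he e' he'
    refine isCInf_of_smoothNear (e.isOpen_inter_preimage_symm e'.open_source) fun x hx => ?_
    obtain ⟨s, hs, hps⟩ := he.lift x hx.1
    have h1 : p (s x) ∈ e'.source := by
      rw [hps.self_of_nhds]
      exact hx.2
    -- The transition map is `e' ∘ p` after a local lift of `e.symm`, both smooth.
    exact ((he'.smooth_comp _ h1).comp hs).congr (hps.mono fun z hz => by simp only [hz])

variable {N p} [T2Space X]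
  {h : ∀ x : X, ∃ e : OpenPartialHomeomorph X E, x ∈ e.source ∧ IsQuotientChart N p e}

theorem smoothNear_quotient_proj (hp : Continuous p) (n : N) :
    SmoothNear N (quotientManifold N p h) p n := by
  obtain ⟨e, hn, he⟩ := h (p n)
  have h1 : SmoothNear (ofSpace E) (quotientManifold N p h) e.symm (e (p n)) :=
    smoothNear_chart_symm (M := quotientManifold N p h) (e := e) he (e.map_source hn)
  refine (SmoothNear.comp h1 (he.smooth_comp n hn)).congr ?_
  filter_upwards [hp.continuousAt.eventually (e.open_source.mem_nhds hn)] with z hz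
  exact e.left_inv hz

theorem exists_section_quotientManifold (x : quotientManifold N p h) :
    ∃ s : X → N, SmoothNear (quotientManifold N p h) N s x ∧ ∀ᶠ x' in 𝓝 x, p (s x') = x' := by
  obtain ⟨e, hx, he⟩ := h x
  obtain ⟨s, hs, hps⟩ := he.lift (e x) (e.map_source hx)
  have h1 : SmoothNear (quotientManifold N p h) (ofSpace E) e x :=
    smoothNear_chart (M := quotientManifold N p h) (e := e) he hx
  refine ⟨fun x' => s (e x'), SmoothNear.comp hs h1, ?_⟩
  have h2 : ∀ᶠ x' in 𝓝 x, p (s (e x')) = e.symm (e x') := (e.continuousAt hx).eventually hps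
  filter_upwards [h2, e.open_source.mem_nhds hx] with x' hx' hx''
  rw [hx', e.left_inv hx'']

end QuotientManifold

/-! ### The quotient of an equivariant circle bundle -/

section QuotientBundle

variable {G Y Ybar : LCManifold.{u}} [Group G] [MulAction G Y] {qY : Y → Ybar}
  {R : TBundle Y univ} [MulAction G R.total]

variable (G qY R) in
/-- A `G`-invariant `𝕋`-equivariant coordinate `T` over the open set `W` of the orbit space, with the
section `s` on which it is `1`. -/
structure OrbitTrivialization where
  W : Set Ybar
  s : Ybar → R.total
  T : R.total → Circle
  isOpen : IsOpen W
  smooth_s : ∀ x ∈ W, SmoothNear Ybar R.total s x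
  smooth_T : ∀ r, qY (R.proj r) ∈ W → CircleSmoothNear R.total T r
  proj_s : ∀ x ∈ W, qY (R.proj (s x)) = x
  T_s : ∀ x ∈ W, T (s x) = 1
  T_smul : ∀ r, qY (R.proj r) ∈ W → ∀ z : Circle, T (z • r) = z * T r
  T_act : ∀ r, qY (R.proj r) ∈ W → ∀ g : G, T (g • r) = T r
  orbit : ∀ r, qY (R.proj r) ∈ W → ∃ g : G, g • r = T r • s (qY (R.proj r))

/-- The element `(c y)⁻¹` moves the fibre over `y` to the fibre over the section `σ`, where `τ` is
read off. The result is invariant because `c (g • y) = g * c y`, and normalised on `σ' ∘ σ` because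
`c ∘ σ = 1`. -/
theorem exists_orbitTrivialization (hG : IsLieGroup G) (hY : IsPrincipalQuotient G Y Ybar qY)
    (hR : IsEquivariantTBundle G R (fun g y => g • y)) (x : Ybar) :
    ∃ D : OrbitTrivialization G qY R, x ∈ D.W := by
  obtain ⟨W, hW, hxW, σ, c, hσ, hc, hσq, hm⟩ := hY.locally_trivial x
  obtain ⟨V, hV, hxV, σ', τ, hσ', hτ, hσ'p, hp⟩ := R.locally_trivial (σ x) (mem_univ _)
  have hWo : IsOpen (W ∩ σ ⁻¹' V) := hσ.1.isOpen_inter_preimage hW hV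
  have hWY : IsOpen (qY ⁻¹' W) := hW.preimage hY.continuous
  have hVR : IsOpen (R.proj ⁻¹' V) := hV.preimage (continuousOn_univ.1 R.smooth_proj.1)
  have hcg : ∀ y, qY y ∈ W → ∀ g : G, c (g • y) = g * c y := by
    intro y hy g
    refine hY.eq_of_smul_eq (m := σ (qY y)) ?_
    have h1 := hm (g • y) (by rwa [mem_preimage, hY.map_smul])
    rw [hY.map_smul] at h1
    rw [mul_smul, ← hm y hy, ← h1]
  have hcσ : ∀ y ∈ W, c (σ y) = 1 := by
    intro y hy
    have h1 := hm (σ y) (by rwa [mem_preimage, hσq y hy])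
    rw [hσq y hy] at h1
    exact hY.free _ _ h1.symm
  have hτz : ∀ r, R.proj r ∈ V → ∀ z : Circle, τ (z • r) = z * τ r := by
    intro r hr z
    refine R.eq_of_smul_eq (p := σ' (R.proj r)) ?_
    have h1 := hp (z • r) (by rwa [mem_preimage, R.proj_smul])
    rw [R.proj_smul] at h1
    rw [mul_smul, ← hp r hr, ← h1]
  have hproj : ∀ r, qY (R.proj r) ∈ W → R.proj ((c (R.proj r))⁻¹ • r) = σ (qY (R.proj r)) := by
    intro r hr
    rw [hR.proj_smul, inv_smul_eq_iff]
    exact hm _ hr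
  refine ⟨⟨W ∩ σ ⁻¹' V, fun x => σ' (σ x), fun r => τ ((c (R.proj r))⁻¹ • r), hWo,
    ?_, ?_, ?_, ?_, ?_, ?_, ?_⟩, hxW, hxV⟩
  · intro x hx
    exact (hσ'.smoothNear hV hx.2).comp (hσ.smoothNear hW hx.1)
  · intro r hr
    have h1 : CircleSmoothNear R.total τ ((c (R.proj r))⁻¹ • r) := hτ.smoothNear hVR (by
      rw [mem_preimage, hproj r hr.1]
      exact hr.2)
    have h2 : SmoothNear R.total G (fun r => c (R.proj r)) r :=
      (hc.smoothNear hWY hr.1).comp (R.smoothNear_proj r)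
    exact h1.comp (f := fun r => (c (R.proj r))⁻¹ • r)
      (hR.smooth.smoothNear_smul (hG.smoothNear_inv h2) (smoothNear_id r))
  · intro x hx
    rw [hσ'p _ ⟨hx.2, mem_univ _⟩, hσq x hx.1]
  · intro x hx
    have h1 : R.proj (σ' (σ x)) = σ x := hσ'p _ ⟨hx.2, mem_univ _⟩
    have h2 := hp (σ' (σ x)) (by rw [mem_preimage, h1]; exact hx.2)
    rw [h1] at h2
    change τ ((c (R.proj (σ' (σ x))))⁻¹ • σ' (σ x)) = 1
    rw [h1, hcσ x hx.1, inv_one, one_smul]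
    exact R.free _ _ h2.symm
  · intro r hr z
    simp only [R.proj_smul]
    rw [hR.comm, hτz]
    rw [hproj r hr.1]
    exact hr.2
  · intro r hr g
    have : c (g • R.proj r) = g * c (R.proj r) := hcg _ hr.1 g
    simp only [hR.proj_smul, this, mul_inv_rev, mul_smul, inv_smul_smul]
  · intro r hr
    refine ⟨(c (R.proj r))⁻¹, ?_⟩
    have h1 := hp ((c (R.proj r))⁻¹ • r) (by rw [mem_preimage, hproj r hr.1]; exact hr.2)
    rw [hproj r hr.1] at h1
    exact h1

variable (G R) in
/-- The orbit space of the total space. -/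
abbrev OrbitSpace : Type u := MulAction.orbitRel.Quotient G R.total

variable (G R) in
/-- The projection to the orbit space. -/
def orbitMk (r : R.total) : OrbitSpace G R := Quotient.mk (MulAction.orbitRel G R.total) r

theorem orbitMk_eq_iff {r r' : R.total} :
    orbitMk G R r = orbitMk G R r' ↔ ∃ g : G, g • r = r' := by
  rw [eq_comm]
  unfold orbitMk
  rw [Quotient.eq, MulAction.orbitRel_apply]
  rfl

theorem orbitMk_surjective : Function.Surjective (orbitMk G R) := Quotient.mk_surjective

/-- Group elements act by homeomorphisms, so saturations of open sets are open. -/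
theorem isOpenQuotientMap_orbitMk (hR : IsEquivariantTBundle G R (fun g y => g • y)) :
    IsOpenQuotientMap (orbitMk G R) := by
  have : ContinuousConstSMul G R.total := ⟨fun g => continuous_iff_continuousAt.2 fun r =>
    (hR.smooth.smoothNear_const_smul g r).continuousAt⟩
  exact MulAction.isOpenQuotientMap_quotientMk

/-- The action of `𝕋` on the orbit space. -/
@[reducible] def orbitSpaceAction (hR : IsEquivariantTBundle G R (fun g y => g • y)) :
    MulAction Circle (OrbitSpace G R) where
  smul z := Quotient.map' (fun r => z • r) (by
    rintro r r' ⟨g, hg⟩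
    refine ⟨g, ?_⟩
    simp only at hg ⊢
    rw [hR.comm, hg])
  one_smul := by
    intro x
    obtain ⟨r, rfl⟩ := orbitMk_surjective x
    exact congrArg (orbitMk G R) (one_smul Circle r)
  mul_smul := by
    intro z z' x
    obtain ⟨r, rfl⟩ := orbitMk_surjective x
    exact congrArg (orbitMk G R) (mul_smul z z' r)

/-- The projection of the orbit space to the orbit space of the base. -/
def orbitProj (hY : IsPrincipalQuotient G Y Ybar qY)
    (hR : IsEquivariantTBundle G R (fun g y => g • y)) : OrbitSpace G R → Ybar :=
  Quotient.lift (fun r => qY (R.proj r)) (by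
    rintro r r' ⟨g, hg⟩
    simp only at hg ⊢
    rw [← hg, hR.proj_smul, hY.map_smul])

/-! ### Topology and charts of the orbit space -/

section Charts

variable (hY : IsPrincipalQuotient G Y Ybar qY)
  (hR : IsEquivariantTBundle G R (fun g y => g • y)) (D : OrbitTrivialization G qY R)

include hY in
theorem continuous_base_proj : Continuous fun r : R.total => qY (R.proj r) :=
  hY.continuous.comp (continuousOn_univ.1 R.smooth_proj.1)

theorem continuous_orbitProj : Continuous (orbitProj hY hR) :=
  (isOpenQuotientMap_orbitMk hR).isQuotientMap.continuous_iff.2 (continuous_base_proj hY)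

/-- The invariant coordinate as a function on the orbit space. -/
def OrbitTrivialization.coord (x : OrbitSpace G R) : Circle := D.T x.out

/-- The representative picked by `Quotient.out` is irrelevant over `D.W`, where `T` is invariant;
elsewhere the coordinate carries no meaning. -/
theorem OrbitTrivialization.coord_mk {r : R.total} (hr : qY (R.proj r) ∈ D.W) :
    D.coord (orbitMk G R r) = D.T r := by
  have h1 : orbitMk G R r = orbitMk G R (orbitMk G R r).out := (Quotient.out_eq _).symm
  obtain ⟨g, hg⟩ := orbitMk_eq_iff.1 h1
  unfold OrbitTrivialization.coord
  rw [← hg, D.T_act r hr]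

theorem OrbitTrivialization.mk_eq {r : R.total} (hr : qY (R.proj r) ∈ D.W) :
    orbitMk G R r = orbitMk G R (D.T r • D.s (qY (R.proj r))) :=
  orbitMk_eq_iff.2 (D.orbit r hr)

include hY hR in
theorem OrbitTrivialization.continuousAt_coord {r : R.total} (hr : qY (R.proj r) ∈ D.W) :
    ContinuousAt D.coord (orbitMk G R r) := by
  rw [← (isOpenQuotientMap_orbitMk hR).continuousAt_comp_iff]
  refine (D.smooth_T r hr).continuousAt.congr ?_
  filter_upwards [(D.isOpen.preimage (continuous_base_proj hY)).mem_nhds hr] with r' hr'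
  exact (D.coord_mk hr').symm

theorem OrbitTrivialization.coord_smul_s {x : Ybar} (hx : x ∈ D.W) (z : Circle) :
    D.T (z • D.s x) = z := by
  rw [D.T_smul _ (by rwa [D.proj_s x hx]), D.T_s x hx, mul_one]

theorem OrbitTrivialization.base_smul_s {x : Ybar} (hx : x ∈ D.W) (z : Circle) :
    qY (R.proj (z • D.s x)) = x := by
  rw [R.proj_smul, D.proj_s x hx]

include hY hR in
-- Orbits over different base points are separated in `Ybar`. Orbits over the same point are
-- separated by the invariant coordinate, since that coordinate and the base point determine the
-- orbit.
theorem t2Space_orbitSpace (hG : IsLieGroup G) : T2Space (OrbitSpace G R) := by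
  rw [t2Space_iff_disjoint_nhds]
  intro x x' hxx'
  by_cases hb : orbitProj hY hR x = orbitProj hY hR x'
  · obtain ⟨r, rfl⟩ := orbitMk_surjective x
    obtain ⟨r', rfl⟩ := orbitMk_surjective x'
    have hb' : qY (R.proj r) = qY (R.proj r') := hb
    obtain ⟨D, hD⟩ := exists_orbitTrivialization hG hY hR (qY (R.proj r))
    have hD' : qY (R.proj r') ∈ D.W := hb' ▸ hD
    have h1 := D.continuousAt_coord hY hR hD
    have h2 := D.continuousAt_coord hY hR hD'
    refine h1.tendsto.disjoint (disjoint_nhds_nhds.2 fun h => hxx' ?_) h2.tendsto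
    rw [D.coord_mk hD, D.coord_mk hD'] at h
    rw [D.mk_eq hD, D.mk_eq hD', h, hb']
  · exact (continuous_orbitProj hY hR).continuousAt.tendsto.disjoint (disjoint_nhds_nhds.2 hb)
      (continuous_orbitProj hY hR).continuousAt.tendsto

theorem OrbitTrivialization.smoothNear_section (z₀ : Circle)
    {e : OpenPartialHomeomorph Ybar.carrier Ybar.model} (he : e ∈ atlas Ybar.model Ybar.carrier)
    {a : Ybar.model} (ha : a ∈ e.target) (ha' : e.symm a ∈ D.W) (θ : ℝ) :
    SmoothNear (ofSpace (Ybar.model × ℝ)) R.total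
      (fun x : Ybar.model × ℝ => (z₀ * Circle.exp x.2) • D.s (e.symm x.1)) (a, θ) := by
  have h1 : SmoothNear (ofSpace (Ybar.model × ℝ)) (ofSpace Ybar.model) (fun x => x.1) (a, θ) :=
    smoothNear_clm (ContinuousLinearMap.fst ℝ Ybar.model ℝ) (a, θ)
  have h2 : SmoothNear (ofSpace (Ybar.model × ℝ)) (ofSpace ℝ) (fun x => x.2) (a, θ) :=
    smoothNear_clm (ContinuousLinearMap.snd ℝ Ybar.model ℝ) (a, θ)
  refine R.smoothNear_smul (M := ofSpace (Ybar.model × ℝ))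
    ((circleSmoothNear_const z₀ _).mul h2.circleExp) ?_
  have h3 : SmoothNear (ofSpace (Ybar.model × ℝ)) Ybar (fun x => e.symm x.1) (a, θ) :=
    (smoothNear_chart_symm he ha).comp h1
  exact (D.smooth_s _ ha').comp h3

/-- A chart of the orbit space: a chart of the base together with the angle of the invariant
coordinate, relative to `z₀`. -/
def OrbitTrivialization.chart (z₀ : Circle) {e : OpenPartialHomeomorph Ybar.carrier Ybar.model}
    (he : e ∈ atlas Ybar.model Ybar.carrier) :
    OpenPartialHomeomorph (OrbitSpace G R) (Ybar.model × ℝ) where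
  toFun x := (e (orbitProj hY hR x), Complex.arg (z₀⁻¹ * D.coord x : Circle))
  invFun a := orbitMk G R ((z₀ * Circle.exp a.2) • D.s (e.symm a.1))
  -- The slit plane excludes the angle `π`, to match the open interval in the target. Writing the
  -- source as an image makes its openness a case of openness of the quotient map.
  source := orbitMk G R '' {r | qY (R.proj r) ∈ D.W ∩ e.source ∧
    ((z₀⁻¹ * D.T r : Circle) : ℂ) ∈ Complex.slitPlane}
  target := (e.target ∩ e.symm ⁻¹' D.W) ×ˢ Ioo (-Real.pi) Real.pi
  map_source' := by
    rintro _ ⟨r, ⟨hr, hr'⟩, rfl⟩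
    rw [D.coord_mk hr.1]
    have h1 : orbitProj hY hR (orbitMk G R r) = qY (R.proj r) := rfl
    refine ⟨⟨e.map_source hr.2, ?_⟩, ?_⟩
    · change e.symm (e (qY (R.proj r))) ∈ D.W
      rw [e.left_inv hr.2]
      exact hr.1
    · rw [Complex.mem_slitPlane_iff_arg] at hr'
      exact ⟨Complex.neg_pi_lt_arg _, lt_of_le_of_ne (Complex.arg_le_pi _) hr'.1⟩
  map_target' := by
    rintro ⟨a, θ⟩ ⟨⟨ha, ha'⟩, hθ⟩
    refine ⟨_, ⟨?_, ?_⟩, rfl⟩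
    · rw [D.base_smul_s ha']
      exact ⟨ha', e.map_target ha⟩
    · simp only [D.coord_smul_s ha', inv_mul_cancel_left]
      rw [Complex.mem_slitPlane_iff_arg, Circle.arg_exp hθ.1 hθ.2.le]
      exact ⟨hθ.2.ne, Circle.coe_ne_zero _⟩
  left_inv' := by
    rintro _ ⟨r, ⟨hr, hr'⟩, rfl⟩
    have h1 : orbitProj hY hR (orbitMk G R r) = qY (R.proj r) := rfl
    rw [D.coord_mk hr.1, h1, Circle.exp_arg, mul_inv_cancel_left, e.left_inv hr.2, ← D.mk_eq hr.1]
  right_inv' := by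
    rintro ⟨a, θ⟩ ⟨⟨ha, ha'⟩, hθ⟩
    have h1 := D.base_smul_s ha' (z₀ * Circle.exp θ)
    have h2 : orbitProj hY hR (orbitMk G R ((z₀ * Circle.exp θ) • D.s (e.symm a))) = e.symm a := h1
    simp only [h2]
    rw [D.coord_mk (by rw [h1]; exact ha'), D.coord_smul_s ha', inv_mul_cancel_left,
      Circle.arg_exp hθ.1 hθ.2.le, e.right_inv ha]
  open_source := by
    refine (isOpenQuotientMap_orbitMk hR).isOpenMap _ ?_
    have h0 : IsOpen {r : R.total | qY (R.proj r) ∈ D.W ∩ e.source} :=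
      (D.isOpen.inter e.open_source).preimage (continuous_base_proj hY)
    have h1 : ContinuousOn (fun r => ((z₀⁻¹ * D.T r : Circle) : ℂ))
        {r : R.total | qY (R.proj r) ∈ D.W ∩ e.source} := fun r hr =>
      (SmoothNear.continuousAt ((circleSmoothNear_const z₀⁻¹ r).mul
        (D.smooth_T r hr.1))).continuousWithinAt
    exact h1.isOpen_inter_preimage h0 Complex.isOpen_slitPlane
  open_target := (e.isOpen_inter_preimage_symm D.isOpen).prod isOpen_Ioo
  continuousOn_toFun := by
    rintro _ ⟨r, ⟨hr, hr'⟩, rfl⟩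
    refine ContinuousAt.continuousWithinAt (ContinuousAt.prodMk ?_ ?_)
    · exact ContinuousAt.comp (e.continuousAt hr.2) (continuous_orbitProj hY hR).continuousAt
    · have h1 := D.continuousAt_coord hY hR hr.1
      rw [← D.coord_mk hr.1] at hr'
      refine ContinuousAt.comp (f := fun x => ((z₀⁻¹ * D.coord x : Circle) : ℂ))
        (Complex.continuousAt_arg hr') ?_
      exact continuous_subtype_val.continuousAt.comp (continuousAt_const.mul h1)
  continuousOn_invFun := by
    rintro ⟨a, θ⟩ ⟨⟨ha, ha'⟩, hθ⟩
    exact ((isOpenQuotientMap_orbitMk hR).continuous.continuousAt.comp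
      (D.smoothNear_section z₀ he ha ha' θ).continuousAt).continuousWithinAt

theorem OrbitTrivialization.isQuotientChart (z₀ : Circle)
    {e : OpenPartialHomeomorph Ybar.carrier Ybar.model} (he : e ∈ atlas Ybar.model Ybar.carrier) :
    IsQuotientChart R.total (orbitMk G R) (D.chart hY hR z₀ he) where
  smooth_comp := by
    rintro r ⟨r', ⟨hr, hr'⟩, hrr'⟩
    -- The source conditions are known for `r'` only; by invariance they pass to every point of its
    -- orbit.
    obtain ⟨g, rfl⟩ := orbitMk_eq_iff.1 hrr'
    have hrg : qY (R.proj (g • r')) = qY (R.proj r') := by rw [hR.proj_smul, hY.map_smul]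
    rw [← D.T_act r' hr.1 g] at hr'
    rw [← hrg] at hr
    generalize g • r' = r at hr hr'
    have h1 : SmoothNear R.total Ybar (fun r => qY (R.proj r)) r :=
      (hY.smooth.smoothNear _).comp (R.smoothNear_proj r)
    have h2 := CircleSmoothNear.arg ((circleSmoothNear_const z₀⁻¹ r).mul (D.smooth_T r hr.1)) hr'
    refine (SmoothNear.prodMk_space (SmoothNear.comp (f := fun r => qY (R.proj r))
      (smoothNear_chart he hr.2) h1) h2).congr ?_
    filter_upwards [(D.isOpen.preimage (continuous_base_proj hY)).mem_nhds hr.1] with r'' hr''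
    change _ = (e (qY (R.proj r'')), Complex.arg (z₀⁻¹ * D.coord (orbitMk G R r'') : Circle))
    rw [D.coord_mk hr'']
  lift := by
    rintro ⟨a, θ⟩ ⟨⟨ha, ha'⟩, -⟩
    exact ⟨_, D.smoothNear_section z₀ he ha ha' θ, Eventually.of_forall fun _ => rfl⟩

include hY hR in
theorem exists_isQuotientChart (hG : IsLieGroup G) (x : OrbitSpace G R) :
    ∃ e : OpenPartialHomeomorph (OrbitSpace G R) (Ybar.model × ℝ),
      x ∈ e.source ∧ IsQuotientChart R.total (orbitMk G R) e := by
  obtain ⟨r, rfl⟩ := orbitMk_surjective x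
  obtain ⟨D, hD⟩ := exists_orbitTrivialization hG hY hR (qY (R.proj r))
  -- With `z₀ = D.T r` the relative coordinate of `r` is `1`, safely off the cut.
  refine ⟨D.chart hY hR (D.T r) (chart_mem_atlas Ybar.model (qY (R.proj r))),
    ⟨r, ⟨⟨hD, mem_chart_source _ _⟩, ?_⟩, rfl⟩, D.isQuotientChart hY hR _ _⟩
  simp

end Charts

/-- A `G`-equivariant `𝕋`-bundle has a quotient over the orbit space of the base. -/
theorem exists_tBundleQuotient (hG : IsLieGroup G) (hY : IsPrincipalQuotient G Y Ybar qY)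
    (hR : IsEquivariantTBundle G R (fun g y => g • y)) :
    ∃ (Rbar : TBundle Ybar univ) (qR : R.total → Rbar.total),
      IsTBundleQuotient G R Rbar qY qR ∧ IsPrincipalQuotient G R.total Rbar.total qR := by
  have ht2 : T2Space (OrbitSpace G R) := t2Space_orbitSpace hY hR hG
  let Q : LCManifold.{u} := quotientManifold R.total (orbitMk G R) (E := Ybar.model × ℝ)
    (exists_isQuotientChart hY hR hG)
  let qR : R.total → Q := orbitMk G R
  have hqR : ∀ r, SmoothNear R.total Q qR r :=
    smoothNear_quotient_proj (isOpenQuotientMap_orbitMk hR).continuous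
  have hsec : ∀ x : Q, ∃ s : Q → R.total, SmoothNear Q R.total s x ∧
      ∀ᶠ x' in 𝓝 x, qR (s x') = x' := exists_section_quotientManifold
  let act : MulAction Circle Q := orbitSpaceAction hR
  have hact : ∀ (z : Circle) (r : R.total), qR (z • r) = z • qR r := fun _ _ => rfl
  let pr : Q → Ybar := orbitProj hY hR
  have hpr : ∀ r, pr (qR r) = qY (R.proj r) := fun _ => rfl
  have hprs : ∀ x, SmoothNear Q Ybar pr x := fun x => by
    obtain ⟨s, hs, hqs⟩ := hsec x
    have h1 : SmoothNear R.total Ybar (fun r => qY (R.proj r)) (s x) :=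
      (hY.smooth.smoothNear _).comp (R.smoothNear_proj _)
    refine (h1.comp hs).congr (hqs.mono fun z hz => ?_)
    exact congrArg pr hz
  have hsurj : Function.Surjective qR := orbitMk_surjective
  have horb : ∀ r r', qR r = qR r' ↔ ∃ g : G, g • r = r' := fun _ _ => orbitMk_eq_iff
  have hfree : ∀ (g : G) (r : R.total), g • r = r → g = 1 := fun g r h =>
    hY.free g (R.proj r) (by rw [← hR.proj_smul, h])
  have hprc : Continuous pr := continuous_orbitProj hY hR
  let Rbar : TBundle Ybar univ :=
    { total := Q
      act := act
      proj := pr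
      smooth_act := by
        refine smooth_of_smoothNear fun p => ?_
        obtain ⟨s, hs, hqs⟩ := hsec p.2
        have h1 : SmoothNear ((ofSpace ℝ).prod Q) R.total
            (fun p => Circle.exp p.1 • s p.2) p :=
          R.smoothNear_smul (M := (ofSpace ℝ).prod Q) (smoothNear_fst p).circleExp
            (SmoothNear.comp hs (smoothNear_snd p))
        have h2 : ∀ᶠ p' in 𝓝 p, qR (s p'.2) = p'.2 := continuousAt_snd.eventually hqs
        refine (SmoothNear.comp (hqR _) h1).congr (h2.mono fun p' hp' => ?_)
        exact congrArg (fun x : Q => Circle.exp p'.1 • x) hp'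
      smooth_proj := smooth_of_smoothNear hprs
      proj_mem := fun _ => mem_univ _
      proj_smul := by
        intro z x
        obtain ⟨r, rfl⟩ := hsurj x
        rw [← hact, hpr, hpr, R.proj_smul]
      free := by
        intro z x h
        obtain ⟨r, rfl⟩ := hsurj x
        rw [← hact, eq_comm, horb] at h
        obtain ⟨g, hg⟩ := h
        -- A circle element moves `r` within its fibre, so a group element with the same effect
        -- fixes the base point and is trivial.
        have h1 : g = 1 := hY.free g (R.proj r) (by rw [← hR.proj_smul, hg, R.proj_smul])
        rw [h1, one_smul] at hg
        exact R.free z r hg.symm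
      locally_trivial := by
        intro x _
        obtain ⟨D, hD⟩ := exists_orbitTrivialization hG hY hR x
        refine ⟨D.W, D.isOpen, hD, fun x' => qR (D.s x'), D.coord, ?_, ?_, ?_, ?_⟩
        · exact smoothOn_of_smoothNear D.isOpen fun x' hx' => (hqR _).comp (D.smooth_s x' hx')
        · refine smoothOn_of_smoothNear (D.isOpen.preimage hprc) fun x' hx' => ?_
          obtain ⟨s, hs, hqs⟩ := hsec x'
          have h1 : qY (R.proj (s x')) ∈ D.W := by
            rw [← hpr, hqs.self_of_nhds]
            exact hx'
          have h2 : CircleSmoothNear Q (fun z => D.T (s z)) x' := (D.smooth_T _ h1).comp hs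
          refine h2.congr ?_
          filter_upwards [hqs, (D.isOpen.preimage hprc).mem_nhds hx'] with z hz hz'
          rw [← D.coord_mk (by rw [← hpr, hz]; exact hz')]
          exact congrArg D.coord hz
        · intro x' hx'
          rw [hpr, D.proj_s x' hx'.1]
        · intro x' hx'
          obtain ⟨r, rfl⟩ := hsurj x'
          have h1 := D.coord_mk (r := r) hx'
          rw [hpr, ← hact]
          change _ = qR (D.coord (orbitMk G R r) • D.s (qY (R.proj r)))
          rw [h1]
          exact D.mk_eq hx' }
  refine ⟨Rbar, qR, ⟨smooth_of_smoothNear hqR, hsurj, hpr, hact, horb⟩,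
    ⟨smooth_of_smoothNear hqR, hsurj, horb, hfree, fun x => ?_⟩⟩
  obtain ⟨s, hs, hqs⟩ := hsec x
  obtain ⟨W, hWs, hW, hxW⟩ := mem_nhds_iff.1 (hs.eventually.and hqs)
  -- Outside `W` the transporter is set to `1`; only its values over `W` are used.
  have hex : ∀ r : R.total, ∃ g : G, qR r ∈ W → r = g • s (qR r) := by
    intro r
    by_cases hr : qR r ∈ W
    · obtain ⟨g, hg⟩ := (horb (s (qR r)) r).1 (hWs hr).2
      exact ⟨g, fun _ => hg.symm⟩
    · exact ⟨1, fun h => absurd h hr⟩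
  choose c hc using hex
  have hWo : IsOpen (qR ⁻¹' W) := hW.preimage (isOpenQuotientMap_orbitMk hR).continuous
  refine ⟨W, hW, hxW, s, c, smoothOn_of_smoothNear hW fun x' hx' => (hWs hx').1,
    smoothOn_of_smoothNear hWo fun r hr => ?_, fun x' hx' => (hWs hx').2, fun r hr => hc r hr⟩
  have h1 : SmoothNear R.total Y (fun r => R.proj (s (qR r))) r :=
    (R.smoothNear_proj _).comp ((hWs hr).1.comp (hqR r))
  -- The same element carries the base points into one another, and on `Y` transporters are already
  -- known to be smooth.
  refine hY.smoothNear_transporter hG h1 (R.smoothNear_proj r) ?_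
  filter_upwards [hWo.mem_nhds hr] with r' hr'
  rw [← hR.proj_smul, ← hc r' hr']

end QuotientBundle

/-! ### Descent of basic 1-forms -/

section Descent

variable {G N B : LCManifold.{u}} [Group G] [MulAction G N] {q : N → B}

/-- Differentiate `f (g • n) = g • f n` in `g` at the identity. -/
theorem tmap_infAct {N' : LCManifold.{u}} [MulAction G N'] (hN : IsSmoothAction G N)
    {f : N → N'} {n : N} (hf : SmoothNear N N' f n) (hfg : ∀ (g : G) m, f (g • m) = g • f m)
    (X : G.model) : tmap f n (infAct X n) = infAct X (f n) := by
  have hf' : SmoothNear N N' f ((1 : G) • n) := by rwa [one_smul]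
  have h1 := tmap_comp (M := G) (f := fun g : G => g • n) (g := f) hf'
    (hN.smoothNear_smul_const 1 n) X
  simp only [hfg, one_smul] at h1
  exact h1.symm

/-- The derivative of the orbit map at any point is a generating vector. -/
theorem tmap_smul_const (hG : IsLieGroup G) (hN : IsSmoothAction G N) (g : G) (n : N)
    (X : G.model) : ∃ X' : G.model,
      tmap (M := G) (N := N) (fun g' => g' • n) g X = infAct X' (g • n) := by
  -- Right translation by `g⁻¹` brings the tangent vector at `g` to the identity, since `g' • n =
  -- (g' * g⁻¹) • (g • n)`.
  refine ⟨tmap (M := G) (N := G) (fun g' => g' * g⁻¹) g X, ?_⟩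
  have h1 : SmoothNear G N (fun g' : G => g' • (g • n)) (g * g⁻¹) :=
    hN.smoothNear_smul_const _ _
  have h2 := tmap_comp (M := G) (f := fun g' : G => g' * g⁻¹) (g := fun g' : G => g' • (g • n)) h1
    (hG.smoothNear_mul (smoothNear_id _) (smoothNear_const _ _)) X
  simp only [smul_smul, inv_mul_cancel_right, mul_inv_cancel] at h2
  rw [h2]
  unfold infAct
  simp only [smul_smul]

theorem Ad_inv_Ad (hG : IsLieGroup G) (g : G) (X : G.model) : Ad g⁻¹ (Ad g X) = X := by
  have h0 : ∀ k l : G, SmoothNear G G (fun h : G => k * h * k⁻¹) l := fun k l =>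
    hG.smoothNear_mul (hG.smoothNear_mul (smoothNear_const _ _) (smoothNear_id _))
      (smoothNear_const _ _)
  have h1 := tmap_comp (M := G) (f := fun h : G => g * h * g⁻¹)
    (g := fun h : G => g⁻¹ * h * g⁻¹⁻¹) (h0 _ _) (h0 g 1) X
  have h2 : (fun z : G => g⁻¹ * (g * z * g⁻¹) * g⁻¹⁻¹) = fun z => z := by
    funext z
    group
  rw [h2, tmap_id] at h1
  unfold Ad
  have h3 : g * 1 * g⁻¹ = 1 := by group
  rw [h3] at h1
  exact h1.symm

/-- An invariant horizontal 1-form is the pull-back of a 1-form on the quotient. -/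
theorem IsPrincipalQuotient.exists_descent (hG : IsLieGroup G) (hN : IsSmoothAction G N)
    (hq : IsPrincipalQuotient G N B q) {β : N → N.model → ℝ} (hlin : ∀ n, IsLinearMap ℝ (β n))
    (hsm : ∀ (s : B.model → N) (a k : B.model), SmoothNear (ofSpace B.model) N s a →
      SmoothNear (ofSpace (B.model × B.model)) (ofSpace ℝ)
        (fun p : B.model × B.model => β (s p.1) (tmap (M := ofSpace B.model) (N := N) s p.1 p.2))
        (a, k))
    (hinv : InvariantOneForm G N β) (hhor : ∀ (n : N) (X : G.model), β n (infAct X n) = 0) :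
    ∃ βbar : B → B.model → ℝ, IsOneForm B βbar ∧
      ∀ (n : N) (h : N.model), βbar (q n) (tmap q n h) = β n h := by
  have hsec : ∀ b : B, ∃ s : B → N, SmoothNear B N s b ∧ ∀ᶠ b' in 𝓝 b, q (s b') = b' := by
    intro b
    obtain ⟨n, rfl⟩ := hq.surjective b
    obtain ⟨s, hs, -, hqs⟩ := hq.exists_section hN n
    exact ⟨s, hs, hqs⟩
  choose s hs hqs using hsec
  have hqn : ∀ n, SmoothNear N B q n := hq.smooth.smoothNear
  -- Near `n`, the identity is `n' = g n' • s (q n')`. Its derivative is a generating vector, killed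
  -- by horizontality, plus the translate by `g n` of the derivative of `s ∘ q`, and that
  -- translation is undone by invariance.
  have hpull : ∀ (n : N) (h : N.model),
      β (s (q n) (q n)) (tmap (s (q n)) (q n) (tmap q n h)) = β n h := by
    intro n h
    have h1 : SmoothNear N N (fun n' => s (q n) (q n')) n :=
      SmoothNear.comp (hs (q n)) (hqn n)
    obtain ⟨g, hg, hgs⟩ := hq.exists_smooth_transporter hG h1 (smoothNear_id n)
      ((hqn n).continuousAt.eventually (hqs (q n)))
    have h2 := tmap_congr hgs h
    have hn : n = g n • s (q n) (q n) := hgs.self_of_nhds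
    rw [tmap_id, tmap_partial (F := fun p : G.prod N => p.1 • p.2)
      (Smooth.smoothNear (M := G.prod N) hN _) hg h1] at h2
    obtain ⟨X, hX⟩ := tmap_smul_const hG hN (g n) (s (q n) (q n)) (tmap g n h)
    dsimp only at h2
    rw [hX, ← hn] at h2
    conv_rhs => rw [h2, (hlin n).map_add, hhor, zero_add]
    rw [← tmap_comp (hs (q n)) (hqn n)]
    have h3 := hinv (g n) (s (q n) (q n))
      (tmap (M := N) (N := N) (fun z => s (q n) (q z)) n h)
    rw [← hn] at h3
    exact h3.symm
  refine ⟨fun b k => β (s b b) (tmap (s b) b k), ⟨fun b => ?_, fun e he => ?_⟩, hpull⟩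
  · have h1 := (hs b).isLinearMap_tmap
    exact ⟨fun k l => by rw [h1.map_add, (hlin _).map_add],
      fun c k => by rw [h1.map_smul, (hlin _).map_smul]⟩
  · refine isCInf_of_smoothNear (e.open_target.prod isOpen_univ) ?_
    rintro ⟨a, k⟩ ⟨ha, -⟩
    have ha : a ∈ e.target := ha
    have he' := smoothNear_chart_symm he ha
    -- The sections `s b` are chosen independently, so nothing is smooth in the index `b`. Near `a`
    -- a single section is fixed, and `hpull` shows that pulling back by it gives the same form.
    have hS : SmoothNear (ofSpace B.model) N (fun x => s (e.symm a) (e.symm x)) a :=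
      SmoothNear.comp (hs (e.symm a)) he'
    have hqS : ∀ᶠ x in 𝓝 a, q (s (e.symm a) (e.symm x)) = e.symm x :=
      (SmoothNear.continuousAt he').eventually (hqs (e.symm a))
    refine (hsm _ a k hS).congr ?_
    have h1 : ∀ᶠ p : B.model × B.model in 𝓝 (a, k), _ :=
      continuousAt_fst.eventually (hS.eventually.and hqS.eventually_nhds)
    filter_upwards [h1] with p hp
    obtain ⟨hp1, hp2⟩ := hp
    have hp3 : (fun x => q (s (e.symm a) (e.symm x))) =ᶠ[𝓝 p.1] fun x => e.symm x := hp2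
    have h2 := tmap_congr (M := ofSpace B.model) (N := B) hp3 p.2
    rw [tmap_comp (M := ofSpace B.model) (hqn _) hp1] at h2
    exact (hpull _ _).symm.trans
      (congrArg₂ (fun b k => β (s b b) (tmap (s b) b k)) hp2.self_of_nhds h2)

end Descent

/-! ### The form `κ` -/

section Kappa

variable {G M : LCManifold.{u}} [Group G] [MulAction G M] {𝒢 : BundleGerbe M} [MulAction G 𝒢.Y]
  [MulAction G 𝒢.P.total] {Ξ : M → M.model → G.model} {lam : 𝒢.Y → G.model → ℝ}

theorem BundleGerbe.smoothNear_π (𝒢 : BundleGerbe M) (y : 𝒢.Y) : SmoothNear 𝒢.Y M 𝒢.π y :=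
  𝒢.smooth_π.smoothNear y

theorem isLinearMap_kappa (hΞ : IsPrincipalConnection G M Ξ) (hlam : IsDualMap G 𝒢.Y lam)
    (y : 𝒢.Y) : IsLinearMap ℝ (kappa 𝒢 Ξ lam y) := by
  have h1 := (𝒢.smoothNear_π y).isLinearMap_tmap
  have h2 := hΞ.form.linear (𝒢.π y)
  have h3 := hlam.linear y
  exact ⟨fun h k => by simp only [kappa, h1.map_add, h2.map_add, h3.map_add],
    fun c h => by simp only [kappa, h1.map_smul, h2.map_smul, h3.map_smul]⟩

/-- `π` carries generating vectors to generating vectors, on which `Ξ` is the identity. This is what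
lets `κ` cancel a moment equal to `λ`. -/
theorem kappa_infAct (h𝒢 : IsStronglyEquivariant G 𝒢) (hΞ : IsPrincipalConnection G M Ξ)
    (y : 𝒢.Y) (X : G.model) : kappa 𝒢 Ξ lam y (infAct X y) = lam y X := by
  unfold kappa
  rw [tmap_infAct h𝒢.smooth (𝒢.smoothNear_π y) h𝒢.π_smul, hΞ.vertical]

/-- Translation by `g` contributes `Ad g` through `Ξ` and `Ad g⁻¹` through `λ`; the two cancel. -/
theorem kappa_invariant (hG : IsLieGroup G) (hM : IsSmoothAction G M)
    (h𝒢 : IsStronglyEquivariant G 𝒢) (hΞ : IsPrincipalConnection G M Ξ)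
    {f : 𝒢.Y → 𝒢.Y.model → 𝒢.Y.model → ℝ} (hobs : ObstructionVanishes G 𝒢.Y f lam) :
    InvariantOneForm G 𝒢.Y (kappa 𝒢 Ξ lam) := by
  intro g y h
  unfold kappa
  rw [sub_eq_zero.1 (hobs.ζ_eq_zero g _ y),
    ← tmap_comp (𝒢.smoothNear_π _) (h𝒢.smooth.smoothNear_const_smul g y)]
  simp only [h𝒢.π_smul]
  rw [tmap_comp (f := 𝒢.π) (g := fun m : M => g • m) (hM.smoothNear_const_smul g _)
    (𝒢.smoothNear_π y), hΞ.equivariant, Ad_inv_Ad hG]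

/-- The expression is the smooth pairing of `λ ∘ s` with the pull-back of `Ξ` along `π ∘ s`.
Smoothness along parametrised maps is the form used for descent. -/
theorem smoothNear_kappa_pullback (hΞ : IsPrincipalConnection G M Ξ) (hlam : IsDualMap G 𝒢.Y lam)
    {E : Type u} [AddCommGroup E] [Module ℝ E] [TopologicalSpace E] [IsTopologicalAddGroup E]
    [ContinuousSMul ℝ E] [LocallyConvexSpace ℝ E] [T2Space E] {s : E → 𝒢.Y} {a : E}
    (hs : SmoothNear (ofSpace E) 𝒢.Y s a) (k : E) :
    SmoothNear (ofSpace (E × E)) (ofSpace ℝ) (fun p : E × E =>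
      kappa 𝒢 Ξ lam (s p.1) (tmap (M := ofSpace E) (N := 𝒢.Y) s p.1 p.2)) (a, k) := by
  have h1 : SmoothNear (ofSpace E) M (fun x => 𝒢.π (s x)) a := (𝒢.smoothNear_π _).comp hs
  have h2 := hΞ.form.smoothNear_pullback h1 k
  have h0 : SmoothNear (ofSpace (E × E)) (ofSpace E) (fun p => p.1) (a, k) :=
    smoothNear_clm (ContinuousLinearMap.fst ℝ E E) (a, k)
  have h3 : SmoothNear (ofSpace (E × E)) 𝒢.Y (fun p => s p.1) (a, k) :=
    SmoothNear.comp (g := s) hs h0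
  have h4 := SmoothNear.comp₂ (M := 𝒢.Y) (N := ofSpace G.model) (hlam.smooth.smoothNear _) h3 h2
  refine h4.congr ?_
  have h5 : ∀ᶠ p : E × E in 𝓝 (a, k), _ := continuousAt_fst.eventually hs.eventually
  filter_upwards [h5] with p hp
  unfold kappa
  rw [tmap_comp (M := ofSpace E) (𝒢.smoothNear_π _) hp]

end Kappa

/-! ### Tensor products of fibres -/

section Tensor

variable {A B C : Type u} [MulAction Circle A] [MulAction Circle B] [MulAction Circle C]

theorem Tensor.mk_eq_mk_iff {a a' : A} {b b' : B} {c c' : C} :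
    Tensor.mk a b c = Tensor.mk a' b' c' ↔ ∃ z₁ z₂ z₃ : Circle, z₁ * z₂⁻¹ * z₃ = 1 ∧
      a' = z₁ • a ∧ b' = z₂ • b ∧ c' = z₃ • c := by
  refine (Quotient.eq (r := tensorSetoid A B C)).trans ?_
  change (∃ z₁ z₂ z₃ : Circle, z₁ * z₂⁻¹ * z₃ = 1 ∧
    (a', b', c') = (z₁ • a, z₂ • b, z₃ • c)) ↔ _
  simp only [Prod.mk.injEq]

theorem Tensor.mk_smul (z₁ z₂ z₃ : Circle) (a : A) (b : B) (c : C) :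
    Tensor.mk (z₁ • a) (z₂ • b) (z₃ • c) = Tensor.mk ((z₁ * z₂⁻¹ * z₃) • a) b c := by
  rw [Tensor.mk_eq_mk_iff]
  refine ⟨z₂⁻¹ * z₃, z₂⁻¹, z₃⁻¹, ?_, ?_, ?_, ?_⟩
  · rw [inv_inv, mul_assoc, mul_comm z₂, mul_assoc, mul_inv_cancel_left, inv_mul_cancel]
  · rw [smul_smul]
    congr 1
    rw [mul_comm _ z₁, mul_assoc]
  · rw [inv_smul_smul]
  · rw [inv_smul_smul]

theorem Tensor.exists_rep (t : Tensor A B C) : ∃ a b c, t = Tensor.mk a b c := by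
  obtain ⟨⟨a, b, c⟩, h⟩ := Quotient.exists_rep t
  exact ⟨a, b, c, h.symm⟩

theorem Tensor.smul_injective {XA XB XC : LCManifold.{u}} {SA : Set XA} {SB : Set XB}
    {SC : Set XC} {A : TBundle XA SA} {B : TBundle XB SB} {C : TBundle XC SC} {a : A.total}
    {b : B.total} {c : C.total} {z z' : Circle}
    (h : Tensor.mk (z • a) b c = Tensor.mk (z' • a) b c) : z = z' := by
  obtain ⟨z₁, z₂, z₃, h1, ha, hb, hc⟩ := Tensor.mk_eq_mk_iff.1 h
  rw [B.free _ _ hb.symm, C.free _ _ hc.symm, inv_one, mul_one, mul_one] at h1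
  rw [h1, one_smul] at ha
  exact (A.eq_of_smul_eq ha).symm

end Tensor

/-- `IsTensorSection` locates only its own local representatives. Any other representative differs
from them by circle factors, which do not move projections. -/
theorem PseudoTBundle.proj_of_eq {M : LCManifold.{u}} {𝒢 : BundleGerbe M} (𝓡 : PseudoTBundle 𝒢)
    {y₁ y₂ : 𝒢.Y} (hy : 𝒢.π y₁ = 𝒢.π y₂) {a b : 𝓡.R.total} {c : 𝒢.P.total}
    (h : 𝓡.v (y₁, y₂) = Tensor.mk a b c) :
    𝓡.R.proj a = y₁ ∧ 𝓡.R.proj b = y₂ ∧ 𝒢.P.proj c = (y₁, y₂) := by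
  obtain ⟨W, -, hx, a', b', c', -, -, -, hW⟩ := 𝓡.section_v (y₁, y₂) hy
  obtain ⟨ha, hb, hc, hv⟩ := hW _ ⟨hx, hy⟩
  rw [hv] at h
  obtain ⟨z₁, z₂, z₃, -, rfl, rfl, rfl⟩ := Tensor.mk_eq_mk_iff.1 h
  rw [𝓡.R.proj_smul, 𝓡.R.proj_smul, 𝒢.P.proj_smul]
  exact ⟨ha, hb, hc⟩

/-- The component of `v` with respect to given points of the fibres. -/
theorem PseudoTBundle.exists_component {M : LCManifold.{u}} {𝒢 : BundleGerbe M}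
    (𝓡 : PseudoTBundle 𝒢) {y₁ y₂ : 𝒢.Y} {r₁ r₂ : 𝓡.R.total} {p : 𝒢.P.total}
    (h₁ : 𝓡.R.proj r₁ = y₁) (h₂ : 𝓡.R.proj r₂ = y₂) (h₃ : 𝒢.P.proj p = (y₁, y₂)) :
    ∃ w : Circle, 𝓡.v (y₁, y₂) = Tensor.mk (w • r₁) r₂ p := by
  have hy : 𝒢.π y₁ = 𝒢.π y₂ := by
    have := 𝒢.P.proj_mem p
    rwa [h₃] at this
  obtain ⟨a, b, c, h⟩ := Tensor.exists_rep (𝓡.v (y₁, y₂))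
  obtain ⟨ha, hb, hc⟩ := 𝓡.proj_of_eq hy h
  obtain ⟨z₁, rfl⟩ := 𝓡.R.exists_smul_eq (h₁.trans ha.symm)
  obtain ⟨z₂, rfl⟩ := 𝓡.R.exists_smul_eq (h₂.trans hb.symm)
  obtain ⟨z₃, rfl⟩ := 𝒢.P.exists_smul_eq (h₃.trans hc.symm)
  exact ⟨_, h.trans (Tensor.mk_smul z₁ z₂ z₃ r₁ r₂ p)⟩

/-! ### The quotient of the section `v` -/

section QuotientSection

variable {G M Mbar : LCManifold.{u}} [Group G] [MulAction G M] {q : M → Mbar} {𝒢 : BundleGerbe M}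
  [MulAction G 𝒢.Y] [MulAction G 𝒢.P.total] {𝒢bar : BundleGerbe Mbar} {qY : 𝒢.Y → 𝒢bar.Y}
  {qP : 𝒢.P.total → 𝒢bar.P.total}

/-- A point of `(Y/G)^[2]` lifts to `Y^[2]`, smoothly in the point. -/
theorem IsGerbeQuotient.exists_smooth_lift (hG : IsLieGroup G) (hq : IsPrincipalQuotient G M Mbar q)
    (h𝒢 : IsStronglyEquivariant G 𝒢) (h𝒢bar : IsGerbeQuotient G 𝒢 𝒢bar q qY qP)
    {x : 𝒢bar.Y.prod 𝒢bar.Y} (hx : x ∈ fib2 𝒢bar.π) :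
    ∃ l : 𝒢bar.Y.prod 𝒢bar.Y → 𝒢.Y.prod 𝒢.Y,
      SmoothNear (𝒢bar.Y.prod 𝒢bar.Y) (𝒢.Y.prod 𝒢.Y) l x ∧ ∀ᶠ z in 𝓝 x,
        qY (l z).1 = z.1 ∧ qY (l z).2 = z.2 ∧ (z ∈ fib2 𝒢bar.π → l z ∈ fib2 𝒢.π) := by
  have hY := h𝒢bar.quotient_Y
  have hsec : ∀ b : 𝒢bar.Y, ∃ s : 𝒢bar.Y → 𝒢.Y, SmoothNear 𝒢bar.Y 𝒢.Y s b ∧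
      ∀ᶠ b' in 𝓝 b, qY (s b') = b' := by
    intro b
    obtain ⟨n, rfl⟩ := hY.surjective b
    obtain ⟨s, hs, -, hqs⟩ := hY.exists_section h𝒢.smooth n
    exact ⟨s, hs, hqs⟩
  obtain ⟨s₁, hs₁, hqs₁⟩ := hsec x.1
  obtain ⟨s₂, hs₂, hqs₂⟩ := hsec x.2
  have h1 : SmoothNear (𝒢bar.Y.prod 𝒢bar.Y) 𝒢.Y (fun z => s₁ z.1) x :=
    SmoothNear.comp hs₁ (smoothNear_fst x)
  have h2 : SmoothNear (𝒢bar.Y.prod 𝒢bar.Y) 𝒢.Y (fun z => s₂ z.2) x :=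
    SmoothNear.comp hs₂ (smoothNear_snd x)
  have e1 : ∀ᶠ z in 𝓝 x, qY (s₁ z.1) = z.1 := continuousAt_fst.eventually hqs₁
  have e2 : ∀ᶠ z in 𝓝 x, qY (s₂ z.2) = z.2 := continuousAt_snd.eventually hqs₂
  have key : ∀ z : 𝒢bar.Y.prod 𝒢bar.Y, qY (s₁ z.1) = z.1 → qY (s₂ z.2) = z.2 → z ∈ fib2 𝒢bar.π →
      q (𝒢.π (s₂ z.2)) = q (𝒢.π (s₁ z.1)) := by
    intro z hz1 hz2 hz
    rw [← h𝒢bar.π_eq, ← h𝒢bar.π_eq, hz1, hz2]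
    exact hz.symm
  -- Lifting the two entries separately gives points whose images in `M` share an orbit; the second
  -- lift is moved by the transporter between those images.
  obtain ⟨g, hg, hgz⟩ := hq.exists_smooth_transporter_imp hG ((𝒢.smoothNear_π _).comp h2)
    ((𝒢.smoothNear_π _).comp h1) (key x e1.self_of_nhds e2.self_of_nhds hx)
  refine ⟨fun z => (s₁ z.1, g z • s₂ z.2), h1.prodMk (h𝒢.smooth.smoothNear_smul hg h2), ?_⟩
  filter_upwards [e1, e2, hgz] with z hz1 hz2 hz
  refine ⟨hz1, (hY.map_smul _ _).trans hz2, fun hzf => ?_⟩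
  change 𝒢.π (s₁ z.1) = 𝒢.π (g z • s₂ z.2)
  rw [h𝒢.π_smul]
  exact hz (key z hz1 hz2 hzf)

theorem IsGerbeQuotient.exists_lift_Y (hq : IsPrincipalQuotient G M Mbar q)
    (h𝒢 : IsStronglyEquivariant G 𝒢) (h𝒢bar : IsGerbeQuotient G 𝒢 𝒢bar q qY qP) (y : 𝒢.Y)
    {x : 𝒢bar.Y} (hx : 𝒢bar.π (qY y) = 𝒢bar.π x) : ∃ y' : 𝒢.Y, qY y' = x ∧ 𝒢.π y = 𝒢.π y' := by
  obtain ⟨y', rfl⟩ := h𝒢bar.quotient_Y.surjective x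
  rw [h𝒢bar.π_eq, h𝒢bar.π_eq, eq_comm, hq.orbits] at hx
  obtain ⟨g, hg⟩ := hx
  exact ⟨g • y', h𝒢bar.quotient_Y.map_smul g y', by rw [h𝒢.π_smul, hg]⟩

/-- Two lifts to `Y^[2]` of the same pair differ by one group element. -/
theorem IsGerbeQuotient.exists_smul_eq_pair (hq : IsPrincipalQuotient G M Mbar q)
    (h𝒢 : IsStronglyEquivariant G 𝒢) (h𝒢bar : IsGerbeQuotient G 𝒢 𝒢bar q qY qP)
    {y₁ y₂ y₁' y₂' : 𝒢.Y} (hy : 𝒢.π y₁ = 𝒢.π y₂) (hy' : 𝒢.π y₁' = 𝒢.π y₂')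
    (h₁ : qY y₁ = qY y₁') (h₂ : qY y₂ = qY y₂') : ∃ g : G, g • y₁ = y₁' ∧ g • y₂ = y₂' := by
  obtain ⟨g, rfl⟩ := (h𝒢bar.quotient_Y.orbits _ _).1 h₁
  obtain ⟨g', rfl⟩ := (h𝒢bar.quotient_Y.orbits _ _).1 h₂
  rw [h𝒢.π_smul, h𝒢.π_smul, hy] at hy'
  -- Both elements move the common image in `M` to the same point, and the action on `M` is free.
  rw [hq.eq_of_smul_eq hy']
  exact ⟨g', rfl, rfl⟩

theorem IsGerbeQuotient.exists_lift_P (hq : IsPrincipalQuotient G M Mbar q)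
    (h𝒢 : IsStronglyEquivariant G 𝒢) (h𝒢bar : IsGerbeQuotient G 𝒢 𝒢bar q qY qP)
    {y₁ y₂ : 𝒢.Y} (hy : 𝒢.π y₁ = 𝒢.π y₂) {pbar : 𝒢bar.P.total}
    (hp : 𝒢bar.P.proj pbar = (qY y₁, qY y₂)) :
    ∃ p : 𝒢.P.total, qP p = pbar ∧ 𝒢.P.proj p = (y₁, y₂) := by
  obtain ⟨p, rfl⟩ := h𝒢bar.quotient_P.surjective pbar
  rw [h𝒢bar.quotient_P.proj_eq, Prod.mk.injEq] at hp
  obtain ⟨g, hg₁, hg₂⟩ := h𝒢bar.exists_smul_eq_pair hq h𝒢 (𝒢.P.proj_mem p) hy hp.1 hp.2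
  refine ⟨g • p, ((h𝒢bar.quotient_P.orbits _ _).2 ⟨g, rfl⟩).symm, ?_⟩
  rw [h𝒢.equivariant_P.proj_smul, hg₁, hg₂]

variable {𝓡 : PseudoTBundle 𝒢} [MulAction G 𝓡.R.total] {Rbar : TBundle 𝒢bar.Y univ}
  {qR : 𝓡.R.total → Rbar.total}

theorem IsTBundleQuotient.map_smul_group {X Xbar : LCManifold.{u}} {S : Set X} {Sbar : Set Xbar}
    {P : TBundle X S} [MulAction G P.total] {Pbar : TBundle Xbar Sbar} {qX : X → Xbar}
    {qP : P.total → Pbar.total} (h : IsTBundleQuotient G P Pbar qX qP) (g : G) (p : P.total) :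
    qP (g • p) = qP p :=
  ((h.orbits _ _).2 ⟨g, rfl⟩).symm

theorem IsTBundleQuotient.exists_lift {X Xbar : LCManifold.{u}} [MulAction G X]
    {P : TBundle X univ} [MulAction G P.total] {Pbar : TBundle Xbar univ} {qX : X → Xbar}
    {qP : P.total → Pbar.total} (h : IsTBundleQuotient G P Pbar qX qP)
    (hX : IsPrincipalQuotient G X Xbar qX) (hP : IsEquivariantTBundle G P (fun g x => g • x))
    {x : X} {pbar : Pbar.total} (hp : Pbar.proj pbar = qX x) :
    ∃ p : P.total, qP p = pbar ∧ P.proj p = x := by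
  obtain ⟨p, rfl⟩ := h.surjective pbar
  rw [h.proj_eq, hX.orbits] at hp
  obtain ⟨g, hg⟩ := hp
  exact ⟨g • p, h.map_smul_group g p, by rw [hP.proj_smul, hg]⟩

/-- Two lifts of a pair differ by one `g`; invariance of `v` absorbs it, and `qR`, `qP` forget it
while respecting circle factors. -/
theorem exists_quotient_section (hq : IsPrincipalQuotient G M Mbar q)
    (h𝒢 : IsStronglyEquivariant G 𝒢) (h𝒢bar : IsGerbeQuotient G 𝒢 𝒢bar q qY qP)
    (h𝓡 : IsEquivariantPseudo G 𝓡) (hQ : IsTBundleQuotient G 𝓡.R Rbar qY qR) :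
    ∃ vbar : 𝒢bar.Y.prod 𝒢bar.Y → Tensor Rbar.total Rbar.total 𝒢bar.P.total,
      ∀ (y₁ y₂ : 𝒢.Y) (a b : 𝓡.R.total) (c : 𝒢.P.total), 𝒢.π y₁ = 𝒢.π y₂ →
        𝓡.v (y₁, y₂) = Tensor.mk a b c →
        vbar (qY y₁, qY y₂) = Tensor.mk (qR a) (qR b) (qP c) := by
  have key : ∀ x : 𝒢bar.Y.prod 𝒢bar.Y, ∃ t : Tensor Rbar.total Rbar.total 𝒢bar.P.total,
      ∀ (y₁ y₂ : 𝒢.Y) (a b : 𝓡.R.total) (c : 𝒢.P.total), qY y₁ = x.1 → qY y₂ = x.2 →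
        𝒢.π y₁ = 𝒢.π y₂ → 𝓡.v (y₁, y₂) = Tensor.mk a b c →
        t = Tensor.mk (qR a) (qR b) (qP c) := by
    intro x
    by_cases hx : ∃ y₁ y₂ : 𝒢.Y, qY y₁ = x.1 ∧ qY y₂ = x.2 ∧ 𝒢.π y₁ = 𝒢.π y₂
    · obtain ⟨y₁, y₂, h₁, h₂, hy⟩ := hx
      obtain ⟨a, b, c, hv⟩ := Tensor.exists_rep (𝓡.v (y₁, y₂))
      refine ⟨Tensor.mk (qR a) (qR b) (qP c), fun y₁' y₂' a' b' c' h₁' h₂' hy' hv' => ?_⟩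
      obtain ⟨g, rfl, rfl⟩ := h𝒢bar.exists_smul_eq_pair hq h𝒢 hy hy' (h₁.trans h₁'.symm)
        (h₂.trans h₂'.symm)
      rw [h𝓡.invariant_v g y₁ y₂ a b c hy hv] at hv'
      obtain ⟨z₁, z₂, z₃, hz, rfl, rfl, rfl⟩ := Tensor.mk_eq_mk_iff.1 hv'
      rw [Tensor.mk_eq_mk_iff]
      refine ⟨z₁, z₂, z₃, hz, ?_, ?_, ?_⟩
      · rw [hQ.map_smul, hQ.map_smul_group]
      · rw [hQ.map_smul, hQ.map_smul_group]
      · rw [h𝒢bar.quotient_P.map_smul, h𝒢bar.quotient_P.map_smul_group]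
    -- Off the fibre product the value is arbitrary; the diagonal supplies a point of the bundle
    -- over pairs.
    · obtain ⟨r, -⟩ := Rbar.exists_proj_eq (mem_univ x.1)
      obtain ⟨p, -⟩ := 𝒢bar.P.exists_proj_eq (x := (x.1, x.1)) rfl
      exact ⟨Tensor.mk r r p, fun y₁ y₂ a b c h₁ h₂ hy _ => absurd ⟨y₁, y₂, h₁, h₂, hy⟩ hx⟩
  choose vbar hvbar using key
  exact ⟨vbar, fun y₁ y₂ a b c hy hv => hvbar _ y₁ y₂ a b c rfl rfl hy hv⟩

/-- The quotient of an equivariant pseudo `𝕋`-bundle. -/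
theorem exists_pseudoTBundle_quotient (hG : IsLieGroup G) (hq : IsPrincipalQuotient G M Mbar q)
    (h𝒢 : IsStronglyEquivariant G 𝒢) (h𝒢bar : IsGerbeQuotient G 𝒢 𝒢bar q qY qP)
    (h𝓡 : IsEquivariantPseudo G 𝓡) :
    ∃ (𝓡bar : PseudoTBundle 𝒢bar) (qR : 𝓡.R.total → 𝓡bar.R.total),
      IsTBundleQuotient G 𝓡.R 𝓡bar.R qY qR ∧
      IsPrincipalQuotient G 𝓡.R.total 𝓡bar.R.total qR ∧
      ∀ (y₁ y₂ : 𝒢.Y) (a b : 𝓡.R.total) (c : 𝒢.P.total), 𝒢.π y₁ = 𝒢.π y₂ →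
        𝓡.v (y₁, y₂) = Tensor.mk a b c →
        𝓡bar.v (qY y₁, qY y₂) = Tensor.mk (qR a) (qR b) (qP c) := by
  have hY := h𝒢bar.quotient_Y
  obtain ⟨Rbar, qR, hQ, hQp⟩ := exists_tBundleQuotient hG hY h𝓡.equivariant_R
  obtain ⟨vbar, hvbar⟩ := exists_quotient_section hq h𝒢 h𝒢bar h𝓡 hQ
  have hsection : IsTensorSection (fib2 𝒢bar.π) Rbar Rbar 𝒢bar.P
      (fun x => x.1) (fun x => x.2) (fun x => x) vbar := by
    intro x hx
    obtain ⟨l, hl, hlz⟩ := h𝒢bar.exists_smooth_lift hG hq h𝒢 hx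
    obtain ⟨-, -, hlx⟩ := hlz.self_of_nhds
    obtain ⟨V, hV, hxV, a, b, c, ha, hb, hc, habc⟩ := 𝓡.section_v (l x) (hlx hx)
    have hlV : ∀ᶠ z in 𝓝 x, l z ∈ V := hl.continuousAt.eventually (hV.mem_nhds hxV)
    obtain ⟨W, hWs, hW, hxW⟩ := mem_nhds_iff.1 ((hl.eventually.and hlV).and hlz)
    refine ⟨W, hW, hxW, fun z => qR (a (l z)), fun z => qR (b (l z)), fun z => qP (c (l z)),
      smoothOn_of_smoothNear hW fun z hz => ?_, smoothOn_of_smoothNear hW fun z hz => ?_,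
      smoothOn_of_smoothNear hW fun z hz => ?_, fun z hz => ?_⟩
    · exact (hQ.smooth.smoothNear _).comp ((ha.smoothNear hV (hWs hz).1.2).comp (hWs hz).1.1)
    · exact (hQ.smooth.smoothNear _).comp ((hb.smoothNear hV (hWs hz).1.2).comp (hWs hz).1.1)
    · exact (h𝒢bar.quotient_P.smooth.smoothNear _).comp
        ((hc.smoothNear hV (hWs hz).1.2).comp (hWs hz).1.1)
    · obtain ⟨⟨-, hzV⟩, hz1, hz2, hzf⟩ := hWs hz.1
      obtain ⟨h1, h2, h3, h4⟩ := habc (l z) ⟨hzV, hzf hz.2⟩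
      refine ⟨?_, ?_, ?_, ?_⟩
      · rw [hQ.proj_eq, h1, hz1]
      · rw [hQ.proj_eq, h2, hz2]
      · rw [h𝒢bar.quotient_P.proj_eq, h3, hz1, hz2]
      · rw [← hvbar (l z).1 (l z).2 _ _ _ (hzf hz.2) h4, hz1, hz2]
  refine ⟨⟨Rbar, vbar, hsection, ?_⟩, qR, hQ, hQp, hvbar⟩
  intro x₁ x₂ x₃ s₁ s₂ s₃ t₁₂ t₁₃ t₂₃ w₁₂ w₁₃ w₂₃ hs₁ hs₂ hs₃ ht₁₂ ht₁₃ ht₂₃ h₁₂ h₁₃ h₂₃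
  have hf : ∀ {t : 𝒢bar.P.total} {x x' : 𝒢bar.Y}, 𝒢bar.P.proj t = (x, x') →
      𝒢bar.π x = 𝒢bar.π x' := by
    intro t x x' ht
    have := 𝒢bar.P.proj_mem t
    rwa [ht] at this
  -- Lift the base points into one fibre of `π`, then the bundle points over them. The components of
  -- `v` on the lifts equal the given ones, since components are unique, so `delta_v` upstairs
  -- applies.
  obtain ⟨y₁, rfl⟩ := hY.surjective x₁
  obtain ⟨y₂, rfl, hy₂⟩ := h𝒢bar.exists_lift_Y hq h𝒢 y₁ (hf ht₁₂)
  obtain ⟨y₃, rfl, hy₃⟩ := h𝒢bar.exists_lift_Y hq h𝒢 y₁ (hf ht₁₃)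
  obtain ⟨r₁, rfl, hr₁⟩ := hQ.exists_lift hY h𝓡.equivariant_R hs₁
  obtain ⟨r₂, rfl, hr₂⟩ := hQ.exists_lift hY h𝓡.equivariant_R hs₂
  obtain ⟨r₃, rfl, hr₃⟩ := hQ.exists_lift hY h𝓡.equivariant_R hs₃
  obtain ⟨p₁₂, rfl, hp₁₂⟩ := h𝒢bar.exists_lift_P hq h𝒢 hy₂ ht₁₂
  obtain ⟨p₁₃, rfl, hp₁₃⟩ := h𝒢bar.exists_lift_P hq h𝒢 hy₃ ht₁₃
  obtain ⟨p₂₃, rfl, hp₂₃⟩ := h𝒢bar.exists_lift_P hq h𝒢 (hy₂.symm.trans hy₃) ht₂₃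
  obtain ⟨u₁₂, hu₁₂⟩ := 𝓡.exists_component hr₁ hr₂ hp₁₂
  obtain ⟨u₁₃, hu₁₃⟩ := 𝓡.exists_component hr₁ hr₃ hp₁₃
  obtain ⟨u₂₃, hu₂₃⟩ := 𝓡.exists_component hr₂ hr₃ hp₂₃
  rw [hvbar _ _ _ _ _ hy₂ hu₁₂, hQ.map_smul] at h₁₂
  rw [hvbar _ _ _ _ _ hy₃ hu₁₃, hQ.map_smul] at h₁₃
  rw [hvbar _ _ _ _ _ (hy₂.symm.trans hy₃) hu₂₃, hQ.map_smul] at h₂₃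
  rw [← Tensor.smul_injective h₁₂, ← Tensor.smul_injective h₁₃, ← Tensor.smul_injective h₂₃,
    ← h𝒢bar.quotient_P.map_smul]
  exact h𝒢bar.s_eq _ _ _ _ _ _ hy₂ (hy₂.symm.trans hy₃)
    (𝓡.delta_v y₁ y₂ y₃ r₁ r₂ r₃ p₁₂ p₁₃ p₂₃ u₁₂ u₁₃ u₂₃ hr₁ hr₂ hr₃ hp₁₂ hp₁₃ hp₂₃ hu₁₂ hu₁₃ hu₂₃)

end QuotientSection

/-! ### Connections on the quotient -/

section QuotientConnection

theorem velocity_congr {M : LCManifold.{u}} {c c' : ℝ → M} {t : ℝ} (h : c =ᶠ[𝓝 t] c') :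
    velocity c t = velocity c' t :=
  tmap_congr (M := ofSpace ℝ) (N := M) h 1

theorem SmoothCurveOn.smoothNear {M : LCManifold.{u}} {c : ℝ → M} {I : Set ℝ}
    (hc : SmoothCurveOn c I) (hI : IsOpen I) {t : ℝ} (ht : t ∈ I) :
    SmoothNear (ofSpace ℝ) M c t :=
  SmoothOn.smoothNear (M := ofSpace ℝ) hc hI ht

theorem TBundle.tmap_proj_vertical {X : LCManifold.{u}} {S : Set X} (P : TBundle X S)
    (p : P.total) : tmap P.proj p (velocity (fun θ : ℝ => Circle.exp θ • p) 0) = 0 := by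
  have h1 : SmoothNear (ofSpace ℝ) P.total (fun θ : ℝ => Circle.exp θ • p) 0 :=
    P.smoothNear_smul (M := ofSpace ℝ) (smoothNear_id (M := ofSpace ℝ) (0 : ℝ)).circleExp
      (smoothNear_const _ _)
  have h2 := velocity_comp (f := P.proj) (P.smoothNear_proj _) h1
  simp only [P.proj_smul, Circle.exp_zero, one_smul] at h2
  rw [← h2]
  exact tmap_const (M := ofSpace ℝ) (N := X) _ _ _

variable {G M Mbar : LCManifold.{u}} [Group G] [MulAction G M] {q : M → Mbar} {𝒢 : BundleGerbe M}
  [MulAction G 𝒢.Y] [MulAction G 𝒢.P.total]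

/-- The derivative of a local section through `n` is a right inverse. -/
theorem IsPrincipalQuotient.tmap_surjective {N B : LCManifold.{u}} [MulAction G N] {q : N → B}
    (hN : IsSmoothAction G N) (hq : IsPrincipalQuotient G N B q) (n : N) (k : B.model) :
    ∃ h : N.model, tmap q n h = k := by
  obtain ⟨s, hs, hsn, hqs⟩ := hq.exists_section hN n
  refine ⟨tmap s (q n) k, ?_⟩
  have h1 := tmap_comp (f := s) (g := q) (hq.smooth.smoothNear _) hs k
  have h2 : (fun b => q (s b)) =ᶠ[𝓝 (q n)] fun b => b := hqs
  rw [tmap_congr h2, tmap_id, hsn] at h1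
  exact h1.symm

/-- The form `η - κ` on `R`. -/
def shiftedForm (𝓡 : PseudoTBundle 𝒢) (H : 𝓡.R.total → 𝓡.R.total.model → ℝ)
    (Ξ : M → M.model → G.model) (lam : 𝒢.Y → G.model → ℝ) (r : 𝓡.R.total)
    (h : 𝓡.R.total.model) : ℝ :=
  H r h - kappa 𝒢 Ξ lam (𝓡.R.proj r) (tmap 𝓡.R.proj r h)

variable {𝓡 : PseudoTBundle 𝒢} [MulAction G 𝓡.R.total] {H : 𝓡.R.total → 𝓡.R.total.model → ℝ}
  {Ξ : M → M.model → G.model} {lam : 𝒢.Y → G.model → ℝ}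

theorem isLinearMap_shiftedForm (hH : IsOneForm 𝓡.R.total H) (hΞ : IsPrincipalConnection G M Ξ)
    (hlam : IsDualMap G 𝒢.Y lam) (r : 𝓡.R.total) : IsLinearMap ℝ (shiftedForm 𝓡 H Ξ lam r) := by
  have h1 := hH.linear r
  have h2 := isLinearMap_kappa hΞ hlam (𝓡.R.proj r)
  have h3 := (𝓡.R.smoothNear_proj r).isLinearMap_tmap
  refine ⟨fun h k => ?_, fun c h => ?_⟩
  · simp only [shiftedForm, h1.map_add, h3.map_add, h2.map_add]
    ring
  · simp only [shiftedForm, h1.map_smul, h3.map_smul, h2.map_smul, smul_sub]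

theorem smoothNear_shiftedForm_pullback (hH : IsOneForm 𝓡.R.total H)
    (hΞ : IsPrincipalConnection G M Ξ) (hlam : IsDualMap G 𝒢.Y lam)
    {E : Type u} [AddCommGroup E] [Module ℝ E] [TopologicalSpace E] [IsTopologicalAddGroup E]
    [ContinuousSMul ℝ E] [LocallyConvexSpace ℝ E] [T2Space E] {s : E → 𝓡.R.total} {a : E}
    (hs : SmoothNear (ofSpace E) 𝓡.R.total s a) (k : E) :
    SmoothNear (ofSpace (E × E)) (ofSpace ℝ) (fun p : E × E =>
      shiftedForm 𝓡 H Ξ lam (s p.1) (tmap (M := ofSpace E) (N := 𝓡.R.total) s p.1 p.2))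
      (a, k) := by
  have h1 : SmoothNear (ofSpace E) 𝒢.Y (fun x => 𝓡.R.proj (s x)) a :=
    (𝓡.R.smoothNear_proj _).comp hs
  refine (SmoothNear.sub_space (hH.smoothNear_pullback hs k)
    (smoothNear_kappa_pullback hΞ hlam h1 k)).congr ?_
  have h2 : ∀ᶠ p : E × E in 𝓝 (a, k), _ := continuousAt_fst.eventually hs.eventually
  filter_upwards [h2] with p hp
  unfold shiftedForm
  rw [tmap_comp (M := ofSpace E) (𝓡.R.smoothNear_proj _) hp]

theorem invariant_shiftedForm (hG : IsLieGroup G) (hM : IsSmoothAction G M)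
    (h𝒢 : IsStronglyEquivariant G 𝒢) (hΞ : IsPrincipalConnection G M Ξ)
    {f : 𝒢.Y → 𝒢.Y.model → 𝒢.Y.model → ℝ} (hobs : ObstructionVanishes G 𝒢.Y f lam)
    (h𝓡 : IsEquivariantPseudo G 𝓡) (hHinv : InvariantOneForm G 𝓡.R.total H) :
    InvariantOneForm G 𝓡.R.total (shiftedForm 𝓡 H Ξ lam) := by
  intro g r h
  unfold shiftedForm
  have h1 := kappa_invariant hG hM h𝒢 hΞ hobs g (𝓡.R.proj r) (tmap 𝓡.R.proj r h)
  rw [← tmap_comp (f := 𝓡.R.proj) (g := fun y : 𝒢.Y => g • y)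
    (h𝒢.smooth.smoothNear_const_smul g _) (𝓡.R.smoothNear_proj r)] at h1
  simp only [← h𝓡.equivariant_R.proj_smul] at h1
  rw [tmap_comp (f := fun r : 𝓡.R.total => g • r) (g := 𝓡.R.proj) (𝓡.R.smoothNear_proj _)
    (h𝓡.equivariant_R.smooth.smoothNear_const_smul g r)] at h1
  rw [hHinv, h1]

/-- The hypothesis `hmom` is where `μ = 0` enters: `η` and `κ` then agree on generating vectors. -/
theorem shiftedForm_infAct (h𝒢 : IsStronglyEquivariant G 𝒢) (hΞ : IsPrincipalConnection G M Ξ)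
    (h𝓡 : IsEquivariantPseudo G 𝓡) (hmom : IsMoment G 𝓡.R H lam) (r : 𝓡.R.total) (X : G.model) :
    shiftedForm 𝓡 H Ξ lam r (infAct X r) = 0 := by
  unfold shiftedForm
  rw [tmap_infAct h𝓡.equivariant_R.smooth (𝓡.R.smoothNear_proj r) h𝓡.equivariant_R.proj_smul,
    kappa_infAct h𝒢 hΞ, hmom, sub_self]

variable {𝒢bar : BundleGerbe Mbar} {qY : 𝒢.Y → 𝒢bar.Y} {qP : 𝒢.P.total → 𝒢bar.P.total}
  {𝓡bar : PseudoTBundle 𝒢bar} {qR : 𝓡.R.total → 𝓡bar.R.total}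
  {Hbar : 𝓡bar.R.total → 𝓡bar.R.total.model → ℝ}

/-- `qR` is `𝕋`-equivariant and surjective on tangent vectors, so both properties are checked on
`R`. There `κ` comes from the base: it vanishes along circle orbits and is unchanged by circle
translations. -/
theorem isTConnection_descent (h𝓡 : IsEquivariantPseudo G 𝓡)
    (hQ : IsTBundleQuotient G 𝓡.R 𝓡bar.R qY qR)
    (hQp : IsPrincipalQuotient G 𝓡.R.total 𝓡bar.R.total qR) (hH : IsTConnection 𝓡.R H)
    (hΞ : IsPrincipalConnection G M Ξ) (hlam : IsDualMap G 𝒢.Y lam)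
    (hHbar : IsOneForm 𝓡bar.R.total Hbar)
    (hpull : ∀ r h, Hbar (qR r) (tmap qR r h) = shiftedForm 𝓡 H Ξ lam r h) :
    IsTConnection 𝓡bar.R Hbar where
  form := hHbar
  vertical := by
    intro x
    obtain ⟨r, rfl⟩ := hQ.surjective x
    have h1 : SmoothNear (ofSpace ℝ) 𝓡.R.total (fun θ : ℝ => Circle.exp θ • r) 0 :=
      𝓡.R.smoothNear_smul (M := ofSpace ℝ) (smoothNear_id (M := ofSpace ℝ) (0 : ℝ)).circleExp
        (smoothNear_const _ _)
    have h2 := velocity_comp (f := qR) (hQ.smooth.smoothNear _) h1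
    simp only [hQ.map_smul, Circle.exp_zero, one_smul] at h2
    rw [h2, hpull]
    unfold shiftedForm
    rw [hH.vertical, 𝓡.R.tmap_proj_vertical, (isLinearMap_kappa hΞ hlam _).map_zero, sub_zero]
  invariant := by
    intro z x k
    obtain ⟨r, rfl⟩ := hQ.surjective x
    obtain ⟨h, rfl⟩ := hQp.tmap_surjective h𝓡.equivariant_R.smooth r k
    rw [← tmap_comp (f := qR) (g := fun x => z • x) (𝓡bar.R.smoothNear_const_smul z _)
      (hQ.smooth.smoothNear r)]
    simp only [← hQ.map_smul]
    rw [tmap_comp (f := fun r => z • r) (g := qR) (hQ.smooth.smoothNear _)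
      (𝓡.R.smoothNear_const_smul z r), hpull, hpull]
    unfold shiftedForm
    rw [hH.invariant, ← tmap_comp (𝓡.R.smoothNear_proj _) (𝓡.R.smoothNear_const_smul z r)]
    simp only [𝓡.R.proj_smul]

/-- Curves representing the quotient section are lifted to curves representing `v`, where the
pull-back of `η` and `∇` is known to vanish; the `κ`-corrections sum to zero. -/
theorem pullbackVanishes_descent (hG : IsLieGroup G) (hq : IsPrincipalQuotient G M Mbar q)
    (h𝒢 : IsStronglyEquivariant G 𝒢) (h𝒢bar : IsGerbeQuotient G 𝒢 𝒢bar q qY qP)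
    {A : 𝒢.P.total → 𝒢.P.total.model → ℝ} {f : 𝒢.Y → 𝒢.Y.model → 𝒢.Y.model → ℝ}
    {Abar : 𝒢bar.P.total → 𝒢bar.P.total.model → ℝ}
    {fbar : 𝒢bar.Y → 𝒢bar.Y.model → 𝒢bar.Y.model → ℝ}
    (hred : IsFormReduction 𝒢 A f Ξ lam 𝒢bar qY qP Abar fbar)
    (hH : IsPseudoConnection A 𝓡 H) (hQ : IsTBundleQuotient G 𝓡.R 𝓡bar.R qY qR)
    (hv : ∀ (y₁ y₂ : 𝒢.Y) (a b : 𝓡.R.total) (c : 𝒢.P.total), 𝒢.π y₁ = 𝒢.π y₂ →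
      𝓡.v (y₁, y₂) = Tensor.mk a b c →
      𝓡bar.v (qY y₁, qY y₂) = Tensor.mk (qR a) (qR b) (qP c))
    (hpull : ∀ r h, Hbar (qR r) (tmap qR r h) = shiftedForm 𝓡 H Ξ lam r h) :
    PullbackVanishes (fib2 𝒢bar.π) 𝓡bar.R 𝓡bar.R 𝒢bar.P
      (fun x => x.1) (fun x => x.2) (fun x => x) 𝓡bar.v Hbar Hbar Abar := by
  intro I hI x a b c hx ha hb hc hI' t ht
  have hxt := hx.smoothNear hI ht
  obtain ⟨l, hl, hlz⟩ := h𝒢bar.exists_smooth_lift hG hq h𝒢 (hI' t ht).1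
  have hlf : l (x t) ∈ fib2 𝒢.π := hlz.self_of_nhds.2.2 (hI' t ht).1
  obtain ⟨V, hV, hxV, a', b', c', ha', hb', hc', habc⟩ := 𝓡.section_v (l (x t)) hlf
  have hlx : SmoothNear (ofSpace ℝ) (𝒢.Y.prod 𝒢.Y) (fun s => l (x s)) t := SmoothNear.comp hl hxt
  have hlV : ∀ᶠ s in 𝓝 t, l (x s) ∈ V :=
    (SmoothNear.continuousAt hlx).eventually (hV.mem_nhds hxV)
  have hsI : ∀ᶠ s in 𝓝 t, s ∈ I := hI.mem_nhds ht
  have hlz' := (SmoothNear.continuousAt hxt).eventually hlz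
  have hpt : ∀ᶠ s in 𝓝 t, l (x s) ∈ fib2 𝒢.π ∧ 𝓡.R.proj (a' (l (x s))) = (l (x s)).1 ∧
      𝓡.R.proj (b' (l (x s))) = (l (x s)).2 ∧ 𝒢.P.proj (c' (l (x s))) = l (x s) ∧
      𝓡.v (l (x s)) = Tensor.mk (a' (l (x s))) (b' (l (x s))) (c' (l (x s))) ∧
      Tensor.mk (qR (a' (l (x s)))) (qR (b' (l (x s)))) (qP (c' (l (x s)))) =
        Tensor.mk (a s) (b s) (c s) := by
    filter_upwards [hlV, hsI, hlz'] with s hsV hs hsl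
    have h1 := hsl.2.2 (hI' s hs).1
    obtain ⟨h2, h3, h4, h5⟩ := habc _ ⟨hsV, h1⟩
    refine ⟨h1, h2, h3, h4, h5, ?_⟩
    rw [← (hI' s hs).2.2.2.2, ← hv (l (x s)).1 (l (x s)).2 _ _ _ h1 h5, hsl.1, hsl.2.1]
  -- Local representatives of `v` along the lifted curve project to the given curves only up to
  -- circle factors, chosen here pointwise; freeness later makes them smooth.
  have hex : ∀ s, ∃ z₁ z₂ z₃ : Circle,
      Tensor.mk (qR (a' (l (x s)))) (qR (b' (l (x s)))) (qP (c' (l (x s)))) =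
        Tensor.mk (a s) (b s) (c s) → z₁ * z₂⁻¹ * z₃ = 1 ∧ a s = z₁ • qR (a' (l (x s))) ∧
          b s = z₂ • qR (b' (l (x s))) ∧ c s = z₃ • qP (c' (l (x s))) := by
    intro s
    by_cases h : Tensor.mk (qR (a' (l (x s)))) (qR (b' (l (x s)))) (qP (c' (l (x s)))) =
        Tensor.mk (a s) (b s) (c s)
    · obtain ⟨z₁, z₂, z₃, hz⟩ := Tensor.mk_eq_mk_iff.1 h
      exact ⟨z₁, z₂, z₃, fun _ => hz⟩
    · exact ⟨1, 1, 1, fun h' => absurd h' h⟩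
  choose z₁ z₂ z₃ hz using hex
  have ha₁ : SmoothNear (ofSpace ℝ) 𝓡.R.total (fun s => a' (l (x s))) t :=
    SmoothNear.comp (M := ofSpace ℝ) (g := a') (f := fun s => l (x s))
      (ha'.smoothNear hV hxV) hlx
  have hb₁ : SmoothNear (ofSpace ℝ) 𝓡.R.total (fun s => b' (l (x s))) t :=
    SmoothNear.comp (M := ofSpace ℝ) (g := b') (f := fun s => l (x s))
      (hb'.smoothNear hV hxV) hlx
  have hc₁ : SmoothNear (ofSpace ℝ) 𝒢.P.total (fun s => c' (l (x s))) t :=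
    SmoothNear.comp (M := ofSpace ℝ) (g := c') (f := fun s => l (x s))
      (hc'.smoothNear hV hxV) hlx
  have hz₁ : CircleSmoothNear (ofSpace ℝ) z₁ t :=
    𝓡bar.R.circleSmoothNear_ratio (M := ofSpace ℝ) (SmoothNear.comp (hQ.smooth.smoothNear _) ha₁)
      (ha.smoothNear hI ht) (hpt.mono fun s hs => (hz s hs.2.2.2.2.2).2.1)
  have hz₂ : CircleSmoothNear (ofSpace ℝ) z₂ t :=
    𝓡bar.R.circleSmoothNear_ratio (M := ofSpace ℝ) (SmoothNear.comp (hQ.smooth.smoothNear _) hb₁)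
      (hb.smoothNear hI ht) (hpt.mono fun s hs => (hz s hs.2.2.2.2.2).2.2.1)
  have hz₃ : CircleSmoothNear (ofSpace ℝ) z₃ t :=
    𝒢bar.P.circleSmoothNear_ratio (M := ofSpace ℝ)
      (SmoothNear.comp (h𝒢bar.quotient_P.smooth.smoothNear _) hc₁)
      (hc.smoothNear hI ht) (hpt.mono fun s hs => (hz s hs.2.2.2.2.2).2.2.2)
  have ha₂ := 𝓡.R.smoothNear_smul (M := ofSpace ℝ) hz₁ ha₁
  have hb₂ := 𝓡.R.smoothNear_smul (M := ofSpace ℝ) hz₂ hb₁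
  have hc₂ := 𝒢.P.smoothNear_smul (M := ofSpace ℝ) hz₃ hc₁
  obtain ⟨J, hJs, hJ, htJ⟩ := mem_nhds_iff.1
    (((hlx.eventually.and ha₂.eventually).and (hb₂.eventually.and hc₂.eventually)).and hpt)
  have hcurve : ∀ {N : LCManifold.{u}} {γ : ℝ → N},
      (∀ s ∈ J, SmoothNear (ofSpace ℝ) N γ s) → SmoothCurveOn γ J := fun h =>
    smoothOn_of_smoothNear (M := ofSpace ℝ) hJ h
  -- The corrected curves project to `a`, `b`, `c` on the nose, and `z₁ * z₂⁻¹ * z₃ = 1` ensures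
  -- that they still represent `v`.
  have key := hH.compatible J hJ (fun s => l (x s)) (fun s => z₁ s • a' (l (x s)))
    (fun s => z₂ s • b' (l (x s))) (fun s => z₃ s • c' (l (x s)))
    (hcurve fun s hs => (hJs hs).1.1.1) (hcurve fun s hs => (hJs hs).1.1.2)
    (hcurve fun s hs => (hJs hs).1.2.1) (hcurve fun s hs => (hJs hs).1.2.2)
    (fun s hs => by
      obtain ⟨h1, h2, h3, h4, h5, h6⟩ := (hJs hs).2
      refine ⟨h1, ?_, ?_, ?_, ?_⟩
      · rw [𝓡.R.proj_smul, h2]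
      · rw [𝓡.R.proj_smul, h3]
      · rw [𝒢.P.proj_smul, h4]
      · rw [Tensor.mk_smul, (hz s h6).1, one_smul, h5]) t htJ
  have hRstep : ∀ (γ : ℝ → 𝓡bar.R.total) (γ' : ℝ → 𝓡.R.total) (y : ℝ → 𝒢.Y),
      SmoothNear (ofSpace ℝ) 𝓡.R.total γ' t → (∀ᶠ s in 𝓝 t, γ s = qR (γ' s)) →
      (∀ᶠ s in 𝓝 t, 𝓡.R.proj (γ' s) = y s) →
      Hbar (γ t) (velocity γ t) = H (γ' t) (velocity γ' t) -
        kappa 𝒢 Ξ lam (y t) (velocity y t) := by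
    intro γ γ' y hγ' hγ hy
    have h1 : velocity γ t = tmap qR (γ' t) (velocity γ' t) :=
      (velocity_congr hγ).trans (velocity_comp (hQ.smooth.smoothNear _) hγ')
    have h2 : velocity y t = tmap 𝓡.R.proj (γ' t) (velocity γ' t) :=
      (velocity_congr hy).symm.trans (velocity_comp (𝓡.R.smoothNear_proj _) hγ')
    rw [h1, h2, hγ.self_of_nhds, hpull, ← hy.self_of_nhds]
    rfl
  have e1 := hRstep a (fun s => z₁ s • a' (l (x s))) (fun s => (l (x s)).1) ha₂
    (hpt.mono fun s hs => by rw [hQ.map_smul]; exact (hz s hs.2.2.2.2.2).2.1)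
    (hpt.mono fun s hs => by rw [𝓡.R.proj_smul]; exact hs.2.1)
  have e2 := hRstep b (fun s => z₂ s • b' (l (x s))) (fun s => (l (x s)).2) hb₂
    (hpt.mono fun s hs => by rw [hQ.map_smul]; exact (hz s hs.2.2.2.2.2).2.2.1)
    (hpt.mono fun s hs => by rw [𝓡.R.proj_smul]; exact hs.2.2.1)
  have hcp : ∀ᶠ s in 𝓝 t, 𝒢.P.proj (z₃ s • c' (l (x s))) = l (x s) :=
    hpt.mono fun s hs => by rw [𝒢.P.proj_smul]; exact hs.2.2.2.1
  have hcq : ∀ᶠ s in 𝓝 t, c s = qP (z₃ s • c' (l (x s))) :=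
    hpt.mono fun s hs => by
      rw [h𝒢bar.quotient_P.map_smul]; exact (hz s hs.2.2.2.2.2).2.2.2
  have h1 : velocity c t = tmap qP (z₃ t • c' (l (x t)))
      (velocity (fun s => z₃ s • c' (l (x s))) t) :=
    (velocity_congr hcq).trans (velocity_comp (h𝒢bar.quotient_P.smooth.smoothNear _) hc₂)
  have h2 : velocity (M := 𝒢.Y.prod 𝒢.Y) (fun s => l (x s)) t =
      tmap 𝒢.P.proj (z₃ t • c' (l (x t))) (velocity (fun s => z₃ s • c' (l (x s))) t) :=
    (velocity_congr (M := 𝒢.Y.prod 𝒢.Y) hcp).symm.trans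
      (velocity_comp (𝒢.P.smoothNear_proj _) hc₂)
  have h3 : velocity (fun s => (l (x s)).1) t =
      (velocity (M := 𝒢.Y.prod 𝒢.Y) (fun s => l (x s)) t).1 := tmap_fst_comp hlx 1
  have h4 : velocity (fun s => (l (x s)).2) t =
      (velocity (M := 𝒢.Y.prod 𝒢.Y) (fun s => l (x s)) t).2 := tmap_snd_comp hlx 1
  have e3 := hred.connection_eq (z₃ t • c' (l (x t)))
    (velocity (fun s => z₃ s • c' (l (x s))) t)
  rw [← h1, ← h2, ← h3, ← h4, ← hcq.self_of_nhds, hcp.self_of_nhds] at e3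
  -- The corrections are `-κ₁ + κ₂ - (κ₂ - κ₁) = 0`, so `key` is what remains.
  rw [e1, e2, e3]
  linarith

end QuotientConnection

end

/-! ### The quotient pseudo `𝕋`-bundle with connection -/

theorem mainTheorem8
    -- a Lie group `G` acting on `M`, freely and locally trivially, with quotient manifold `M/G`
    (G : LCManifold.{u}) [Group G] (hG : IsLieGroup G)
    (M Mbar : LCManifold.{u}) [MulAction G M] (hM : IsSmoothAction G M)
    (q : M → Mbar) (hq : IsPrincipalQuotient G M Mbar q)
    -- a strongly equivariant bundle gerbe with invariant connection and invariant curving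
    (𝒢 : BundleGerbe M) [MulAction G 𝒢.Y] [MulAction G 𝒢.P.total]
    (h𝒢 : IsStronglyEquivariant G 𝒢)
    (A : 𝒢.P.total → 𝒢.P.total.model → ℝ) (hA : IsGerbeConnection 𝒢 A)
    (hAinv : InvariantOneForm G 𝒢.P.total A)
    (f : 𝒢.Y → 𝒢.Y.model → 𝒢.Y.model → ℝ) (hf : IsCurving 𝒢 A f)
    (hfinv : InvariantTwoForm G 𝒢.Y f)
    -- a connection on `M → M/G`, and `λ` with `δλ` the moment of `(P, ∇)` and `(E, ζ) = 0`
    (Ξ : M → M.model → G.model) (hΞ : IsPrincipalConnection G M Ξ)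
    (lam : 𝒢.Y → G.model → ℝ) (hlam : IsDualMap G 𝒢.Y lam)
    (hδlam : IsMoment G 𝒢.P A (fun x X => lam x.2 X - lam x.1 X))
    (hobs : ObstructionVanishes G 𝒢.Y f lam)
    -- the reduction with respect to `λ` and `Ξ`
    (𝒢bar : BundleGerbe Mbar) (qY : 𝒢.Y → 𝒢bar.Y) (qP : 𝒢.P.total → 𝒢bar.P.total)
    (h𝒢bar : IsGerbeQuotient G 𝒢 𝒢bar q qY qP)
    (Abar : 𝒢bar.P.total → 𝒢bar.P.total.model → ℝ) (hAbar : IsGerbeConnection 𝒢bar Abar)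
    (fbar : 𝒢bar.Y → 𝒢bar.Y.model → 𝒢bar.Y.model → ℝ) (hfbar : IsCurving 𝒢bar Abar fbar)
    (hred : IsFormReduction 𝒢 A f Ξ lam 𝒢bar qY qP Abar fbar)
    -- an equivariant pseudo `𝕋`-bundle with invariant connection `η = √-1 H`, its moment and `μ`
    (𝓡 : PseudoTBundle 𝒢) [MulAction G 𝓡.R.total] (h𝓡 : IsEquivariantPseudo G 𝓡)
    (H : 𝓡.R.total → 𝓡.R.total.model → ℝ) (hH : IsPseudoConnection A 𝓡 H)
    (hHinv : InvariantOneForm G 𝓡.R.total H)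
    (ρ : 𝒢.Y → G.model → ℝ) (hρ : IsMoment G 𝓡.R H ρ)
    (μ : M → G.model → ℝ) (hμ : ∀ y X, μ (𝒢.π y) X = ρ y X - lam y X)
    (hμ0 : ∀ x X, μ x X = 0) :
    -- the quotient `R/G` is a pseudo `𝕋`-bundle for the reduction, with a connection that pulls
    -- back to `η - κ`
    ∃ (𝓡bar : PseudoTBundle 𝒢bar) (qR : 𝓡.R.total → 𝓡bar.R.total)
      (Hbar : 𝓡bar.R.total → 𝓡bar.R.total.model → ℝ),
      IsTBundleQuotient G 𝓡.R 𝓡bar.R qY qR ∧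
      (∀ (y₁ y₂ : 𝒢.Y) (a b : 𝓡.R.total) (c : 𝒢.P.total), 𝒢.π y₁ = 𝒢.π y₂ →
        𝓡.v (y₁, y₂) = Tensor.mk a b c →
        𝓡bar.v (qY y₁, qY y₂) = Tensor.mk (qR a) (qR b) (qP c)) ∧
      IsPseudoConnection Abar 𝓡bar Hbar ∧
      (∀ (r : 𝓡.R.total) (h : 𝓡.R.total.model),
        Hbar (qR r) (tmap qR r h) =
          H r h - kappa 𝒢 Ξ lam (𝓡.R.proj r) (tmap 𝓡.R.proj r h)) := by
  have hmom : IsMoment G 𝓡.R H lam := fun r X => by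
    rw [← hρ r X]
    have h1 := hμ (𝓡.R.proj r) X
    rw [hμ0] at h1
    linarith
  obtain ⟨𝓡bar, qR, hQ, hQp, hv⟩ := exists_pseudoTBundle_quotient hG hq h𝒢 h𝒢bar h𝓡
  obtain ⟨Hbar, hHbar, hpull⟩ := hQp.exists_descent hG h𝓡.equivariant_R.smooth
    (isLinearMap_shiftedForm hH.connection.form hΞ hlam)
    (fun s a k hs => smoothNear_shiftedForm_pullback hH.connection.form hΞ hlam hs k)
    (invariant_shiftedForm hG hM h𝒢 hΞ hobs h𝓡 hHinv)
    (shiftedForm_infAct h𝒢 hΞ h𝓡 hmom)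
  exact ⟨𝓡bar, qR, Hbar, hQ, hv,
    ⟨isTConnection_descent h𝓡 hQ hQp hH.connection hΞ hlam hHbar hpull,
      pullbackVanishes_descent hG hq h𝒢 h𝒢bar hred hH hQ hv hpull⟩, hpull⟩
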